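/- **Setting.** Let $\mathfrak F=\bigoplus_{n\ge 0}L^2(\mathbb R^d)^{\otimes_{\rm sym}n}$ be the bosonic Fock space over $L^2(\mathbb R^d)$ and $\mathfrak H=L^2(\mathbb R^d)\otimes\mathfrak F$. For $\alpha>0$ let $a_y,a_y^\dagger$ be the annihilation and creation operators on $\mathfrak F$ (operator-valued distributions), scaled so that $[a_y,a_z^\dagger]=\alpha^{-2}\delta(y-z)$, i.e. $(a_y\Psi)_n(x_1,\dots,x_n)=\alpha^{-1}\sqrt{n+1}\,\Psi_{n+1}(y,x_1,\dots,x_n)$. Let $V\in L^\infty(\mathbb R^d)$ be real-valued and strictly negative (a.e.), with $V(x)\to0$ as $|x|\to\infty$, and let $v\in L^2(\mathbb R^d)$ be real-valued. Let $$H_\alpha^{(V)}=(-\Delta_x+V(x))\otimes\mathbb 1+\mathbb 1\otimes\int a_y^\dagger a_y\,dy+\int v(x-y)\,(a_y^\dagger+a_y)\,dy ,$$ and let $H_\alpha^{(0)}$ be the same operator with $V$ replaced by $0$. These are self-adjoint and bounded from below. For a positive trace-class operator $\Gamma$ on $\mathfrak H$ and $H=H_\alpha^{(V)}$ or $H_\alpha^{(0)}$,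 $\mathrm{Tr}(H\Gamma)\in(-\infty,+\infty]$ denotes $\mathrm{Tr}(\Gamma^{1/2}H\Gamma^{1/2})$ in the sense of quadratic forms. **Localized states.** Let $0\le q\le1$ be a measurable function on $\mathbb R^d$, identified with the multiplication operator. Let $Qf=qf\oplus(1-q^2)^{1/2}f$, let $G(Q)=\bigoplus_nQ^{\otimes n}:\mathfrak F\to\mathfrak F(L^2(\mathbb R^d)\oplus L^2(\mathbb R^d))$, let $U:\mathfrak F(L^2(\mathbb R^d)\oplus L^2(\mathbb R^d))\to\mathfrak F\otimes\mathfrak F$ be the canonical isomorphism, and $Y_q=q\otimes UG(Q):\mathfrak H\to\mathfrak H\otimes\mathfrak F$. For a positive trace-class operator $\Gamma$ on $\mathfrak H$, its $q$-localization is the positive trace-class operator $\Gamma_q=\mathrm{Tr}_{3}\,(Y_q\Gamma Y_q^*)$ on $\mathfrak H$, where $\mathrm{Tr}_3$ is the partial trace over the last factor $\mathfrak F$. Fix smooth functions $\chi,\eta:\mathbb R^d\to[0,1]$ with $\chi^2+\eta^2=1$, $\chi(x)=1$ for $|x|\le1$, $\chi(x)=0$ for $|x|\ge2$, and $\chi$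 non-increasing along rays from the origin (i.e. $\chi(tx)\le\chi(x)$ for $t\ge1$). For $R>0$ put $\chi_R(x)=\chi(x/R)$ and $\eta_R(x)=\eta(x/R)$. **Proposition (Energy localization).** Let $(\Psi_\alpha)_{\alpha>0}$ be a family of normalized vectors in $\mathfrak H$ and $\Gamma_\alpha=|\Psi_\alpha\rangle\langle\Psi_\alpha|$. Assume that there is a constant $C$ with $\mathrm{Tr}(H_\alpha^{(V)}\Gamma_\alpha)\le C$ for all sufficiently large $\alpha$. Let $\Gamma_{\alpha,\chi_R}$ and $\Gamma_{\alpha,\eta_R}$ be the $\chi_R$- and $\eta_R$-localizations of $\Gamma_\alpha$. Then $$\liminf_{\alpha\to\infty}\mathrm{Tr}\big(H_\alpha^{(V)}\Gamma_\alpha\big)\;\ge\;\liminf_{R\to\infty}\,\liminf_{\alpha\to\infty}\Big[\mathrm{Tr}\big(H_\alpha^{(V)}\Gamma_{\alpha,\chi_R}\big)+\mathrm{Tr}\big(H_\alpha^{(0)}\Gamma_{\alpha,\eta_R}\big)\Big].$$ -/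

import Mathlib

open MeasureTheory Filter Topology
open scoped ENNReal ContDiff

namespace Polaron
noncomputable section

/-- The space `ℝ^d`. -/
abbrev Space (d : ℕ) : Type := EuclideanSpace ℝ (Fin d)
/-- Configurations of finitely many (labelled) points: the disjoint union of the `(ℝ^d)^n`, `n ≥ 0`. -/
abbrev Conf (d : ℕ) : Type := Σ n : ℕ, (Fin n → Space d)

/-- Lebesgue measure on each sector `(ℝ^d)^n`; thus `L²(Conf d) = ⨁ₙ L²((ℝ^d)^n)`, the full Fock
space over `L²(ℝ^d)`. -/
instance instMeasureSpaceConf (d : ℕ) : MeasureSpace (Conf d) where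
  volume := Measure.sum fun n =>
    (volume : Measure (Fin n → Space d)).map (Sigma.mk n)

theorem volume_conf (d : ℕ) : (volume : Measure (Conf d)) =
    Measure.sum fun n => (volume : Measure (Fin n → Space d)).map (Sigma.mk n) := rfl

instance instSFiniteConf (d : ℕ) : SFinite (volume : Measure (Conf d)) := by
  rw [volume_conf]; infer_instance

theorem measurable_mk (d n : ℕ) :
    Measurable (fun y : Fin n → Space d => (⟨n, y⟩ : Conf d)) := by
  exact Measurable.of_le_map (iInf_le _ n)

theorem measurable_of_sectors {d : ℕ} {β : Type*} [MeasurableSpace β] {f : Conf d → β}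
    (h : ∀ n, Measurable fun y : Fin n → Space d => f ⟨n, y⟩) : Measurable f := by
  intro s hs
  refine MeasurableSpace.measurableSet_iInf.2 fun n => h n hs

/-- The coordinates of a configuration known to lie in the sector `n` (and `0` otherwise). -/
def sector {d : ℕ} (n : ℕ) (c : Conf d) : Fin n → Space d :=
  if h : c.1 = n then c.2 ∘ Fin.cast h.symm else 0

theorem sector_mk {d n : ℕ} (y : Fin n → Space d) : sector n (⟨n, y⟩ : Conf d) = y := by
  simp [sector]

theorem measurable_sector {d : ℕ} (n : ℕ) : Measurable (sector (d := d) n) := by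
  refine measurable_of_sectors fun m => ?_
  by_cases h : m = n
  · subst h
    simp only [sector_mk]
    exact measurable_id
  · simp only [sector, h, dite_false]
    exact measurable_const

theorem measurable_of_sectors_prod {d : ℕ} {α β : Type*} [MeasurableSpace α] [MeasurableSpace β]
    {f : α × Conf d → β}
    (h : ∀ n, Measurable fun p : α × (Fin n → Space d) => f (p.1, ⟨n, p.2⟩)) : Measurable f := by
  have hfst : Measurable fun c : Conf d => c.1 := measurable_of_sectors fun n => measurable_const
  intro s hs
  have : f ⁻¹' s = ⋃ n, ((fun p : α × Conf d => p.2.1) ⁻¹' {n} ∩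
      (fun p : α × Conf d => f (p.1, ⟨n, sector n p.2⟩)) ⁻¹' s) := by
    ext ⟨a, n, y⟩
    simp only [Set.mem_preimage, Set.mem_iUnion, Set.mem_inter_iff, Set.mem_singleton_iff]
    constructor
    · intro hx
      exact ⟨n, rfl, by simpa [sector_mk] using hx⟩
    · rintro ⟨m, hm, hx⟩
      subst hm
      simpa [sector_mk] using hx
  rw [this]
  refine MeasurableSet.iUnion fun n => ?_
  refine ((hfst.comp measurable_snd) (measurableSet_singleton n)).inter ?_
  exact ((h n).comp (measurable_fst.prodMk ((measurable_sector n).comp measurable_snd))) hs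

theorem lintegral_conf {d : ℕ} {f : Conf d → ℝ≥0∞} (hf : Measurable f) :
    ∫⁻ c, f c = ∑' n, ∫⁻ y : Fin n → Space d, f ⟨n, y⟩ := by
  rw [volume_conf, lintegral_sum_measure]
  congr 1; ext n
  rw [lintegral_map hf (measurable_mk d n)]

theorem ae_conf {d : ℕ} {p : Conf d → Prop} (h : ∀ᵐ c, p c) (n : ℕ) :
    ∀ᵐ y : Fin n → Space d, p ⟨n, y⟩ := by
  rw [volume_conf] at h
  exact ae_of_ae_map (measurable_mk d n).aemeasurable
    (ae_mono (Measure.le_sum _ n) h)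


/-- Concatenation of two configurations. -/
def Conf.cat {d : ℕ} (c c' : Conf d) : Conf d := ⟨c.1 + c'.1, Fin.append c.2 c'.2⟩

/-- Relabelling of the points, by the permutation `τ n` in the sector `n`. -/
def Conf.perm {d : ℕ} (τ : ∀ n, Equiv.Perm (Fin n)) (c : Conf d) : Conf d := ⟨c.1, c.2 ∘ τ c.1⟩

theorem measurePreserving_of_eq {α β : Type*} [MeasurableSpace α] [MeasurableSpace β]
    {μ : Measure α} {ν : Measure β} {f g : α → β} (h : MeasurePreserving f μ ν) (hfg : g = f) :
    MeasurePreserving g μ ν := hfg ▸ h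

theorem measurePreserving_append (d n m : ℕ) :
    MeasurePreserving (fun p : (Fin n → Space d) × (Fin m → Space d) => Fin.append p.1 p.2) := by
  have h1 := volume_measurePreserving_sumPiEquivProdPi_symm
    (fun _ : Fin n ⊕ Fin m => Space d)
  have h2 := volume_measurePreserving_piCongrLeft (fun _ : Fin (n + m) => Space d)
    (finSumFinEquiv (m := n) (n := m))
  have h3 := h2.comp h1
  refine measurePreserving_of_eq h3 (funext fun p => funext fun i => ?_)
  obtain ⟨j, rfl⟩ := (finSumFinEquiv (m := n) (n := m)).surjective i
  simp only [Function.comp_apply]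
  rw [MeasurableEquiv.piCongrLeft]
  simp only [MeasurableEquiv.coe_mk]
  rw [Equiv.piCongrLeft_apply_apply]
  rcases j with j | j
  · simp [MeasurableEquiv.coe_sumPiEquivProdPi_symm]
  · simp [MeasurableEquiv.coe_sumPiEquivProdPi_symm]

theorem measurePreserving_comp_perm (d n : ℕ) (σ : Equiv.Perm (Fin n)) :
    MeasurePreserving (fun y : Fin n → Space d => y ∘ σ) := by
  have h := volume_measurePreserving_piCongrLeft (fun _ : Fin n => Space d) σ.symm
  refine measurePreserving_of_eq h (funext fun y => funext fun i => ?_)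
  obtain ⟨j, rfl⟩ := σ.symm.surjective i
  rw [MeasurableEquiv.piCongrLeft]
  simp only [MeasurableEquiv.coe_mk]
  rw [Equiv.piCongrLeft_apply_apply]
  simp

theorem measurable_cat (d : ℕ) : Measurable fun p : Conf d × Conf d => p.1.cat p.2 := by
  refine measurable_of_sectors_prod fun m => ?_
  have : Measurable fun p : (Fin m → Space d) × Conf d => p.2.cat (⟨m, p.1⟩ : Conf d) :=
    measurable_of_sectors_prod fun n => (measurable_mk d (n + m)).comp
      ((measurePreserving_append d n m).measurable.comp measurable_swap)
  exact this.comp measurable_swap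

theorem measurePreserving_perm (d : ℕ) (τ : ∀ n, Equiv.Perm (Fin n)) :
    MeasurePreserving (Conf.perm (d := d) τ) := by
  have hm : Measurable (Conf.perm (d := d) τ) := measurable_of_sectors fun n =>
    (measurable_mk d n).comp (measurePreserving_comp_perm d n (τ n)).measurable
  refine ⟨hm, ?_⟩
  ext s hs
  rw [Measure.map_apply hm hs, ← lintegral_indicator_one (hm hs), ← lintegral_indicator_one hs,
    lintegral_conf (measurable_one.indicator (hm hs)), lintegral_conf (measurable_one.indicator hs)]
  congr 1
  ext n
  exact (measurePreserving_comp_perm d n (τ n)).lintegral_comp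
    (f := fun y => s.indicator 1 (⟨n, y⟩ : Conf d))
    ((measurable_one.indicator hs).comp (measurable_mk d n))

theorem lintegral_conf_conf {d : ℕ} {G : Conf d × Conf d → ℝ≥0∞} (hG : Measurable G)
    {W : ∀ n m : ℕ, (Fin (n + m) → Space d) → ℝ≥0∞} (hW : ∀ n m, Measurable (W n m))
    (hGW : ∀ n m (y : Fin n → Space d) (z : Fin m → Space d),
      G (⟨n, y⟩, ⟨m, z⟩) = W n m (Fin.append y z)) :
    ∫⁻ c, ∫⁻ c', G (c, c') = ∑' n, ∑' m, ∫⁻ w, W n m w := by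
  rw [lintegral_conf hG.lintegral_prod_right']
  congr 1; ext n
  have h1 : ∀ y : Fin n → Space d, ∫⁻ c', G (⟨n, y⟩, c') =
      ∑' m, ∫⁻ z : Fin m → Space d, W n m (Fin.append y z) := fun y => by
    rw [lintegral_conf (f := fun c' => G (⟨n, y⟩, c')) (hG.comp measurable_prodMk_left)]
    simp_rw [hGW]
  have hm : ∀ m, Measurable fun p : (Fin n → Space d) × (Fin m → Space d) =>
      W n m (Fin.append p.1 p.2) := fun m => (hW n m).comp (measurePreserving_append d n m).measurable
  simp_rw [h1]
  rw [lintegral_tsum fun m => (hm m).lintegral_prod_right'.aemeasurable]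
  congr 1; ext m
  rw [← (measurePreserving_append d n m).lintegral_comp (hW n m), Measure.volume_eq_prod,
    lintegral_prod _ (hm m).aemeasurable]

theorem quasiMeasurePreserving_cat (d : ℕ) :
    Measure.QuasiMeasurePreserving (fun p : Conf d × Conf d => p.1.cat p.2) := by
  refine ⟨measurable_cat d, ?_⟩
  refine Measure.AbsolutelyContinuous.mk fun s hs h0 => ?_
  have h0' : ∀ᵐ c : Conf d, c ∉ s := measure_eq_zero_iff_ae_notMem.1 h0
  have hG : Measurable ((((fun p : Conf d × Conf d => p.1.cat p.2) ⁻¹' s)).indicator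
    (1 : Conf d × Conf d → ℝ≥0∞)) := measurable_one.indicator (measurable_cat d hs)
  have hI : Measurable (s.indicator (1 : Conf d → ℝ≥0∞)) := measurable_one.indicator hs
  rw [Measure.map_apply (measurable_cat d) hs, ← lintegral_indicator_one (measurable_cat d hs),
    Measure.volume_eq_prod, lintegral_prod _ hG.aemeasurable,
    lintegral_conf_conf hG (W := fun n m w => s.indicator 1 (⟨n + m, w⟩ : Conf d))
      (fun n m => hI.comp (measurable_mk d _)) (fun n m y z => rfl)]
  simp only [ENNReal.tsum_eq_zero]
  intro n m
  rw [lintegral_eq_zero_iff (f := fun w => s.indicator 1 (⟨n + m, w⟩ : Conf d))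
    (hI.comp (measurable_mk d _))]
  filter_upwards [ae_conf h0' (n + m)] with w hw
  simp [hw]

theorem exists_perm_lt {N : ℕ} (S : Finset (Fin N)) :
    ∃ σ : Equiv.Perm (Fin N), ∀ i, i ∈ S ↔ (σ i : ℕ) < S.card := by
  classical
  have hc : S.card ≤ N := by simpa using S.card_le_univ
  have e : {x : Fin N // x ∈ S} ≃ {x : Fin N // (x : ℕ) < S.card} := by
    refine Fintype.equivOfCardEq ?_
    rw [Fintype.card_coe, Fintype.card_subtype]
    rw [Fin.card_filter_val_lt]
    omega
  refine ⟨e.extendSubtype, fun i => ⟨fun h => e.extendSubtype_mem i h, fun h => ?_⟩⟩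
  by_contra h'
  exact e.extendSubtype_not_mem i h' h

/-- the sum over all ways of splitting a configuration into two parts -/
theorem lintegral_split {d : ℕ} {a b : Space d → ℝ≥0∞} (ha : Measurable a) (hb : Measurable b)
    (hab : ∀ x, a x + b x = 1) {F : Conf d → ℝ≥0∞} (hF : Measurable F)
    (hsym : ∀ n (σ : Equiv.Perm (Fin n)),
      ∀ᵐ y : Fin n → Space d, F ⟨n, y ∘ σ⟩ = F ⟨n, y⟩) :
    ∫⁻ c : Conf d, ∫⁻ c' : Conf d, ((c.1 + c'.1).choose c.1 : ℝ≥0∞) * (∏ i, a (c.2 i)) *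
      (∏ j, b (c'.2 j)) * F (c.cat c') = ∫⁻ c, F c := by
  classical
  let P : ∀ N : ℕ, ℕ → (Fin N → Space d) → ℝ≥0∞ := fun N k w =>
    (∏ i : Fin N, if (i : ℕ) < k then a (w i) else b (w i)) * F ⟨N, w⟩
  have hP : ∀ N k, Measurable (P N k) := fun N k => by
    refine Measurable.mul (Finset.measurable_prod _ fun i _ => ?_) (hF.comp (measurable_mk d N))
    by_cases h : (i : ℕ) < k
    · simp only [h, if_true]
      exact ha.comp (measurable_pi_apply i)
    · simp only [h, if_false]
      exact hb.comp (measurable_pi_apply i)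
  have hprod : ∀ {f : Space d → ℝ≥0∞}, Measurable f →
      Measurable fun c : Conf d => ∏ i, f (c.2 i) := fun {f} hf =>
    measurable_of_sectors fun n => Finset.measurable_prod (f := fun i (y : Fin n → Space d) => f (y i))
      (Finset.univ : Finset (Fin n)) fun i _ => hf.comp (measurable_pi_apply i)
  have hfst : Measurable fun c : Conf d => c.1 := measurable_of_sectors fun n => measurable_const
  have hG : Measurable fun p : Conf d × Conf d => ((p.1.1 + p.2.1).choose p.1.1 : ℝ≥0∞) *
      (∏ i, a (p.1.2 i)) * (∏ j, b (p.2.2 j)) * F (p.1.cat p.2) := by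
    refine (((?_ : Measurable _).mul ((hprod ha).comp measurable_fst)).mul
      ((hprod hb).comp measurable_snd)).mul (hF.comp (measurable_cat d))
    exact (measurable_from_prod_countable_left (f := fun q : ℕ × ℕ =>
      ((q.1 + q.2).choose q.1 : ℝ≥0∞)) fun _ => measurable_of_countable _).comp
      ((hfst.comp measurable_fst).prodMk (hfst.comp measurable_snd))
  rw [lintegral_conf_conf hG (W := fun n m w => ((n + m).choose n : ℝ≥0∞) * P (n + m) n w)
    (fun n m => (hP _ _).const_mul _) ?_, lintegral_conf hF]
  swap
  · intro n m y z
    simp only [P, Fin.prod_univ_add, Fin.append_left, Fin.append_right, Conf.cat]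
    simp [mul_assoc]
  have hsplit : ∀ N, ∫⁻ w : Fin N → Space d, F ⟨N, w⟩ =
      ∑ q ∈ Finset.HasAntidiagonal.antidiagonal N, ((q.1 + q.2).choose q.1 : ℝ≥0∞) *
        ∫⁻ w : Fin (q.1 + q.2) → Space d, P (q.1 + q.2) q.1 w := by
    intro N
    have h1 : ∀ q ∈ Finset.HasAntidiagonal.antidiagonal N, ((q.1 + q.2).choose q.1 : ℝ≥0∞) *
        ∫⁻ w : Fin (q.1 + q.2) → Space d, P (q.1 + q.2) q.1 w =
        (N.choose q.1 : ℝ≥0∞) * ∫⁻ w : Fin N → Space d, P N q.1 w := by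
      intro q hq
      obtain rfl := Finset.HasAntidiagonal.mem_antidiagonal.1 hq
      rfl
    rw [Finset.sum_congr rfl h1,
      Finset.Nat.sum_antidiagonal_eq_sum_range_succ_mk]
    have h2 := Finset.sum_powerset_apply_card (fun k => ∫⁻ w : Fin N → Space d, P N k w)
      (x := (Finset.univ : Finset (Fin N)))
    simp only [Finset.card_univ, Fintype.card_fin, nsmul_eq_mul] at h2
    rw [← h2]
    have hQ : ∀ S : Finset (Fin N), Measurable fun w : Fin N → Space d =>
        (∏ i ∈ S, a (w i)) * (∏ i ∈ Finset.univ \ S, b (w i)) * F ⟨N, w⟩ := fun S =>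
      ((Finset.measurable_prod (f := fun i (w : Fin N → Space d) => a (w i)) _
        fun i _ => ha.comp (measurable_pi_apply i)).mul
        (Finset.measurable_prod (f := fun i (w : Fin N → Space d) => b (w i)) _
        fun i _ => hb.comp (measurable_pi_apply i))).mul (hF.comp (measurable_mk d N))
    have h3 : ∀ S : Finset (Fin N), ∫⁻ w : Fin N → Space d, P N S.card w =
        ∫⁻ w : Fin N → Space d, (∏ i ∈ S, a (w i)) * (∏ i ∈ Finset.univ \ S, b (w i)) * F ⟨N, w⟩ := by
      intro S
      obtain ⟨σ, hσ⟩ := exists_perm_lt S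
      rw [← (measurePreserving_comp_perm d N σ).lintegral_comp
        (f := fun w => (∏ i ∈ S, a (w i)) * (∏ i ∈ Finset.univ \ S, b (w i)) * F ⟨N, w⟩) ?_]
      · refine lintegral_congr_ae ?_
        filter_upwards [hsym N σ] with w hw
        simp only [P, hw]
        congr 1
        rw [← Equiv.prod_comp σ, ← Finset.prod_mul_prod_compl S, Finset.compl_eq_univ_sdiff]
        congr 1
        · refine Finset.prod_congr rfl fun i hi => ?_
          rw [if_pos ((hσ i).1 hi)]
          rfl
        · refine Finset.prod_congr rfl fun i hi => ?_
          rw [if_neg fun h => (Finset.mem_sdiff.1 hi).2 ((hσ i).2 h)]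
          rfl
      · exact hQ S
    rw [Finset.sum_congr rfl fun S _ => h3 S, ← lintegral_finsetSum _ fun S _ => ?_]
    · refine lintegral_congr fun w => ?_
      rw [← Finset.sum_mul, ← Finset.prod_add]
      simp [hab]
    · exact hQ S
  simp_rw [hsplit]
  simp_rw [lintegral_const_mul _ (hP _ _)]
  rw [← ENNReal.tsum_prod (f := fun n m => ((n + m).choose n : ℝ≥0∞) *
    ∫⁻ w : Fin (n + m) → Space d, P (n + m) n w),
    ← Finset.HasAntidiagonal.sigmaAntidiagonalEquivProd.tsum_eq, ENNReal.tsum_sigma']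
  congr 1; ext N
  rw [tsum_fintype, ← Finset.sum_coe_sort (Finset.HasAntidiagonal.antidiagonal N)]
  rfl

/-- The bosonic Fock space `⨁ₙ L²(ℝ^d)^{⊗_sym n}`: the functions in `L²(Conf d)` that are symmetric in
each sector. -/
def Fock (d : ℕ) : Submodule ℂ (Lp ℂ 2 (volume : Measure (Conf d))) :=
  ⨅ τ : ∀ n, Equiv.Perm (Fin n), LinearMap.eqLocus
    (Lp.compMeasurePreservingₗᵢ ℂ (Conf.perm τ) (measurePreserving_perm d τ)).toLinearMap
    LinearMap.id

theorem measurePreserving_id_perm (d : ℕ) (τ : ∀ n, Equiv.Perm (Fin n)) :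
    MeasurePreserving (Prod.map id (Conf.perm τ) : Space d × Conf d → Space d × Conf d) :=
  (MeasurePreserving.id volume).prod (measurePreserving_perm d τ)

/-- The Hilbert space `L²(ℝ^d) ⊗ 𝔉 = ⨁ₙ L²(ℝ^d) ⊗ L²(ℝ^d)^{⊗_sym n}` of particle and field: the
functions `Ψ(x, c)` in `L²(ℝ^d × Conf d)` that are symmetric in the field configuration `c`. -/
def Hil (d : ℕ) : Submodule ℂ (Lp ℂ 2 (volume : Measure (Space d × Conf d))) :=
  ⨅ τ : ∀ n, Equiv.Perm (Fin n), LinearMap.eqLocus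
    (Lp.compMeasurePreservingₗᵢ ℂ (Prod.map id (Conf.perm τ))
      (measurePreserving_id_perm d τ)).toLinearMap
    LinearMap.id

instance instCompleteFock (d : ℕ) : CompleteSpace (Fock d) := by
  have h : IsClosed (Fock d : Set (Lp ℂ 2 (volume : Measure (Conf d)))) := by
    rw [Fock, Submodule.coe_iInf]
    exact isClosed_iInter fun τ => isClosed_eq
      (Lp.compMeasurePreservingₗᵢ ℂ (Conf.perm τ) (measurePreserving_perm d τ)).continuous
      continuous_id
  exact h.completeSpace_coe

instance instCompleteHil (d : ℕ) : CompleteSpace (Hil d) := by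
  have h : IsClosed (Hil d : Set (Lp ℂ 2 (volume : Measure (Space d × Conf d)))) := by
    rw [Hil, Submodule.coe_iInf]
    exact isClosed_iInter fun τ => isClosed_eq
      (Lp.compMeasurePreservingₗᵢ ℂ _ (measurePreserving_id_perm d τ)).continuous
      continuous_id
  exact h.completeSpace_coe

theorem Hil_symm {d : ℕ} (Ψ : Hil d) (n : ℕ) (σ : Equiv.Perm (Fin n)) :
    ∀ᵐ x : Space d, ∀ᵐ y : Fin n → Space d,
      Ψ.1 (x, ⟨n, y ∘ σ⟩) = Ψ.1 (x, ⟨n, y⟩) := by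
  classical
  let τ : ∀ n, Equiv.Perm (Fin n) := Function.update (fun n => 1) n σ
  have h := (Submodule.mem_iInf _).1 Ψ.2 τ
  have h' : Lp.compMeasurePreserving (Prod.map id (Conf.perm τ))
      (measurePreserving_id_perm d τ) Ψ.1 = Ψ := h
  have h1 := Lp.coeFn_compMeasurePreserving Ψ.1 (measurePreserving_id_perm d τ)
  rw [h'] at h1
  filter_upwards [Measure.ae_ae_of_ae_prod h1] with x hx
  filter_upwards [ae_conf hx n] with y hy
  rw [hy]
  simp [Conf.perm, τ]

/-- Elementary tensor -/
theorem enorm_tensor {A B : Type*} [MeasureSpace A] [MeasureSpace B]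
    [SFinite (volume : Measure B)]
    (u : Lp ℂ 2 (volume : Measure A)) (g : Lp ℂ 2 (volume : Measure B)) :
    eLpNorm (fun p : A × B => u p.1 * g p.2) 2 volume = ‖u‖ₑ * ‖g‖ₑ := by
  have hu := (Lp.stronglyMeasurable u).measurable
  have hg := (Lp.stronglyMeasurable g).measurable
  rw [Lp.enorm_def, Lp.enorm_def, eLpNorm_eq_lintegral_rpow_enorm_toReal (by simp) (by simp),
    eLpNorm_eq_lintegral_rpow_enorm_toReal (by simp) (by simp),
    eLpNorm_eq_lintegral_rpow_enorm_toReal (by simp) (by simp),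
    ← ENNReal.mul_rpow_of_nonneg _ _ (by simp)]
  congr 1
  simp_rw [enorm_mul, ENNReal.mul_rpow_of_nonneg _ _ (ENNReal.toReal_nonneg)]
  exact lintegral_prod_mul (hu.enorm.pow_const _).aemeasurable (hg.enorm.pow_const _).aemeasurable

theorem memLp_tensor {A B : Type*} [MeasureSpace A] [MeasureSpace B]
    [SFinite (volume : Measure B)]
    (u : Lp ℂ 2 (volume : Measure A)) (g : Lp ℂ 2 (volume : Measure B)) :
    MemLp (fun p : A × B => u p.1 * g p.2) 2 volume := by
  have hu := (Lp.stronglyMeasurable u).measurable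
  have hg := (Lp.stronglyMeasurable g).measurable
  refine ⟨((hu.comp measurable_fst).mul (hg.comp measurable_snd)).aestronglyMeasurable, ?_⟩
  rw [enorm_tensor]
  exact ENNReal.mul_lt_top enorm_lt_top enorm_lt_top

/-- The map `u ↦ u ⊗ g`, where `(u ⊗ g)(x, y) = u(x) g(y)`. -/
def tensorRight {A B : Type*} [MeasureSpace A] [MeasureSpace B]
    [SFinite (volume : Measure A)] [SFinite (volume : Measure B)]
    (g : Lp ℂ 2 (volume : Measure B)) :
    Lp ℂ 2 (volume : Measure A) →L[ℂ] Lp ℂ 2 (volume : Measure (A × B)) :=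
  LinearMap.mkContinuous
    { toFun := fun u => (memLp_tensor u g).toLp
      map_add' := fun u w => by
        rw [← MemLp.toLp_add, MemLp.toLp_eq_toLp_iff]
        have h := Measure.quasiMeasurePreserving_fst (μ := (volume : Measure A))
          (ν := (volume : Measure B)) |>.ae (Lp.coeFn_add u w)
        filter_upwards [h] with p hp
        simp only [hp, Pi.add_apply]
        ring
      map_smul' := fun z u => by
        rw [RingHom.id_apply, ← MemLp.toLp_const_smul, MemLp.toLp_eq_toLp_iff]
        have h := Measure.quasiMeasurePreserving_fst (μ := (volume : Measure A))
          (ν := (volume : Measure B)) |>.ae (Lp.coeFn_smul z u)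
        filter_upwards [h] with p hp
        simp only [hp, Pi.smul_apply, smul_eq_mul]
        ring }
    ‖g‖ fun u => by
      refine le_of_eq ?_
      simp only [LinearMap.coe_mk, AddHom.coe_mk, Lp.norm_toLp, enorm_tensor, ENNReal.toReal_mul,
        toReal_enorm]
      ring

/-- A (measurable) function `0 ≤ q ≤ 1`; it stands for the multiplication operator by `q` on `L²(ℝ^d)`. -/
structure Cutoff (d : ℕ) where
  toFun : Space d → ℝ
  measurable : Measurable toFun
  nonneg : ∀ x, 0 ≤ toFun x
  le_one : ∀ x, toFun x ≤ 1

/-- The function `((q ⊗ U G(Q)) Ψ)((x, c), e)`, with `Q f = q f ⊕ (1 - q²)^{1/2} f`, with `G(Q) = ⨁ₙ Q^{⊗ n}` and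
with `U : 𝔉(L² ⊕ L²) → 𝔉(L²) ⊗ 𝔉(L²)` the canonical isomorphism. On symmetric functions `U` restricts
the sector `n + m` to the first `n` variables in the first copy of `L²` and the last `m` variables in
the second copy, times the square root of the binomial coefficient `n + m` over `n`. -/
def splitFun {d : ℕ} (q : Cutoff d) (Ψ : Space d × Conf d → ℂ)
    (p : (Space d × Conf d) × Conf d) : ℂ :=
  ((q.toFun p.1.1 * √((p.1.2.1 + p.2.1).choose p.1.2.1) * (∏ i, q.toFun (p.1.2.2 i)) *
    ∏ j, √(1 - q.toFun (p.2.2 j) ^ 2) : ℝ) : ℂ) * Ψ (p.1.1, p.1.2.cat p.2)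

theorem quasiMeasurePreserving_assoc_cat (d : ℕ) :
    Measure.QuasiMeasurePreserving (fun p : (Space d × Conf d) × Conf d =>
      (p.1.1, p.1.2.cat p.2)) :=
  (QuasiMeasurePreserving.prodMap (Measure.QuasiMeasurePreserving.id volume)
    (quasiMeasurePreserving_cat d)).comp
    (volume_preserving_prodAssoc (α₁ := Space d) (β₁ := Conf d)
      (γ₁ := Conf d)).quasiMeasurePreserving

theorem measurable_prod_conf {d : ℕ} {M : Type*} [CommMonoid M] [MeasurableSpace M]
    [MeasurableMul₂ M] {f : Space d → M} (hf : Measurable f) :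
    Measurable fun c : Conf d => ∏ i, f (c.2 i) :=
  measurable_of_sectors fun n => Finset.measurable_prod (f := fun i (y : Fin n → Space d) => f (y i))
    (Finset.univ : Finset (Fin n)) fun i _ => hf.comp (measurable_pi_apply i)

theorem measurable_splitFun {d : ℕ} (q : Cutoff d) {Ψ : Space d × Conf d → ℂ}
    (hΨ : Measurable Ψ) : Measurable (splitFun q Ψ) := by
  have hfst : Measurable fun c : Conf d => c.1 := measurable_of_sectors fun n => measurable_const
  have hch : Measurable fun p : (Space d × Conf d) × Conf d =>
      √((p.1.2.1 + p.2.1).choose p.1.2.1 : ℝ) :=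
    (measurable_from_prod_countable_left (f := fun r : ℕ × ℕ =>
      √((r.1 + r.2).choose r.1 : ℝ)) fun _ => measurable_of_countable _).comp
      ((hfst.comp (measurable_snd.comp measurable_fst)).prodMk (hfst.comp measurable_snd))
  refine (Complex.measurable_ofReal.comp ((((q.measurable.comp
    (measurable_fst.comp measurable_fst)).mul hch).mul ((measurable_prod_conf q.measurable).comp
    (measurable_snd.comp measurable_fst))).mul ((measurable_prod_conf
    (f := fun x => √(1 - q.toFun x ^ 2)) ?_).comp measurable_snd))).mul
    (hΨ.comp (quasiMeasurePreserving_assoc_cat d).measurable)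
  exact (measurable_const.sub (q.measurable.pow_const 2)).sqrt

theorem lintegral_volume_prod {A B : Type*} [MeasureSpace A] [MeasureSpace B]
    [SFinite (volume : Measure B)] {f : A × B → ℝ≥0∞} (hf : Measurable f) :
    ∫⁻ p, f p = ∫⁻ x, ∫⁻ y, f (x, y) := by
  rw [Measure.volume_eq_prod, lintegral_prod _ hf.aemeasurable]

theorem lintegral_splitFun_le {d : ℕ} (q : Cutoff d) (Ψ : Hil d) :
    ∫⁻ p, ‖splitFun q Ψ.1 p‖ₑ ^ 2 ≤ ∫⁻ p, ‖Ψ.1 p‖ₑ ^ 2 := by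
  have hm : Measurable (Ψ.1 : Space d × Conf d → ℂ) := (Lp.stronglyMeasurable _).measurable
  have hq := q.measurable
  have hq0 := q.nonneg
  have hq1 : ∀ x, 0 ≤ 1 - q.toFun x ^ 2 := fun x => by
    nlinarith [q.nonneg x, q.le_one x]
  have hS := (measurable_splitFun q hm).enorm.pow_const 2
  have hbm : Measurable fun x => ENNReal.ofReal (1 - q.toFun x ^ 2) :=
    (measurable_const.sub (hq.pow_const 2)).ennreal_ofReal
  rw [lintegral_volume_prod hS, lintegral_volume_prod hS.lintegral_prod_right',
    lintegral_volume_prod (hm.enorm.pow_const 2)]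
  refine lintegral_mono_ae ?_
  filter_upwards [ae_all_iff.2 fun n => ae_all_iff.2 fun σ => Hil_symm Ψ n σ] with x hx
  have hF : Measurable fun c => ‖Ψ.1 (x, c)‖ₑ ^ 2 :=
    (hm.comp measurable_prodMk_left).enorm.pow_const 2
  have key := lintegral_split (a := fun x => ENNReal.ofReal (q.toFun x ^ 2))
    (b := fun x => ENNReal.ofReal (1 - q.toFun x ^ 2)) (hq.pow_const 2).ennreal_ofReal hbm
    (fun x => by rw [← ENNReal.ofReal_add (by positivity) (hq1 x)]; simp) hF
    (fun n σ => (hx n σ).mono fun y hy => by simp only [hy])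
  rw [← key]
  refine lintegral_mono fun c => lintegral_mono fun c' => ?_
  have e1 : ‖splitFun q Ψ.1 ((x, c), c')‖ₑ ^ 2 = ENNReal.ofReal (q.toFun x ^ 2) *
      (((c.1 + c'.1).choose c.1 : ℝ≥0∞) * (∏ i, ENNReal.ofReal (q.toFun (c.2 i) ^ 2)) *
      (∏ j, ENNReal.ofReal (1 - q.toFun (c'.2 j) ^ 2)) * ‖Ψ.1 (x, c.cat c')‖ₑ ^ 2) := by
    have hr : ∀ r : ℝ, ‖(r : ℂ)‖ₑ ^ 2 = ENNReal.ofReal (r ^ 2) := fun r => by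
      rw [← ofReal_norm, ← ENNReal.ofReal_pow (norm_nonneg _), Complex.norm_real,
        Real.norm_eq_abs, sq_abs]
    rw [splitFun, enorm_mul, mul_pow, hr, mul_pow, mul_pow, mul_pow, ← Finset.prod_pow,
      ← Finset.prod_pow, Real.sq_sqrt (by positivity)]
    simp_rw [Real.sq_sqrt (hq1 _)]
    rw [ENNReal.ofReal_mul (by positivity), ENNReal.ofReal_mul (by positivity),
      ENNReal.ofReal_mul (by positivity), ENNReal.ofReal_natCast,
      ENNReal.ofReal_prod_of_nonneg fun i _ => by positivity,
      ENNReal.ofReal_prod_of_nonneg fun i _ => hq1 _]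
    ring
  rw [e1]
  refine mul_le_of_le_one_left' ?_
  rw [← ENNReal.ofReal_one]
  exact ENNReal.ofReal_le_ofReal (by nlinarith [q.nonneg x, q.le_one x])

theorem eLpNorm_splitFun_le {d : ℕ} (q : Cutoff d) (Ψ : Hil d) :
    eLpNorm (splitFun q Ψ.1) 2 volume ≤ ‖Ψ‖ₑ := by
  have h : ‖Ψ‖ₑ = eLpNorm Ψ.1 2 volume := by rw [← Lp.enorm_def]; rfl
  rw [h, eLpNorm_eq_lintegral_rpow_enorm_toReal (by simp) (by simp),
    eLpNorm_eq_lintegral_rpow_enorm_toReal (by simp) (by simp)]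
  refine ENNReal.rpow_le_rpow ?_ (by simp)
  simpa using lintegral_splitFun_le q Ψ

theorem memLp_splitFun {d : ℕ} (q : Cutoff d) (Ψ : Hil d) :
    MemLp (splitFun q Ψ.1) 2 volume :=
  ⟨(measurable_splitFun q (Lp.stronglyMeasurable _).measurable).aestronglyMeasurable,
    (eLpNorm_splitFun_le q Ψ).trans_lt enorm_lt_top⟩

/-- The bounded operator `q ⊗ U G(Q)`, from `L²(ℝ^d) ⊗ 𝔉` to `L²(ℝ^d) ⊗ 𝔉 ⊗ 𝔉`, see `splitFun`. -/
def split {d : ℕ} (q : Cutoff d) :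
    Hil d →L[ℂ] Lp ℂ 2 (volume : Measure ((Space d × Conf d) × Conf d)) :=
  LinearMap.mkContinuous
    { toFun := fun Ψ => (memLp_splitFun q Ψ).toLp
      map_add' := fun u w => by
        rw [← MemLp.toLp_add, MemLp.toLp_eq_toLp_iff]
        have h := (quasiMeasurePreserving_assoc_cat d).ae
          (Lp.coeFn_add (u : Lp ℂ 2 (volume : Measure (Space d × Conf d))) w)
        filter_upwards [h] with p hp
        simp only [splitFun, Submodule.coe_add, hp, Pi.add_apply]
        ring
      map_smul' := fun z u => by
        rw [RingHom.id_apply, ← MemLp.toLp_const_smul, MemLp.toLp_eq_toLp_iff]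
        have h := (quasiMeasurePreserving_assoc_cat d).ae
          (Lp.coeFn_smul z (u : Lp ℂ 2 (volume : Measure (Space d × Conf d))))
        filter_upwards [h] with p hp
        simp only [splitFun, Submodule.coe_smul, hp, Pi.smul_apply, smul_eq_mul]
        ring }
    1 fun u => by
      simp only [LinearMap.coe_mk, AddHom.coe_mk, Lp.norm_toLp, one_mul]
      rw [← toReal_enorm]
      exact ENNReal.toReal_mono enorm_ne_top (eLpNorm_splitFun_le q u)

/-- A Hilbert basis. -/
def stdBasis (H : Type) [NormedAddCommGroup H] [InnerProductSpace ℂ H] [CompleteSpace H] :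
    HilbertBasis (exists_hilbertBasis ℂ H).choose ℂ H :=
  (exists_hilbertBasis ℂ H).choose_spec.choose

/-- The operator `(1 ⊗ 1 ⊗ ⟨g|) (q ⊗ U G(Q))` on `L²(ℝ^d) ⊗ 𝔉`. -/
def kraus {d : ℕ} (q : Cutoff d) (g : Fock d) : Hil d →L[ℂ] Hil d :=
  (tensorRight (g : Lp ℂ 2 (volume : Measure (Conf d))) ∘L (Hil d).subtypeL).adjoint ∘L split q

/-- The `q`-localization `Γ_q` of `Γ`: the partial trace of
`(q ⊗ U G(Q)) Γ (q ⊗ U G(Q))^*` over the last factor of `L²(ℝ^d) ⊗ 𝔉 ⊗ 𝔉`. It is the operator with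
`Tr ((A ⊗ B) Γ_q) = Tr ((1 ⊗ U G(Q))^* (q A q ⊗ B ⊗ 1) (1 ⊗ U G(Q)) Γ)`. -/
def localize {d : ℕ} (q : Cutoff d) (Γ : Hil d →L[ℂ] Hil d) : Hil d →L[ℂ] Hil d :=
  ∑' j, kraus q (stdBasis (Fock d) j) ∘L Γ ∘L (kraus q (stdBasis (Fock d) j)).adjoint

/-- `Tr (H Γ) = Tr (Γ^{1/2} H Γ^{1/2}) = ∑ᵢ h (Γ^{1/2} eᵢ)` for a positive trace-class `Γ` and a
self-adjoint operator `H`, bounded from below, with quadratic form `h` (equal to `+∞` outside the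
form domain). The value does not depend on the Hilbert basis `(eᵢ)`. For `Γ = |Ψ⟩⟨Ψ|`,
`‖Ψ‖ = 1`, it is `h Ψ`; for `Γ = ∑ⱼ |Φⱼ⟩⟨Φⱼ|` it is `∑ⱼ h Φⱼ`. -/
def traceForm {H : Type} [NormedAddCommGroup H] [InnerProductSpace ℂ H] [CompleteSpace H]
    (h : H → EReal) (Γ : H →L[ℂ] H) : EReal :=
  ∑' i, h (CFC.sqrt Γ (stdBasis H i))

/-- Adding a point in front of a configuration. -/
def Conf.cons {d : ℕ} (y : Space d) (c : Conf d) : Conf d := ⟨c.1 + 1, Fin.cons y c.2⟩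

/-- The annihilation operator `a_y` at the point `y`, in the scaling
`[a_y, a_z^*] = α^{-2} δ(y - z)`; thus `a(f) = ∫ conj (f y) a_y dy` acts as
`(a(f) Ψ)(x, x₁, …, xₙ) = α^{-1} (n + 1)^{1/2} ∫ conj (f y) Ψ(x, y, x₁, …, xₙ) dy`. -/
def annih {d : ℕ} (α : ℝ) (Ψ : Space d × Conf d → ℂ) (y : Space d) (p : Space d × Conf d) : ℂ :=
  ((α⁻¹ * √(p.2.1 + 1) : ℝ) : ℂ) * Ψ (p.1, p.2.cons y)

/-- `G` is the weak gradient of `Ψ` in the particle variable `x`. -/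
def IsWeakGradient {d : ℕ} (Ψ : Space d × Conf d → ℂ)
    (G : Fin d → Lp ℂ 2 (volume : Measure (Space d × Conf d))) : Prop :=
  ∀ (j : Fin d) (φ : Space d → ℝ), ContDiff ℝ ∞ φ → HasCompactSupport φ → ∀ᵐ c : Conf d,
    ∫ x, (fderiv ℝ φ x (EuclideanSpace.single j 1) : ℂ) * Ψ (x, c) = -∫ x, (φ x : ℂ) * G j (x, c)

/-- `⟨Ψ, (-Δ_x ⊗ 1) Ψ⟩ = ‖∇_x Ψ‖²`, equal to `∞` if `Ψ` has no weak gradient in `L²`; the infimum is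
over a set with at most one element. -/
def kinetic {d : ℕ} (Ψ : Hil d) : ℝ≥0∞ :=
  ⨅ (G : Fin d → Lp ℂ 2 (volume : Measure (Space d × Conf d))) (_ : IsWeakGradient Ψ.1 G),
    ∑ j, ‖G j‖ₑ ^ 2

/-- `⟨Ψ, (1 ⊗ N_α) Ψ⟩`, where `N_α = ∫ a_y^* a_y dy`. -/
def number {d : ℕ} (α : ℝ) (Ψ : Hil d) : ℝ≥0∞ :=
  ∫⁻ y : Space d, ∫⁻ p : Space d × Conf d, ‖annih α Ψ.1 y p‖ₑ ^ 2

/-- `⟨Ψ, (V ⊗ 1) Ψ⟩`. -/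
def potential {d : ℕ} (V : Space d → ℝ) (Ψ : Hil d) : ℝ :=
  ∫ p : Space d × Conf d, V p.1 * ‖Ψ.1 p‖ ^ 2

/-- `⟨Ψ, ∫ v(x - y) (a_y^* + a_y) dy Ψ⟩ = 2 Re ∫ v(x - y) ⟨Ψ(x), a_y Ψ(x)⟩_𝔉 dx dy` for real-valued `v`;
the integral converges absolutely if `v ∈ L²` and `number α Ψ < ∞`. -/
def interaction {d : ℕ} (α : ℝ) (v : Space d → ℝ) (Ψ : Hil d) : ℝ :=
  2 * (∫ r : Space d × (Space d × Conf d),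
    (v (r.2.1 - r.1) : ℂ) * (starRingEnd ℂ (Ψ.1 r.2) * annih α Ψ.1 r.1 r.2)).re

/-- The quadratic form of
`H_α^{(V)} = (-Δ_x + V) ⊗ 1 + 1 ⊗ N_α + ∫ v(x - y) (a_y^* + a_y) dy`,
with value `+∞` outside the form domain of `-Δ_x ⊗ 1 + 1 ⊗ N_α`. -/
def energy {d : ℕ} (α : ℝ) (V v : Space d → ℝ) (Ψ : Hil d) : EReal :=
  (kinetic Ψ : EReal) + (number α Ψ : EReal) + ((potential V Ψ + interaction α v Ψ : ℝ) : EReal)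

/-- The rank-one operator `|Ψ⟩⟨Ψ|`. -/
def pureState {d : ℕ} (Ψ : Hil d) : Hil d →L[ℂ] Hil d := InnerProductSpace.rankOne ℂ Ψ Ψ

/-- A smooth partition of unity `χ² + η² = 1` with `χ = 1` on the unit ball, `χ = 0` outside the ball
of radius `2`, and `χ` (hence also `η`) monotone along rays from the origin. -/
structure SmoothPartition (d : ℕ) where
  χ : Space d → ℝ
  η : Space d → ℝ
  χ_smooth : ContDiff ℝ ∞ χ
  η_smooth : ContDiff ℝ ∞ η
  χ_nonneg : ∀ x, 0 ≤ χ x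
  η_nonneg : ∀ x, 0 ≤ η x
  sq_add_sq : ∀ x, χ x ^ 2 + η x ^ 2 = 1
  χ_eq_one : ∀ x, ‖x‖ ≤ 1 → χ x = 1
  χ_eq_zero : ∀ x, 2 ≤ ‖x‖ → χ x = 0
  χ_antitone : ∀ x (t : ℝ), 1 ≤ t → χ (t • x) ≤ χ x

/-- `χ_R(x) = χ(x / R)`. -/
def SmoothPartition.inside {d : ℕ} (P : SmoothPartition d) (R : ℝ) : Cutoff d where
  toFun x := P.χ (R⁻¹ • x)
  measurable := (P.χ_smooth.continuous.comp (continuous_const_smul _)).measurable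
  nonneg x := P.χ_nonneg _
  le_one x := by nlinarith [P.sq_add_sq (R⁻¹ • x), sq_nonneg (P.η (R⁻¹ • x))]

/-- `η_R(x) = η(x / R)`. -/
def SmoothPartition.outside {d : ℕ} (P : SmoothPartition d) (R : ℝ) : Cutoff d where
  toFun x := P.η (R⁻¹ • x)
  measurable := (P.η_smooth.continuous.comp (continuous_const_smul _)).measurable
  nonneg x := P.η_nonneg _
  le_one x := by nlinarith [P.sq_add_sq (R⁻¹ • x), sq_nonneg (P.χ (R⁻¹ • x))]

end
end Polaron

/-! The proof is an IMS localization in the particle and in the field at once, followed by a choice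
of the radius by pigeonhole.

Adding `energyShift v m = ‖v‖² + m`, with `|V| ≤ m`, turns the form of `H` into a sum of squares:
`‖∇Ψ‖²`, `∫ ‖(a_y + v(x-y))Ψ‖² dy` and `⟨Ψ, (V + m)Ψ⟩` (`energy_eq`). The localization of a pure
state is a sum of rank-one operators over Kraus vectors `kraus q (b j) Ψ`, and the square root that
enters `traceForm` turns these into `kraus q (w i) Ψ` for a Bessel family `w`
(`exists_traceForm_localize_eq`). As `U G(Q)` is an isometry and Bessel's inequality holds
pointwise, each square of a localized state is at most the square of a function cut off by `q`; the
total mass, which the negative shift multiplies, is computed exactly. In the field term `a_y` passes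
through `U G(Q)` and becomes `q(y) a_y` (`fockSplit_annih`).

It remains to compare squares for `χ_R` and `η_R` with those of `Ψ`. The gradient costs `O(R⁻²)`,
because `χ∇χ + η∇η = 0`. Replacing `V` by `0` outside costs `sup_{|x| ≥ R} (-V)`. In the field term
the cross terms change by the factor `D(x,y) = 1 - χ(x)²χ(y) - η(x)²η(y)` (`defect`). By Young's
inequality this costs `ε` times the number of field quanta, which the energy bounds, plus `ε⁻¹ ∫
|v(x-y)|² D² |Ψ|²`. If `x` and `y` are close, `D` is small unless `x` lies in the shell `R ≤ |x| ≤
2R`, where `1 - χ³ - η³` need not be small; if they are far apart, the tail of `v` is small. Hence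
everything is controlled except the mass of `Ψ` in the shell (`exists_traceForm_localize_add_le`).

That mass need not vanish at a given radius. Among `n` disjoint shells of radii `4^k S`, however,
one carries mass at most `1/n`. The index `k` depends on `α` but ranges over a finite set, so a
single `k` serves arbitrarily large `α`. This gives arbitrarily large radii at which the inner
`liminf` is small, which is what the outer `liminf` over `R` requires (`liminf_localize_le`). -/

namespace Polaron
noncomputable section

/-! ### Hilbert space preliminaries: square roots, Bessel families, traces -/

/-- A majorized operator factors through its majorant (Douglas). -/
theorem exists_contraction_comp_eq {H K L : Type*} [NormedAddCommGroup H] [InnerProductSpace ℂ H]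
    [NormedAddCommGroup K] [InnerProductSpace ℂ K] [CompleteSpace K]
    [NormedAddCommGroup L] [InnerProductSpace ℂ L] [CompleteSpace L]
    (A : H →L[ℂ] K) (B : H →L[ℂ] L) (h : ∀ u, ‖A u‖ ≤ ‖B u‖) :
    ∃ U : L →L[ℂ] K, (∀ x, ‖U x‖ ≤ ‖x‖) ∧ ∀ u, A u = U (B u) := by
  let M : Submodule ℂ L := (LinearMap.range B.toLinearMap).topologicalClosure
  have hM : ∀ u, B u ∈ M := fun u => Submodule.le_topologicalClosure _ ⟨u, rfl⟩
  have : CompleteSpace M :=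
    (Submodule.isClosed_topologicalClosure (LinearMap.range B.toLinearMap)).completeSpace_coe
  let B' : H →ₗ[ℂ] M := B.toLinearMap.codRestrict M hM
  have hd : DenseRange B' := by
    intro x
    rw [Topology.IsInducing.subtypeVal.closure_eq_preimage_closure_image]
    have : Subtype.val '' Set.range B' = (LinearMap.range B.toLinearMap : Set L) := by
      ext y
      constructor
      · rintro ⟨_, ⟨u, rfl⟩, rfl⟩
        exact ⟨u, rfl⟩
      · rintro ⟨u, rfl⟩
        exact ⟨B' u, ⟨u, rfl⟩, rfl⟩
    refine (?_ : (x : L) ∈ closure (Subtype.val '' Set.range B'))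
    rw [this]
    exact x.2
  have hn : ∀ u, ‖A.toLinearMap u‖ ≤ 1 * ‖B' u‖ := fun u => by
    rw [one_mul]; exact h u
  refine ⟨A.toLinearMap.extendOfNorm B' ∘L M.orthogonalProjectionOnto, fun x => ?_, fun u => ?_⟩
  · refine (LinearMap.norm_extendOfNorm_apply_le hd 1 hn _).trans ?_
    rw [one_mul]
    exact M.norm_orthogonalProjectionOnto_apply_le x
  · have e : M.orthogonalProjectionOnto (B u) = B' u :=
      M.orthogonalProjectionOnto_mem_subspace_eq_self (B' u)
    rw [ContinuousLinearMap.comp_apply, e, LinearMap.extendOfNorm_eq hd ⟨1, hn⟩]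
    rfl

/-- Distinct basis vectors are at distance `√2`, so balls of radius `1/2` around them are disjoint.
Countability is needed to exchange sums over a basis with integrals. -/
theorem countable_of_hilbertBasis {ι H : Type*} [NormedAddCommGroup H] [InnerProductSpace ℂ H]
    [SecondCountableTopology H] (b : HilbertBasis ι ℂ H) : Countable ι := by
  have hd : ∀ i j, i ≠ j → 1 ≤ dist (b i) (b j) := fun i j hij => by
    have h1 : ‖b i - b j‖ ^ 2 = 2 := by
      rw [@norm_sub_sq ℂ, b.orthonormal.1 i, b.orthonormal.1 j, b.orthonormal.2 hij]
      norm_num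
    rw [dist_eq_norm]
    nlinarith [norm_nonneg (b i - b j)]
  refine Pairwise.countable_of_isOpen_disjoint (s := fun i => Metric.ball (b i) (1 / 2)) ?_
    (fun i => Metric.isOpen_ball) (fun i => ⟨b i, Metric.mem_ball_self (by norm_num)⟩)
  intro i j hij
  refine Metric.ball_disjoint_ball ?_
  linarith [hd i j hij]

theorem hasSum_norm_inner_sq {ι H : Type*} [NormedAddCommGroup H] [InnerProductSpace ℂ H]
    (b : HilbertBasis ι ℂ H) (x : H) : HasSum (fun i => ‖inner ℂ (b i) x‖ ^ 2) (‖x‖ ^ 2) := by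
  have h := (b.hasSum_inner_mul_inner x x).mapL Complex.reCLM
  have e : ∀ i, Complex.reCLM (inner ℂ x (b i) * inner ℂ (b i) x) = ‖inner ℂ (b i) x‖ ^ 2 := by
    intro i
    rw [← inner_conj_symm, Complex.conj_mul', Complex.reCLM_apply]
    norm_cast
  simp_rw [e] at h
  convert h using 1
  rw [Complex.reCLM_apply]
  exact (inner_self_eq_norm_sq (𝕜 := ℂ) x).symm

theorem enorm_sq_eq_ofReal {E : Type*} [SeminormedAddCommGroup E] (x : E) :
    ‖x‖ₑ ^ 2 = ENNReal.ofReal (‖x‖ ^ 2) := by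
  rw [← ofReal_norm, ENNReal.ofReal_pow (norm_nonneg _)]

theorem tsum_enorm_inner_sq {ι H : Type*} [NormedAddCommGroup H] [InnerProductSpace ℂ H]
    (b : HilbertBasis ι ℂ H) (x : H) : ∑' i, ‖inner ℂ (b i) x‖ₑ ^ 2 = ‖x‖ₑ ^ 2 := by
  have h := hasSum_norm_inner_sq b x
  simp_rw [enorm_sq_eq_ofReal]
  rw [← h.tsum_eq, ENNReal.ofReal_tsum_of_nonneg (fun i => by positivity) h.summable]

/-- The square root of `∑ⱼ |k bⱼ⟩⟨k bⱼ|`, for an antilinear `k`, maps an orthonormal basis to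
`k` of a Bessel family. -/
theorem exists_bessel_sqrt_tsum_rankOne {ι κ F H : Type*}
    [NormedAddCommGroup F] [InnerProductSpace ℂ F]
    [NormedAddCommGroup H] [InnerProductSpace ℂ H] [CompleteSpace H]
    (b : HilbertBasis κ ℂ F) (e : HilbertBasis ι ℂ H) (k : F → H)
    (hk : ∀ u, ∃ l : F →L[ℂ] ℂ, ∀ g, inner ℂ (k g) u = l g)
    (hs : Summable fun j => ‖k (b j)‖ ^ 2) :
    ∃ w : ι → F,
      (∀ i, CFC.sqrt (∑' j, InnerProductSpace.rankOne ℂ (k (b j)) (k (b j))) (e i) = k (w i)) ∧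
      (∀ g, ∑' i, ‖inner ℂ (w i) g‖ₑ ^ 2 ≤ ‖g‖ₑ ^ 2) ∧
      ∑' i, ‖k (w i)‖ₑ ^ 2 = ∑' j, ‖k (b j)‖ₑ ^ 2 := by
  set Φ : κ → H := fun j => k (b j) with hΦ
  have hsR : Summable fun j => InnerProductSpace.rankOne ℂ (Φ j) (Φ j) := by
    refine Summable.of_norm ?_
    simpa [InnerProductSpace.norm_rankOne, ← pow_two] using hs
  set Γ : H →L[ℂ] H := ∑' j, InnerProductSpace.rankOne ℂ (Φ j) (Φ j) with hΓ
  have hin : ∀ u : H, HasSum (fun j => ‖inner ℂ (Φ j) u‖ ^ 2) (RCLike.re (inner ℂ (Γ u) u)) := by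
    intro u
    have h1 : HasSum (fun j => InnerProductSpace.rankOne ℂ (Φ j) (Φ j) u) (Γ u) :=
      hsR.hasSum.mapL (ContinuousLinearMap.apply ℂ H u)
    have h2 := (h1.mapL (innerSL ℂ u)).mapL Complex.reCLM
    convert h2 using 1
    · ext j
      simp only [InnerProductSpace.rankOne_apply, innerSL_apply_apply, inner_smul_right,
        Complex.reCLM_apply]
      rw [← inner_conj_symm u, Complex.mul_conj']
      norm_cast
    · rw [← inner_conj_symm (𝕜 := ℂ)]
      simp only [innerSL_apply_apply, Complex.reCLM_apply, RCLike.re_eq_complex_re, Complex.conj_re]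
  have hpos : 0 ≤ Γ := tsum_nonneg fun j => by
    rw [ContinuousLinearMap.nonneg_iff_isPositive]
    exact InnerProductSpace.isPositive_rankOne_self _
  have hsa : ∀ u v, inner ℂ (CFC.sqrt Γ u) v = inner ℂ u (CFC.sqrt Γ v) := by
    have h := (ContinuousLinearMap.nonneg_iff_isPositive _).1 (CFC.sqrt_nonneg Γ)
    exact fun u v => h.isSymmetric u v
  have hsq : ∀ u, HasSum (fun j => ‖inner ℂ (Φ j) u‖ ^ 2) (‖CFC.sqrt Γ u‖ ^ 2) := by
    intro u
    convert hin u using 1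
    conv_rhs => rw [← CFC.sqrt_mul_sqrt_self Γ hpos]
    rw [mul_apply_eq_comp, hsa, ← inner_self_eq_norm_sq (𝕜 := ℂ)]
  have hmem : ∀ u, Memℓp (fun j => inner ℂ (Φ j) u : κ → ℂ) 2 := fun u =>
    memℓp_gen (by simpa using (hsq u).summable)
  -- Since `S* S = Γ`, the operators `S` and `√Γ` have the same norms on vectors, and the Douglas
  -- lemma gives `√Γ = U S` with a contraction `U`.
  let S₀ : H →ₗ[ℂ] lp (fun _ : κ => ℂ) 2 :=
    { toFun := fun u => ⟨fun j => inner ℂ (Φ j) u, hmem u⟩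
      map_add' := fun u v => by ext j; exact inner_add_right _ _ _
      map_smul' := fun z u => by ext j; exact inner_smul_right _ _ _ }
  have hS₀ : ∀ u, ‖S₀ u‖ = ‖CFC.sqrt Γ u‖ := by
    intro u
    have h := lp.norm_rpow_eq_tsum (p := 2) (by simp) (S₀ u)
    have h2 : ‖S₀ u‖ ^ 2 = ‖CFC.sqrt Γ u‖ ^ 2 := by
      rw [← (hsq u).tsum_eq]
      simpa [S₀] using h
    exact (pow_left_inj₀ (norm_nonneg _) (norm_nonneg _) two_ne_zero).1 h2
  let S : H →L[ℂ] lp (fun _ : κ => ℂ) 2 := S₀.mkContinuous ‖CFC.sqrt Γ‖ fun u => by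
    rw [hS₀]; exact ContinuousLinearMap.le_opNorm _ _
  obtain ⟨U, hU, hUS⟩ := exists_contraction_comp_eq (CFC.sqrt Γ) S fun u => (hS₀ u).ge
  let c : ι → lp (fun _ : κ => ℂ) 2 := fun i => U.adjoint (e i)
  -- From `√Γ = U S` one gets `√Γ eᵢ = S* U* eᵢ`, a combination of the `k bⱼ` with coefficients
  -- `cᵢⱼ`. As `k` is antilinear, moving these coefficients inside `k` conjugates them, hence the
  -- `star`.
  let w : ι → F := fun i => b.repr.symm (star (c i))
  have hw : ∀ i, CFC.sqrt Γ (e i) = k (w i) := by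
    intro i
    refine ext_inner_right ℂ fun u => ?_
    rw [hsa, hUS, ← ContinuousLinearMap.adjoint_inner_left]
    obtain ⟨l, hl⟩ := hk u
    rw [hl]
    have h1 := (b.hasSum_repr_symm (star (c i))).mapL l
    have h2 := lp.hasSum_inner (𝕜 := ℂ) (c i) (S u)
    have h3 : (fun j => inner ℂ (c i j) (S u j)) = fun j => l ((star (c i)) j • b j) := by
      ext j
      rw [map_smul, ← hl, smul_eq_mul]
      change inner ℂ (c i j) (inner ℂ (Φ j) u) = _
      rw [RCLike.inner_apply, mul_comm]
      rfl
    rw [h3] at h2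
    exact h2.unique h1
  refine ⟨w, hw, fun g => ?_, ?_⟩
  -- Up to conjugation `⟨wᵢ, g⟩` is the `i`-th coordinate of `U` applied to the conjugated
  -- coordinates of `g`, so Bessel's inequality is Parseval together with `‖U‖ ≤ 1`.
  · have h1 : ∀ i, ‖inner ℂ (w i) g‖ₑ = ‖inner ℂ (e i) (U (star (b.repr g)))‖ₑ := by
      intro i
      have h2 : inner ℂ (w i) g = inner ℂ (star (c i)) (b.repr g) := by
        rw [← b.repr.inner_map_map]; simp [w]
      have h3 : inner ℂ (e i) (U (star (b.repr g))) = inner ℂ (c i) (star (b.repr g)) := by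
        rw [← ContinuousLinearMap.adjoint_inner_left]
      rw [h2, h3, ← RCLike.enorm_conj (inner ℂ (c i) (star (b.repr g)))]
      congr 1
      rw [starRingEnd_apply, lp.inner_eq_tsum, lp.inner_eq_tsum, tsum_star]
      refine tsum_congr fun j => ?_
      simp [RCLike.inner_apply]
    rw [tsum_congr fun i => by rw [h1 i], tsum_enorm_inner_sq]
    gcongr ?_ ^ 2
    refine (enorm_le_iff_norm_le.2 (hU _)).trans ?_
    rw [← ofReal_norm, ← ofReal_norm, norm_star, b.repr.norm_map]
  -- Both sides are the double sum of `|⟨eᵢ, k bⱼ⟩|²`, the trace of `Γ`.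
  · rw [tsum_congr fun j => (tsum_enorm_inner_sq e (k (b j))).symm, ENNReal.tsum_comm]
    refine tsum_congr fun i => ?_
    rw [← hw, enorm_sq_eq_ofReal, ← (hsq (e i)).tsum_eq,
      ENNReal.ofReal_tsum_of_nonneg (fun i => by positivity) (hsq _).summable]
    refine tsum_congr fun j => ?_
    rw [← enorm_sq_eq_ofReal, ← inner_conj_symm, RCLike.enorm_conj]

theorem exists_bessel_traceForm {κ F : Type*} {H : Type}
    [NormedAddCommGroup F] [InnerProductSpace ℂ F]
    [NormedAddCommGroup H] [InnerProductSpace ℂ H] [CompleteSpace H]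
    (b : HilbertBasis κ ℂ F) (k : F → H)
    (hk : ∀ u, ∃ l : F →L[ℂ] ℂ, ∀ g, inner ℂ (k g) u = l g)
    (hs : Summable fun j => ‖k (b j)‖ ^ 2) :
    ∃ w : (exists_hilbertBasis ℂ H).choose → F,
      (∀ h : H → EReal, traceForm h (∑' j, InnerProductSpace.rankOne ℂ (k (b j)) (k (b j))) =
        ∑' i, h (k (w i))) ∧
      (∀ g, ∑' i, ‖inner ℂ (w i) g‖ₑ ^ 2 ≤ ‖g‖ₑ ^ 2) ∧
      ∑' i, ‖k (w i)‖ₑ ^ 2 = ∑' j, ‖k (b j)‖ₑ ^ 2 := by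
  obtain ⟨w, h1, h2, h3⟩ := exists_bessel_sqrt_tsum_rankOne b (stdBasis H) k hk hs
  exact ⟨w, fun h => tsum_congr fun i => by rw [h1], h2, h3⟩

/-- For a unit vector the rank-one operator is a projection, hence its own square root. -/
theorem traceForm_rankOne {H : Type} [NormedAddCommGroup H] [InnerProductSpace ℂ H]
    [CompleteSpace H] (h : H → EReal) {Ψ : H} (hΨ : ‖Ψ‖ = 1) :
    traceForm h (InnerProductSpace.rankOne ℂ Ψ Ψ) =
      ∑' i, h (inner ℂ Ψ (stdBasis H i) • Ψ) := by
  have hpos : 0 ≤ InnerProductSpace.rankOne ℂ Ψ Ψ := by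
    rw [ContinuousLinearMap.nonneg_iff_isPositive]
    exact InnerProductSpace.isPositive_rankOne_self _
  have h1 : CFC.sqrt (InnerProductSpace.rankOne ℂ Ψ Ψ) = InnerProductSpace.rankOne ℂ Ψ Ψ :=
    CFC.sqrt_unique (InnerProductSpace.isIdempotentElem_rankOne_self hΨ) hpos
  rw [traceForm, h1]
  rfl

/-- Sums in `EReal` of terms that are bounded below by a summable family. -/
theorem ereal_tsum_sub {ι : Type*} (N : ι → ℝ≥0∞) {r : ι → ℝ} (hr : Summable r) :
    ∑' i, ((N i : EReal) + ((-r i : ℝ) : EReal)) =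
      ((∑' i, N i : ℝ≥0∞) : EReal) + ((-∑' i, r i : ℝ) : EReal) := by
  let f : ℝ≥0∞ →+ EReal := ⟨⟨fun x => (x : EReal), EReal.coe_ennreal_zero⟩, EReal.coe_ennreal_add⟩
  let g : ℝ →+ EReal := ⟨⟨fun x => (x : EReal), EReal.coe_zero⟩, EReal.coe_add⟩
  have h1 : HasSum (fun i => f (N i)) (f (∑' i, N i)) :=
    ENNReal.summable.hasSum.map f continuous_coe_ennreal_ereal
  have h2 : HasSum (fun i => g (-r i)) (g (-∑' i, r i)) :=
    hr.hasSum.neg.map g continuous_coe_real_ereal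
  refine HasSum.tsum_eq ?_
  -- Addition on `EReal` is continuous here because the second summand is finite; the first may be
  -- `⊤`.
  have h3 := (EReal.continuousAt_add (p := (f (∑' i, N i), g (-∑' i, r i)))
    (Or.inr (EReal.coe_ne_bot _)) (Or.inr (EReal.coe_ne_top _))).tendsto.comp
    (h1.prodMk_nhds h2)
  refine h3.congr fun s => ?_
  simp only [Function.comp_apply]
  exact Finset.sum_add_distrib.symm

/-! ### Configurations and symmetric functions -/

theorem measurable_conf_fst {d : ℕ} : Measurable fun c : Conf d => c.1 :=
  measurable_of_sectors fun _ => measurable_const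

/-- The σ-algebra is pulled back from a countably generated one by the particle number and the
sector coordinates. This makes the `L²` spaces separable and hence their bases countable. -/
instance instCountablyGeneratedConf (d : ℕ) : MeasurableSpace.CountablyGenerated (Conf d) := by
  have h : (inferInstance : MeasurableSpace (Conf d)) = MeasurableSpace.comap
      (fun c : Conf d => (c.1, fun n => sector n c))
      (inferInstance : MeasurableSpace (ℕ × (∀ n : ℕ, Fin n → Space d))) := by
    refine le_antisymm (fun s hs => ?_) ?_
    · refine ⟨⋃ n, {p | p.1 = n ∧ (⟨n, p.2 n⟩ : Conf d) ∈ s}, ?_, ?_⟩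
      · refine MeasurableSet.iUnion fun n => ?_
        refine (measurable_fst (measurableSet_singleton n)).inter ?_
        exact ((measurable_mk d n).comp ((measurable_pi_apply n).comp measurable_snd)) hs
      · ext ⟨n, y⟩
        simp only [Set.mem_preimage, Set.mem_iUnion, Set.mem_ofPred_eq]
        constructor
        · rintro ⟨m, hm, hx⟩
          subst hm
          simpa [sector_mk] using hx
        · intro hx
          exact ⟨n, rfl, by simpa [sector_mk] using hx⟩
    · exact (measurable_conf_fst.prodMk
        (measurable_pi_lambda _ fun n => measurable_sector n)).comap_le
  have h2 := MeasurableSpace.CountablyGenerated.comap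
    (fun c : Conf d => (c.1, fun n => sector n c))
  rwa [← h] at h2

/-- A function of a configuration that is almost everywhere invariant under relabelling. -/
def ConfSymm {d : ℕ} {β : Type*} (f : Conf d → β) : Prop :=
  ∀ᵐ c : Conf d, ∀ σ : Equiv.Perm (Fin c.1), f ⟨c.1, c.2 ∘ σ⟩ = f c

/-- A function of a particle and a configuration that is almost everywhere invariant under
relabelling of the configuration. -/
def FieldSymm {d : ℕ} {β : Type*} (F : Space d × Conf d → β) : Prop :=
  ∀ᵐ p : Space d × Conf d, ∀ σ : Equiv.Perm (Fin p.2.1), F (p.1, ⟨p.2.1, p.2.2 ∘ σ⟩) = F p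

theorem FieldSymm.ae_confSymm {d : ℕ} {β : Type*} {F : Space d × Conf d → β} (h : FieldSymm F) :
    ∀ᵐ x, ConfSymm fun c => F (x, c) :=
  Measure.ae_ae_of_ae_prod h

/-- Membership in `Hil` gives one null set for each family `τ`, and these families are uncountably
many. At a given point only `τ` in its own sector matters, so the countably many pairs `(n, σ)`
suffice. -/
theorem fieldSymm_hil {d : ℕ} (Ψ : Hil d) : FieldSymm (Ψ.1 : Space d × Conf d → ℂ) := by
  classical
  have h : ∀ (n : ℕ) (σ : Equiv.Perm (Fin n)), ∀ᵐ p : Space d × Conf d,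
      Ψ.1 (p.1, Conf.perm (Function.update (fun n => 1) n σ) p.2) = Ψ.1 p := by
    intro n σ
    let τ : ∀ n, Equiv.Perm (Fin n) := Function.update (fun n => 1) n σ
    have h' : Lp.compMeasurePreserving (Prod.map id (Conf.perm τ))
      (measurePreserving_id_perm d τ) Ψ.1 = Ψ := (Submodule.mem_iInf _).1 Ψ.2 τ
    have h1 := Lp.coeFn_compMeasurePreserving Ψ.1 (measurePreserving_id_perm d τ)
    rw [h'] at h1
    filter_upwards [h1] with p hp
    rw [hp]
    rfl
  filter_upwards [ae_all_iff.2 fun n => ae_all_iff.2 (h n)] with p hp σ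
  rw [← hp p.2.1 σ]
  simp [Conf.perm]

theorem mem_hil {d : ℕ} {u : Lp ℂ 2 (volume : Measure (Space d × Conf d))}
    (h : FieldSymm (u : Space d × Conf d → ℂ)) : u ∈ Hil d := by
  refine (Submodule.mem_iInf _).2 fun τ => ?_
  refine Lp.ext ?_
  have h1 := Lp.coeFn_compMeasurePreserving u (measurePreserving_id_perm d τ)
  filter_upwards [h, h1] with p hp h1
  refine h1.trans ?_
  exact hp (τ _)

theorem mem_fock {d : ℕ} {u : Lp ℂ 2 (volume : Measure (Conf d))}
    (h : ConfSymm (u : Conf d → ℂ)) : u ∈ Fock d := by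
  refine (Submodule.mem_iInf _).2 fun τ => ?_
  refine Lp.ext ?_
  have h1 := Lp.coeFn_compMeasurePreserving u (measurePreserving_perm d τ)
  filter_upwards [h, h1] with p hp h1
  refine h1.trans ?_
  exact hp (τ _)

theorem Conf.perm_cat {d : ℕ} (c c' : Conf d) (σ : Equiv.Perm (Fin c.1))
    (σ' : Equiv.Perm (Fin c'.1)) :
    ∃ τ : Equiv.Perm (Fin (c.cat c').1),
      Conf.cat ⟨c.1, c.2 ∘ σ⟩ ⟨c'.1, c'.2 ∘ σ'⟩ = ⟨(c.cat c').1, (c.cat c').2 ∘ τ⟩ := by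
  refine ⟨(finSumFinEquiv.symm.trans (Equiv.sumCongr σ σ')).trans finSumFinEquiv, ?_⟩
  simp only [Conf.cat]
  congr 1
  funext i
  obtain ⟨j, rfl⟩ := finSumFinEquiv.surjective i
  have e : ((finSumFinEquiv.symm.trans (Equiv.sumCongr σ σ')).trans finSumFinEquiv)
      (finSumFinEquiv j) = finSumFinEquiv (Equiv.sumCongr σ σ' j) := by
    simp only [Equiv.trans_apply, Equiv.symm_apply_apply]
  rw [Function.comp_apply]
  refine Eq.trans ?_ (congrArg (Fin.append c.2 c'.2) e).symm
  rcases j with j | j <;> simp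

/-- Relabellings preserve null sets and only countably many are involved, so `f` and `g` agree
almost everywhere along whole orbits. -/
theorem confSymm_of_ae_eq {d : ℕ} {β : Type*} {f g : Conf d → β} (h : f =ᵐ[volume] g)
    (hg : ConfSymm g) : ConfSymm f := by
  have h2 : ∀ᵐ c : Conf d, ∀ n, ∀ σ : Equiv.Perm (Fin n), ∀ h : c.1 = n,
      f ⟨c.1, c.2 ∘ (h ▸ σ)⟩ = g ⟨c.1, c.2 ∘ (h ▸ σ)⟩ := by
    classical
    refine ae_all_iff.2 fun n => ae_all_iff.2 fun σ => ?_
    have := (measurePreserving_perm d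
      (Function.update (fun n => 1) n σ)).quasiMeasurePreserving.ae h
    filter_upwards [this] with c hc hn
    subst hn
    simpa [Conf.perm] using hc
  filter_upwards [h, hg, h2] with c h1 h3 h4 σ
  rw [h1, ← h3 σ]
  exact h4 c.1 σ rfl

theorem fieldSymm_of_ae_eq {d : ℕ} {β : Type*} {f g : Space d × Conf d → β} (h : f =ᵐ[volume] g)
    (hg : FieldSymm g) : FieldSymm f := by
  have h2 : ∀ᵐ p : Space d × Conf d, ∀ n, ∀ σ : Equiv.Perm (Fin n), ∀ h : p.2.1 = n,
      f (p.1, ⟨p.2.1, p.2.2 ∘ (h ▸ σ)⟩) = g (p.1, ⟨p.2.1, p.2.2 ∘ (h ▸ σ)⟩) := by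
    classical
    refine ae_all_iff.2 fun n => ae_all_iff.2 fun σ => ?_
    have := (measurePreserving_id_perm d
      (Function.update (fun n => 1) n σ)).quasiMeasurePreserving.ae h
    filter_upwards [this] with c hc hn
    subst hn
    simpa [Conf.perm, Prod.map] using hc
  filter_upwards [h, hg, h2] with c h1 h3 h4 σ
  rw [h1, ← h3 σ]
  exact h4 c.2.1 σ rfl

/-! ### The isometry `U G(Q)` and its contractions against field vectors -/

/-- The weight of the splitting of a configuration into `c` and `c'`. -/
def splitWeight {d : ℕ} (q : Cutoff d) (c c' : Conf d) : ℝ :=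
  √((c.1 + c'.1).choose c.1) * (∏ i, q.toFun (c.2 i)) * ∏ j, √(1 - q.toFun (c'.2 j) ^ 2)

/-- The operator `U G(Q)` on functions of a configuration. -/
def fockSplit {d : ℕ} (q : Cutoff d) (f : Conf d → ℂ) (c c' : Conf d) : ℂ :=
  (splitWeight q c c' : ℂ) * f (c.cat c')

theorem splitFun_eq_fockSplit {d : ℕ} (q : Cutoff d) (Ψ : Space d × Conf d → ℂ)
    (p : (Space d × Conf d) × Conf d) :
    splitFun q Ψ p = fockSplit q (fun c => (q.toFun p.1.1 : ℂ) * Ψ (p.1.1, c)) p.1.2 p.2 := by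
  simp only [splitFun, fockSplit, splitWeight]
  push_cast
  ring

theorem measurable_splitWeight {d : ℕ} (q : Cutoff d) :
    Measurable fun p : Conf d × Conf d => splitWeight q p.1 p.2 := by
  have hch : Measurable fun p : Conf d × Conf d => √((p.1.1 + p.2.1).choose p.1.1 : ℝ) :=
    (measurable_from_prod_countable_left (f := fun r : ℕ × ℕ =>
      √((r.1 + r.2).choose r.1 : ℝ)) fun _ => measurable_of_countable _).comp
      ((measurable_conf_fst.comp measurable_fst).prodMk (measurable_conf_fst.comp measurable_snd))
  refine (hch.mul ((measurable_prod_conf q.measurable).comp measurable_fst)).mul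
    ((measurable_prod_conf (f := fun x => √(1 - q.toFun x ^ 2)) ?_).comp measurable_snd)
  exact (measurable_const.sub (q.measurable.pow_const 2)).sqrt

theorem measurable_fockSplit {d : ℕ} {A : Type*} [MeasurableSpace A] (q : Cutoff d)
    {F : A × Conf d → ℂ} (hF : Measurable F) :
    Measurable fun p : (A × Conf d) × Conf d =>
      fockSplit q (fun c => F (p.1.1, c)) p.1.2 p.2 := by
  refine (Complex.measurable_ofReal.comp ((measurable_splitWeight q).comp
    ((measurable_snd.comp measurable_fst).prodMk measurable_snd))).mul (hF.comp ?_)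
  exact (measurable_fst.comp measurable_fst).prodMk ((measurable_cat d).comp
    ((measurable_snd.comp measurable_fst).prodMk measurable_snd))

/-- This is `Q* Q = q² + (1 - q²) = 1` at the level of Fock space. Symmetry of `f` is what lets the
binomial weight stand for all ways to distribute the points. -/
theorem lintegral_fockSplit {d : ℕ} (q : Cutoff d) {f : Conf d → ℂ} (hf : Measurable f)
    (hs : ConfSymm f) :
    ∫⁻ c, ∫⁻ c', ‖fockSplit q f c c'‖ₑ ^ 2 = ∫⁻ c, ‖f c‖ₑ ^ 2 := by
  have hq := q.measurable
  have hq0 := q.nonneg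
  have hq1 : ∀ x, 0 ≤ 1 - q.toFun x ^ 2 := fun x => by
    nlinarith [q.nonneg x, q.le_one x]
  have hbm : Measurable fun x => ENNReal.ofReal (1 - q.toFun x ^ 2) :=
    (measurable_const.sub (hq.pow_const 2)).ennreal_ofReal
  have key := lintegral_split (a := fun x => ENNReal.ofReal (q.toFun x ^ 2))
    (b := fun x => ENNReal.ofReal (1 - q.toFun x ^ 2)) (hq.pow_const 2).ennreal_ofReal hbm
    (fun x => by rw [← ENNReal.ofReal_add (by positivity) (hq1 x)]; simp) (hf.enorm.pow_const 2)
    (fun n σ => (ae_conf hs n).mono fun y hy => by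
      have := hy σ
      simp only at this
      simp only [this])
  rw [← key]
  refine lintegral_congr fun c => lintegral_congr fun c' => ?_
  have hr : ∀ r : ℝ, ‖(r : ℂ)‖ₑ ^ 2 = ENNReal.ofReal (r ^ 2) := fun r => by
    rw [enorm_sq_eq_ofReal, Complex.norm_real, Real.norm_eq_abs, sq_abs]
  rw [fockSplit, enorm_mul, mul_pow, hr, splitWeight, mul_pow, mul_pow, ← Finset.prod_pow,
    ← Finset.prod_pow, Real.sq_sqrt (by positivity)]
  simp_rw [Real.sq_sqrt (hq1 _)]
  rw [ENNReal.ofReal_mul (by positivity),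
    ENNReal.ofReal_mul (by positivity), ENNReal.ofReal_natCast,
    ENNReal.ofReal_prod_of_nonneg fun i _ => by positivity,
    ENNReal.ofReal_prod_of_nonneg fun i _ => hq1 _]

theorem lintegral_lintegral_fockSplit {d : ℕ} (q : Cutoff d) {F : Space d × Conf d → ℂ}
    (hF : Measurable F) (hs : FieldSymm F) :
    ∫⁻ z : Space d × Conf d, ∫⁻ c', ‖fockSplit q (fun c => F (z.1, c)) z.2 c'‖ₑ ^ 2 =
      ∫⁻ z, ‖F z‖ₑ ^ 2 := by
  have hm := ((measurable_fockSplit q hF).enorm.pow_const 2).lintegral_prod_right'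
    (ν := (volume : Measure (Conf d)))
  rw [lintegral_volume_prod hm, lintegral_volume_prod (hF.enorm.pow_const 2)]
  refine lintegral_congr_ae ?_
  filter_upwards [hs.ae_confSymm] with x hx
  exact lintegral_fockSplit q (hF.comp measurable_prodMk_left) hx

theorem prod_comp_perm {d : ℕ} {M : Type*} [CommMonoid M] (f : Space d → M) {n : ℕ}
    (y : Fin n → Space d) (σ : Equiv.Perm (Fin n)) : ∏ i, f ((y ∘ σ) i) = ∏ i, f (y i) :=
  Equiv.prod_comp σ fun i => f (y i)

theorem splitWeight_perm {d : ℕ} (q : Cutoff d) (c c' : Conf d) (σ : Equiv.Perm (Fin c.1))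
    (σ' : Equiv.Perm (Fin c'.1)) :
    splitWeight q ⟨c.1, c.2 ∘ σ⟩ ⟨c'.1, c'.2 ∘ σ'⟩ = splitWeight q c c' := by
  simp only [splitWeight]
  rw [prod_comp_perm, prod_comp_perm (fun x => √(1 - q.toFun x ^ 2))]

theorem fockSplit_perm {d : ℕ} (q : Cutoff d) {F : Space d × Conf d → ℂ} (hs : FieldSymm F) :
    ∀ᵐ p : (Space d × Conf d) × Conf d, ∀ (σ : Equiv.Perm (Fin p.1.2.1))
      (σ' : Equiv.Perm (Fin p.2.1)),
      fockSplit q (fun c => F (p.1.1, c)) ⟨p.1.2.1, p.1.2.2 ∘ σ⟩ ⟨p.2.1, p.2.2 ∘ σ'⟩ =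
        fockSplit q (fun c => F (p.1.1, c)) p.1.2 p.2 := by
  filter_upwards [(quasiMeasurePreserving_assoc_cat d).ae hs] with p hp σ σ'
  obtain ⟨τ, hτ⟩ := Conf.perm_cat p.1.2 p.2 σ σ'
  rw [fockSplit, fockSplit, splitWeight_perm, hτ, ← hp τ]

theorem eLpNorm_two_sq {α E : Type*} [MeasurableSpace α] {μ : Measure α}
    [NormedAddCommGroup E] (f : α → E) :
    eLpNorm f 2 μ ^ 2 = ∫⁻ x, ‖f x‖ₑ ^ 2 ∂μ := by
  rw [eLpNorm_eq_lintegral_rpow_enorm_toReal (by simp) (by simp), ← ENNReal.rpow_natCast,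
    ← ENNReal.rpow_mul]
  simp

theorem memLp_two_of_lintegral_lt_top {α : Type*} [MeasurableSpace α] {μ : Measure α}
    {f : α → ℂ} (hf : Measurable f) (h : ∫⁻ x, ‖f x‖ₑ ^ 2 ∂μ < ⊤) : MemLp f 2 μ := by
  refine ⟨hf.aestronglyMeasurable, ?_⟩
  rw [← eLpNorm_two_sq] at h
  exact lt_of_le_of_ne le_top fun h' => by simp [h'] at h

theorem enorm_lp_sq {α : Type*} [MeasurableSpace α] {μ : Measure α} (f : Lp ℂ 2 μ) :
    ‖f‖ₑ ^ 2 = ∫⁻ x, ‖f x‖ₑ ^ 2 ∂μ := by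
  rw [Lp.enorm_def, eLpNorm_two_sq]

theorem enorm_toLp_sq {α : Type*} [MeasurableSpace α] {μ : Measure α} {f : α → ℂ}
    (hf : MemLp f 2 μ) : ‖hf.toLp f‖ₑ ^ 2 = ∫⁻ x, ‖f x‖ₑ ^ 2 ∂μ := by
  rw [Lp.enorm_toLp, eLpNorm_two_sq]

theorem measurable_lp {α : Type*} [MeasurableSpace α] {μ : Measure α} (f : Lp ℂ 2 μ) :
    Measurable f :=
  (Lp.stronglyMeasurable f).measurable

theorem inner_toLp {α : Type*} [MeasurableSpace α] {μ : Measure α} (u : Lp ℂ 2 μ) {f : α → ℂ}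
    (hf : MemLp f 2 μ) : inner ℂ u (hf.toLp f) = ∫ x, starRingEnd ℂ (u x) * f x ∂μ := by
  rw [L2.inner_def]
  refine integral_congr_ae ?_
  filter_upwards [hf.coeFn_toLp] with x hx
  rw [hx, RCLike.inner_apply, mul_comm]

theorem enorm_integral_mul_sq_le {α : Type*} [MeasurableSpace α] {μ : Measure α} (u : Lp ℂ 2 μ)
    {f : α → ℂ} (hf : Measurable f) :
    ‖∫ x, starRingEnd ℂ (u x) * f x ∂μ‖ₑ ^ 2 ≤ ‖u‖ₑ ^ 2 * ∫⁻ x, ‖f x‖ₑ ^ 2 ∂μ := by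
  by_cases h : ∫⁻ x, ‖f x‖ₑ ^ 2 ∂μ = ⊤
  -- With an infinite integral the bound is `⊤` unless `u = 0`; then it is `0 * ⊤ = 0`, and the left
  -- side has to vanish too.
  · by_cases hu : u = 0
    · have : ∫ x, starRingEnd ℂ (u x) * f x ∂μ = 0 := by
        refine integral_eq_zero_of_ae ?_
        filter_upwards [Lp.coeFn_zero ℂ 2 μ] with x hx
        rw [hu, hx]; simp
      rw [this]; simp
    · rw [h, ENNReal.mul_top (pow_ne_zero 2 (enorm_ne_zero.2 hu))]
      exact le_top
  · have hm := memLp_two_of_lintegral_lt_top hf (lt_top_iff_ne_top.2 h)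
    rw [← inner_toLp u hm, ← enorm_toLp_sq hm, ← mul_pow]
    gcongr
    rw [← ofReal_norm, ← ofReal_norm, ← ofReal_norm, ← ENNReal.ofReal_mul (norm_nonneg _)]
    exact ENNReal.ofReal_le_ofReal (norm_inner_le_norm _ _)

/-- Bessel's inequality for a family of symmetric functions, tested on any function. -/
theorem tsum_enorm_integral_sq_le {d : ℕ} {ι : Type*} {w : ι → Fock d}
    (hw : ∀ g, ∑' i, ‖inner ℂ (w i) g‖ₑ ^ 2 ≤ ‖g‖ₑ ^ 2) {f : Conf d → ℂ} (hf : Measurable f) :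
    ∑' i, ‖∫ c, starRingEnd ℂ ((w i).1 c) * f c‖ₑ ^ 2 ≤ ∫⁻ c, ‖f c‖ₑ ^ 2 := by
  by_cases h : ∫⁻ c, ‖f c‖ₑ ^ 2 = ⊤
  · rw [h]; exact le_top
  · have hm := memLp_two_of_lintegral_lt_top hf (lt_top_iff_ne_top.2 h)
    simp_rw [← inner_toLp _ hm]
    -- The `w i` are symmetric, so they only see the projection of `f` onto the Fock space, which
    -- does not increase the norm.
    have h1 : ∀ i, inner ℂ (w i).1 hm.toLp =
        inner ℂ (w i) ((Fock d).orthogonalProjectionOnto hm.toLp) := fun i =>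
      (Submodule.inner_orthogonalProjectionOnto_eq_of_mem_left (w i) _).symm
    simp_rw [h1]
    refine (hw _).trans ?_
    rw [← enorm_toLp_sq hm]
    gcongr ?_ ^ 2
    rw [enorm_le_iff_norm_le]
    exact Submodule.norm_orthogonalProjectionOnto_apply_le _ _

theorem tsum_enorm_integral_sq_eq {d : ℕ} {κ : Type*} (b : HilbertBasis κ ℂ (Fock d))
    {f : Conf d → ℂ} (hf : MemLp f 2 volume) (hs : ConfSymm f) :
    ∑' i, ‖∫ c, starRingEnd ℂ ((b i).1 c) * f c‖ₑ ^ 2 = ∫⁻ c, ‖f c‖ₑ ^ 2 := by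
  have hF : hf.toLp ∈ Fock d := mem_fock (confSymm_of_ae_eq hf.coeFn_toLp hs)
  simp_rw [← inner_toLp _ hf, ← enorm_toLp_sq hf]
  exact tsum_enorm_inner_sq b ⟨hf.toLp, hF⟩

theorem measurable_fockSplit_right {d : ℕ} (q : Cutoff d) {F : Space d × Conf d → ℂ}
    (hF : Measurable F) (z : Space d × Conf d) :
    Measurable fun c' => fockSplit q (fun c => F (z.1, c)) z.2 c' := by
  refine (Complex.measurable_ofReal.comp
    ((measurable_splitWeight q).comp measurable_prodMk_left)).mul (hF.comp ?_)
  exact measurable_const.prodMk ((measurable_cat d).comp measurable_prodMk_left)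

/-- `(1 ⊗ ⟨w|) U G(Q) F`. -/
def contract {d : ℕ} (q : Cutoff d) (w : Conf d → ℂ) (F : Space d × Conf d → ℂ)
    (z : Space d × Conf d) : ℂ :=
  ∫ c', starRingEnd ℂ (w c') * fockSplit q (fun c => F (z.1, c)) z.2 c'

theorem measurable_contract {d : ℕ} (q : Cutoff d) {w : Conf d → ℂ} (hw : Measurable w)
    {F : Space d × Conf d → ℂ} (hF : Measurable F) : Measurable (contract q w F) := by
  have h : StronglyMeasurable fun p : (Space d × Conf d) × Conf d =>
      starRingEnd ℂ (w p.2) * fockSplit q (fun c => F (p.1.1, c)) p.1.2 p.2 :=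
    (((RCLike.continuous_conj.measurable.comp (hw.comp measurable_snd))).mul
      (measurable_fockSplit q hF)).stronglyMeasurable
  exact h.integral_prod_right.measurable

theorem lintegral_contract_le {d : ℕ} (q : Cutoff d) (w : Lp ℂ 2 (volume : Measure (Conf d)))
    {F : Space d × Conf d → ℂ} (hF : Measurable F) (hs : FieldSymm F) :
    ∫⁻ z, ‖contract q w F z‖ₑ ^ 2 ≤ ‖w‖ₑ ^ 2 * ∫⁻ z, ‖F z‖ₑ ^ 2 := by
  rw [← lintegral_lintegral_fockSplit q hF hs, ← lintegral_const_mul' _ _ (ENNReal.pow_ne_top enorm_ne_top)]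
  refine lintegral_mono fun z => ?_
  exact enorm_integral_mul_sq_le w (measurable_fockSplit_right q hF z)

theorem memLp_contract {d : ℕ} (q : Cutoff d) (w : Lp ℂ 2 (volume : Measure (Conf d)))
    {F : Space d × Conf d → ℂ} (hF : Measurable F) (hs : FieldSymm F)
    (hfin : ∫⁻ z, ‖F z‖ₑ ^ 2 < ⊤) : MemLp (contract q w F) 2 volume :=
  memLp_two_of_lintegral_lt_top (measurable_contract q (measurable_lp w) hF)
    ((lintegral_contract_le q w hF hs).trans_lt (ENNReal.mul_lt_top (ENNReal.pow_lt_top enorm_lt_top) hfin))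

theorem fieldSymm_contract {d : ℕ} (q : Cutoff d) (w : Conf d → ℂ)
    {F : Space d × Conf d → ℂ} (hs : FieldSymm F) : FieldSymm (contract q w F) := by
  filter_upwards [Measure.ae_ae_of_ae_prod (fockSplit_perm q hs)] with z hz σ
  refine integral_congr_ae ?_
  filter_upwards [hz] with c' hc'
  have := hc' σ 1
  simp only [Equiv.Perm.coe_one, Function.comp_id] at this
  simp only [this]

/-- Bessel's inequality is applied at each fixed `z`, in the variable that is traced out; the
isometry then removes the splitting. The kinetic and potential squares are bounded through this
lemma, the field square by the same argument. -/
theorem tsum_lintegral_contract_le {d : ℕ} (q : Cutoff d) {ι : Type*} [Countable ι]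
    {w : ι → Fock d} (hw : ∀ g, ∑' i, ‖inner ℂ (w i) g‖ₑ ^ 2 ≤ ‖g‖ₑ ^ 2)
    {F : Space d × Conf d → ℂ} (hF : Measurable F) (hs : FieldSymm F) :
    ∑' i, ∫⁻ z, ‖contract q (w i).1 F z‖ₑ ^ 2 ≤ ∫⁻ z, ‖F z‖ₑ ^ 2 := by
  rw [← lintegral_lintegral_fockSplit q hF hs, ← lintegral_tsum fun i =>
    ((measurable_contract q (measurable_lp _) hF).enorm.pow_const 2).aemeasurable]
  exact lintegral_mono fun z => tsum_enorm_integral_sq_le hw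
    (measurable_fockSplit_right q hF z)

/-- For a basis Parseval replaces Bessel, because at almost every `z` the split function is square
integrable and symmetric in the traced-out variable. -/
theorem tsum_lintegral_contract_eq {d : ℕ} (q : Cutoff d) {κ : Type*} [Countable κ]
    (b : HilbertBasis κ ℂ (Fock d))
    {F : Space d × Conf d → ℂ} (hF : Measurable F) (hs : FieldSymm F)
    (hfin : ∫⁻ z, ‖F z‖ₑ ^ 2 < ⊤) :
    ∑' i, ∫⁻ z, ‖contract q (b i).1 F z‖ₑ ^ 2 = ∫⁻ z, ‖F z‖ₑ ^ 2 := by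
  have hm := ((measurable_fockSplit q hF).enorm.pow_const 2).lintegral_prod_right'
    (ν := (volume : Measure (Conf d)))
  rw [← lintegral_lintegral_fockSplit q hF hs] at hfin ⊢
  rw [← lintegral_tsum fun i =>
    ((measurable_contract q (measurable_lp _) hF).enorm.pow_const 2).aemeasurable]
  refine lintegral_congr_ae ?_
  filter_upwards [ae_lt_top hm hfin.ne, Measure.ae_ae_of_ae_prod (fockSplit_perm q hs)]
    with z hz hz2
  refine tsum_enorm_integral_sq_eq b (memLp_two_of_lintegral_lt_top
    (measurable_fockSplit_right q hF z) hz) ?_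
  filter_upwards [hz2] with c' hc' σ
  simpa using hc' 1 σ

/-- Multiplication by the cutoff in the particle variable. -/
def cutoffMul {d : ℕ} (q : Cutoff d) (F : Space d × Conf d → ℂ) (z : Space d × Conf d) : ℂ :=
  (q.toFun z.1 : ℂ) * F z

theorem measurable_cutoffMul {d : ℕ} (q : Cutoff d) {F : Space d × Conf d → ℂ}
    (hF : Measurable F) : Measurable (cutoffMul q F) :=
  (Complex.measurable_ofReal.comp (q.measurable.comp measurable_fst)).mul hF

theorem fieldSymm_cutoffMul {d : ℕ} (q : Cutoff d) {F : Space d × Conf d → ℂ}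
    (hs : FieldSymm F) : FieldSymm (cutoffMul q F) := by
  filter_upwards [hs] with z hz σ
  rw [cutoffMul, cutoffMul, hz σ]

theorem lintegral_cutoffMul_le {d : ℕ} (q : Cutoff d) (F : Space d × Conf d → ℂ) :
    ∫⁻ z, ‖cutoffMul q F z‖ₑ ^ 2 ≤ ∫⁻ z, ‖F z‖ₑ ^ 2 := by
  refine lintegral_mono fun z => ?_
  gcongr
  rw [enorm_le_iff_norm_le, cutoffMul, norm_mul, Complex.norm_real,
    Real.norm_of_nonneg (q.nonneg _)]
  exact mul_le_of_le_one_left (norm_nonneg _) (q.le_one _)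

theorem lintegral_lp_lt_top {α : Type*} [MeasurableSpace α] {μ : Measure α} (f : Lp ℂ 2 μ) :
    ∫⁻ x, ‖f x‖ₑ ^ 2 ∂μ < ⊤ := by
  rw [← enorm_lp_sq]
  exact ENNReal.pow_lt_top enorm_lt_top

/-! ### Kraus operators and the localized state -/

theorem inner_kraus {d : ℕ} (q : Cutoff d) (g : Fock d) (Ψ u : Hil d) :
    inner ℂ (kraus q g Ψ) u = inner ℂ (split q Ψ) (tensorRight g.1 u.1) := by
  rw [kraus, ContinuousLinearMap.comp_apply, ContinuousLinearMap.adjoint_inner_left]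
  rfl

/-- `kraus` is defined through an adjoint; testing against a vector `x` and using Fubini identifies
it with an explicit integral over the traced-out configuration. -/
theorem kraus_ae_eq {d : ℕ} (q : Cutoff d) (g : Fock d) (Ψ : Hil d) :
    (kraus q g Ψ).1 =ᵐ[volume] contract q g.1 (cutoffMul q Ψ.1) := by
  have hF := measurable_cutoffMul q (measurable_lp Ψ.1)
  have hs := fieldSymm_cutoffMul q (fieldSymm_hil Ψ)
  have hm : MemLp (contract q g.1 (cutoffMul q Ψ.1)) 2 volume := memLp_contract q g.1 hF hs
    ((lintegral_cutoffMul_le q _).trans_lt (lintegral_lp_lt_top _))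
  let u : Hil d := ⟨hm.toLp, mem_hil (fieldSymm_of_ae_eq hm.coeFn_toLp (fieldSymm_contract q _ hs))⟩
  have h : kraus q g Ψ = u := by
    refine ext_inner_left ℂ fun x => ?_
    rw [← inner_conj_symm, inner_kraus, inner_conj_symm]
    have h1 : inner ℂ x u = inner ℂ x.1 hm.toLp := rfl
    rw [h1, inner_toLp]
    have h2 : split q Ψ = (memLp_splitFun q Ψ).toLp := rfl
    rw [h2, inner_toLp]
    have h3 : tensorRight g.1 x.1 = (memLp_tensor x.1 g.1).toLp := rfl
    rw [h3]
    have h4 : ∀ᵐ p : (Space d × Conf d) × Conf d,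
        starRingEnd ℂ ((memLp_tensor x.1 g.1).toLp _ p) * splitFun q Ψ.1 p =
        starRingEnd ℂ (x.1 p.1) * (starRingEnd ℂ (g.1 p.2) *
          fockSplit q (fun c => cutoffMul q Ψ.1 (p.1.1, c)) p.1.2 p.2) := by
      filter_upwards [(memLp_tensor x.1 g.1).coeFn_toLp] with p hp
      rw [hp, splitFun_eq_fockSplit, map_mul, mul_assoc]
      rfl
    have h5 : Integrable (fun p : (Space d × Conf d) × Conf d =>
        starRingEnd ℂ ((memLp_tensor x.1 g.1).toLp _ p) * splitFun q Ψ.1 p) := by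
      have := L2.integrable_inner (𝕜 := ℂ) (memLp_tensor x.1 g.1).toLp (memLp_splitFun q Ψ).toLp
      refine this.congr ?_
      filter_upwards [(memLp_splitFun q Ψ).coeFn_toLp] with p hp
      rw [hp, RCLike.inner_apply, mul_comm]
    rw [integral_congr_ae h4]
    rw [integrable_congr h4] at h5
    rw [Measure.volume_eq_prod, integral_prod _ h5]
    refine integral_congr_ae (Eventually.of_forall fun z => ?_)
    simp only [integral_const_mul]
    rfl
  rw [h]
  exact hm.coeFn_toLp

/-- This is the antilinear continuous dependence of `kraus q g Ψ` on `g`, in the form that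
`exists_bessel_traceForm` asks for. -/
theorem exists_inner_kraus_eq {d : ℕ} (q : Cutoff d) (Ψ u : Hil d) :
    ∃ l : Fock d →L[ℂ] ℂ, ∀ g, inner ℂ (kraus q g Ψ) u = l g := by
  have hadd : ∀ g h : Fock d, tensorRight (g + h).1 u.1 = tensorRight g.1 u.1 + tensorRight h.1 u.1 := by
    intro g h
    change (memLp_tensor u.1 (g + h).1).toLp =
      (memLp_tensor u.1 g.1).toLp + (memLp_tensor u.1 h.1).toLp
    rw [← MemLp.toLp_add, MemLp.toLp_eq_toLp_iff]
    filter_upwards [Measure.quasiMeasurePreserving_snd (μ := (volume : Measure (Space d × Conf d)))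
      (ν := (volume : Measure (Conf d))) |>.ae (Lp.coeFn_add g.1 h.1)] with p hp
    rw [Submodule.coe_add, hp, Pi.add_apply, Pi.add_apply]
    ring
  have hsmul : ∀ (z : ℂ) (g : Fock d), tensorRight (z • g).1 u.1 = z • tensorRight g.1 u.1 := by
    intro z g
    change (memLp_tensor u.1 (z • g).1).toLp = z • (memLp_tensor u.1 g.1).toLp
    rw [← MemLp.toLp_const_smul, MemLp.toLp_eq_toLp_iff]
    filter_upwards [Measure.quasiMeasurePreserving_snd (μ := (volume : Measure (Space d × Conf d)))
      (ν := (volume : Measure (Conf d))) |>.ae (Lp.coeFn_smul z g.1)] with p hp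
    rw [Submodule.coe_smul, hp, Pi.smul_apply, Pi.smul_apply, smul_eq_mul, smul_eq_mul]
    ring
  let l : Fock d →ₗ[ℂ] ℂ :=
    { toFun := fun g => inner ℂ (split q Ψ) (tensorRight g.1 u.1)
      map_add' := fun g h => (congrArg _ (hadd g h)).trans (inner_add_right _ _ _)
      map_smul' := fun z g => (congrArg _ (hsmul z g)).trans (inner_smul_right _ _ _) }
  refine ⟨l.mkContinuous (‖split q Ψ‖ * ‖u‖) fun g => ?_, fun g => inner_kraus q g Ψ u⟩
  refine (norm_inner_le_norm (𝕜 := ℂ) (split q Ψ) (tensorRight g.1 u.1)).trans ?_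
  rw [mul_assoc]
  gcongr
  refine (ContinuousLinearMap.le_of_opNorm_le _ (LinearMap.mkContinuous_norm_le _ (norm_nonneg _) _)
    _).trans (le_of_eq ?_)
  exact mul_comm _ _

instance instSecondCountableFock (d : ℕ) : SecondCountableTopology (Fock d) :=
  have : Fact ((2 : ℝ≥0∞) ≠ ⊤) := ⟨by simp⟩
  inferInstanceAs (SecondCountableTopology (Fock d : Set (Lp ℂ 2 (volume : Measure (Conf d)))))

instance instSecondCountableHil (d : ℕ) : SecondCountableTopology (Hil d) :=
  have : Fact ((2 : ℝ≥0∞) ≠ ⊤) := ⟨by simp⟩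
  inferInstanceAs
    (SecondCountableTopology (Hil d : Set (Lp ℂ 2 (volume : Measure (Space d × Conf d)))))

instance instCountableFockBasis (d : ℕ) : Countable (exists_hilbertBasis ℂ (Fock d)).choose :=
  countable_of_hilbertBasis (stdBasis (Fock d))

instance instCountableHilBasis (d : ℕ) : Countable (exists_hilbertBasis ℂ (Hil d)).choose :=
  countable_of_hilbertBasis (stdBasis (Hil d))

theorem enorm_hil_sq {d : ℕ} (Ψ : Hil d) : ‖Ψ‖ₑ ^ 2 = ∫⁻ z, ‖Ψ.1 z‖ₑ ^ 2 := by
  rw [← enorm_lp_sq]; rfl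

/-- The left side is the trace of the localized state. It must be known exactly, not just bounded,
since it is multiplied by a negative constant in the energy. -/
theorem tsum_enorm_kraus_sq {d : ℕ} (q : Cutoff d) (Ψ : Hil d) :
    ∑' j, ‖kraus q (stdBasis (Fock d) j) Ψ‖ₑ ^ 2 = ∫⁻ z, ‖cutoffMul q Ψ.1 z‖ₑ ^ 2 := by
  have hfin : ∫⁻ z, ‖cutoffMul q Ψ.1 z‖ₑ ^ 2 < ⊤ :=
    (lintegral_cutoffMul_le q _).trans_lt (lintegral_lp_lt_top _)
  rw [← tsum_lintegral_contract_eq q (stdBasis (Fock d))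
    (measurable_cutoffMul q (measurable_lp Ψ.1)) (fieldSymm_cutoffMul q (fieldSymm_hil Ψ)) hfin]
  refine tsum_congr fun j => ?_
  rw [enorm_hil_sq]
  refine lintegral_congr_ae ?_
  filter_upwards [kraus_ae_eq q (stdBasis (Fock d) j) Ψ] with z hz
  rw [hz]

theorem summable_norm_kraus_sq {d : ℕ} (q : Cutoff d) (Ψ : Hil d) :
    Summable fun j => ‖kraus q (stdBasis (Fock d) j) Ψ‖ ^ 2 := by
  have hfin : ∑' j, ‖kraus q (stdBasis (Fock d) j) Ψ‖ₑ ^ 2 ≠ ⊤ := by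
    rw [tsum_enorm_kraus_sq]
    exact ((lintegral_cutoffMul_le q _).trans_lt (lintegral_lp_lt_top _)).ne
  refine (ENNReal.summable_toReal hfin).congr fun j => ?_
  rw [ENNReal.toReal_pow, toReal_enorm]

theorem comp_rankOne_comp_adjoint {H : Type*} [NormedAddCommGroup H] [InnerProductSpace ℂ H]
    [CompleteSpace H] (K : H →L[ℂ] H) (Ψ : H) :
    K ∘L InnerProductSpace.rankOne ℂ Ψ Ψ ∘L K.adjoint =
      InnerProductSpace.rankOne ℂ (K Ψ) (K Ψ) := by
  ext u
  simp [ContinuousLinearMap.adjoint_inner_right]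

theorem localize_pureState {d : ℕ} (q : Cutoff d) (Ψ : Hil d) :
    localize q (pureState Ψ) = ∑' j, InnerProductSpace.rankOne ℂ
      (kraus q (stdBasis (Fock d) j) Ψ) (kraus q (stdBasis (Fock d) j) Ψ) :=
  tsum_congr fun _ => comp_rankOne_comp_adjoint _ _

/-- Traces against the localization of a pure state, by a Bessel family. -/
theorem exists_traceForm_localize_eq {d : ℕ} (q : Cutoff d) (Ψ : Hil d) :
    ∃ w : (exists_hilbertBasis ℂ (Hil d)).choose → Fock d,
      (∀ h, traceForm h (localize q (pureState Ψ)) = ∑' i, h (kraus q (w i) Ψ)) ∧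
      (∀ g, ∑' i, ‖inner ℂ (w i) g‖ₑ ^ 2 ≤ ‖g‖ₑ ^ 2) ∧
      ∑' i, ‖kraus q (w i) Ψ‖ₑ ^ 2 = ∫⁻ z, ‖cutoffMul q Ψ.1 z‖ₑ ^ 2 := by
  obtain ⟨w, h1, h2, h3⟩ := exists_bessel_traceForm (stdBasis (Fock d))
    (fun g => kraus q g Ψ) (exists_inner_kraus_eq q Ψ) (summable_norm_kraus_sq q Ψ)
  refine ⟨w, fun h => ?_, h2, h3.trans (tsum_enorm_kraus_sq q Ψ)⟩
  rw [localize_pureState]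
  exact h1 h

/-! ### Symmetrization and weak gradients of localized vectors -/

theorem ae_perm {d : ℕ} {p : Conf d → Prop} (h : ∀ᵐ c, p c) :
    ∀ᵐ c : Conf d, ∀ σ : Equiv.Perm (Fin c.1), p ⟨c.1, c.2 ∘ σ⟩ := by
  classical
  have h2 : ∀ᵐ c : Conf d, ∀ n, ∀ σ : Equiv.Perm (Fin n),
      p (Conf.perm (Function.update (fun n => 1) n σ) c) :=
    ae_all_iff.2 fun n => ae_all_iff.2 fun σ => (measurePreserving_perm d
      (Function.update (fun n => 1) n σ)).quasiMeasurePreserving.ae h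
  filter_upwards [h2] with c hc σ
  simpa [Conf.perm] using hc c.1 σ

theorem ae_ae_swap {d : ℕ} {p : Space d × Conf d → Prop} (h : ∀ᵐ z, p z) :
    ∀ᵐ c : Conf d, ∀ᵐ x : Space d, p (x, c) := by
  have h1 : ∀ᵐ z : Conf d × Space d, p z.swap :=
    (Measure.measurePreserving_swap (μ := (volume : Measure (Conf d)))
      (ν := (volume : Measure (Space d)))).quasiMeasurePreserving.ae h
  exact Measure.ae_ae_of_ae_prod h1

theorem ae_lintegral_lt_top {d : ℕ} {f : Space d × Conf d → ℝ≥0∞} (hf : Measurable f)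
    (h : ∫⁻ z, f z < ⊤) : ∀ᵐ c : Conf d, ∫⁻ x : Space d, f (x, c) < ⊤ := by
  rw [Measure.volume_eq_prod, lintegral_prod_symm _ hf.aemeasurable] at h
  exact ae_lt_top hf.lintegral_prod_left' h.ne

/-- The average over all relabellings of the configuration. -/
def symmetrize {d : ℕ} (F : Space d × Conf d → ℂ) (z : Space d × Conf d) : ℂ :=
  ((Fintype.card (Equiv.Perm (Fin z.2.1)) : ℝ)⁻¹ : ℝ) *
    ∑ σ : Equiv.Perm (Fin z.2.1), F (z.1, ⟨z.2.1, z.2.2 ∘ σ⟩)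

theorem measurable_symmetrize {d : ℕ} {F : Space d × Conf d → ℂ} (hF : Measurable F) :
    Measurable (symmetrize F) := by
  refine measurable_of_sectors_prod fun n => ?_
  have h : Measurable fun p : Space d × (Fin n → Space d) =>
      ∑ σ : Equiv.Perm (Fin n), F (p.1, ⟨n, p.2 ∘ σ⟩) := by
    refine Finset.measurable_sum _ fun σ _ => hF.comp ?_
    exact measurable_fst.prodMk ((measurable_mk d n).comp
      ((measurePreserving_comp_perm d n σ).measurable.comp measurable_snd))
  exact h.const_mul (((Fintype.card (Equiv.Perm (Fin n)) : ℝ)⁻¹ : ℝ) : ℂ)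

theorem fieldSymm_symmetrize {d : ℕ} (F : Space d × Conf d → ℂ) : FieldSymm (symmetrize F) := by
  refine Eventually.of_forall fun z σ => ?_
  simp only [symmetrize]
  congr 1
  exact Fintype.sum_equiv (Equiv.mulLeft σ) _ _ fun τ => rfl

/-- Convexity of the square: the square of an average is at most the average of the squares. -/
theorem enorm_symmetrize_sq_le {d : ℕ} (F : Space d × Conf d → ℂ) (x : Space d) (n : ℕ)
    (y : Fin n → Space d) :
    ‖symmetrize F (x, ⟨n, y⟩)‖ₑ ^ 2 ≤ (Fintype.card (Equiv.Perm (Fin n)) : ℝ≥0∞)⁻¹ *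
      ∑ σ : Equiv.Perm (Fin n), ‖F (x, ⟨n, y ∘ σ⟩)‖ₑ ^ 2 := by
  set N := Fintype.card (Equiv.Perm (Fin n)) with hN
  have hN0 : 0 < N := Fintype.card_pos
  have hNR : (0 : ℝ) < N := Nat.cast_pos.2 hN0
  simp_rw [enorm_sq_eq_ofReal]
  rw [← ENNReal.ofReal_sum_of_nonneg fun i _ => by positivity, ← ENNReal.ofReal_natCast,
    ← ENNReal.ofReal_inv_of_pos hNR, ← ENNReal.ofReal_mul (by positivity)]
  refine ENNReal.ofReal_le_ofReal ?_
  simp only [symmetrize, norm_mul, Complex.norm_real, mul_pow, Real.norm_eq_abs, sq_abs]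
  have h1 : ‖∑ σ : Equiv.Perm (Fin n), F (x, ⟨n, y ∘ σ⟩)‖ ^ 2 ≤
      N * ∑ σ : Equiv.Perm (Fin n), ‖F (x, ⟨n, y ∘ σ⟩)‖ ^ 2 := by
    refine (pow_le_pow_left₀ (norm_nonneg _) (norm_sum_le _ _) 2).trans ?_
    exact sq_sum_le_card_mul_sum_sq
  calc ((N : ℝ)⁻¹) ^ 2 * ‖∑ σ : Equiv.Perm (Fin n), F (x, ⟨n, y ∘ σ⟩)‖ ^ 2
      ≤ ((N : ℝ)⁻¹) ^ 2 * (N * ∑ σ : Equiv.Perm (Fin n), ‖F (x, ⟨n, y ∘ σ⟩)‖ ^ 2) := by gcongr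
    _ = _ := by field_simp

theorem lintegral_symmetrize_le {d : ℕ} {F : Space d × Conf d → ℂ} (hF : Measurable F) :
    ∫⁻ z, ‖symmetrize F z‖ₑ ^ 2 ≤ ∫⁻ z, ‖F z‖ₑ ^ 2 := by
  have hm : ∀ {G : Space d × Conf d → ℂ}, Measurable G →
      Measurable fun z => ‖G z‖ₑ ^ 2 := fun h => h.enorm.pow_const 2
  rw [lintegral_volume_prod (hm (measurable_symmetrize hF)), lintegral_volume_prod (hm hF)]
  refine lintegral_mono fun x => ?_
  rw [lintegral_conf (f := fun c => ‖symmetrize F (x, c)‖ₑ ^ 2)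
      ((hm (measurable_symmetrize hF)).comp measurable_prodMk_left),
    lintegral_conf (f := fun c => ‖F (x, c)‖ₑ ^ 2) ((hm hF).comp measurable_prodMk_left)]
  refine ENNReal.tsum_le_tsum fun n => ?_
  have hs : Measurable fun y : Fin n → Space d => ‖F (x, ⟨n, y⟩)‖ₑ ^ 2 :=
    ((hm hF).comp measurable_prodMk_left).comp (measurable_mk d n)
  refine (lintegral_mono fun y => enorm_symmetrize_sq_le F x n y).trans ?_
  rw [lintegral_const_mul' _ _ (by simp [Fintype.card_ne_zero]), lintegral_finsetSum]
  · have h1 : ∀ σ : Equiv.Perm (Fin n), ∫⁻ y : Fin n → Space d, ‖F (x, ⟨n, y ∘ σ⟩)‖ₑ ^ 2 =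
        ∫⁻ y : Fin n → Space d, ‖F (x, ⟨n, y⟩)‖ₑ ^ 2 := fun σ =>
      (measurePreserving_comp_perm d n σ).lintegral_comp hs
    simp_rw [h1]
    rw [Finset.sum_const, Finset.card_univ, nsmul_eq_mul, ← mul_assoc,
      ENNReal.inv_mul_cancel (by simp [Fintype.card_ne_zero]) (by simp), one_mul]
  · exact fun σ _ => hs.comp (measurePreserving_comp_perm d n σ).measurable

theorem memLp_test {d : ℕ} {φ : Space d → ℝ} (hφ : Continuous φ) (hc : HasCompactSupport φ) :
    MemLp (fun x => (φ x : ℂ)) 2 volume := by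
  have h := hφ.memLp_of_hasCompactSupport (p := 2) hc (μ := (volume : Measure (Space d)))
  exact h.ofReal

theorem ae_integrable_test_mul {d : ℕ} {φ : Space d → ℝ} (hφ : Continuous φ)
    (hc : HasCompactSupport φ) {F : Space d × Conf d → ℂ} (hF : Measurable F)
    (hfin : ∫⁻ z, ‖F z‖ₑ ^ 2 < ⊤) :
    ∀ᵐ c : Conf d, Integrable fun x => (φ x : ℂ) * F (x, c) := by
  filter_upwards [ae_lintegral_lt_top (hF.enorm.pow_const 2) hfin] with c h
  exact (memLp_test hφ hc).integrable_mul
    (memLp_two_of_lintegral_lt_top (hF.comp measurable_prodMk_right) h)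

/-- The weak gradient of a symmetric function can be taken symmetric. -/
theorem exists_fieldSymm_isWeakGradient {d : ℕ} (Ψ : Hil d)
    {G : Fin d → Lp ℂ 2 (volume : Measure (Space d × Conf d))} (hG : IsWeakGradient Ψ.1 G) :
    ∃ G' : Fin d → Lp ℂ 2 (volume : Measure (Space d × Conf d)), IsWeakGradient Ψ.1 G' ∧
      (∀ j, FieldSymm (G' j : Space d × Conf d → ℂ)) ∧ ∀ j, ‖G' j‖ₑ ^ 2 ≤ ‖G j‖ₑ ^ 2 := by
  have hmem : ∀ j, MemLp (symmetrize (G j)) 2 volume := fun j =>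
    memLp_two_of_lintegral_lt_top (measurable_symmetrize (measurable_lp _))
      ((lintegral_symmetrize_le (measurable_lp _)).trans_lt (lintegral_lp_lt_top _))
  refine ⟨fun j => (hmem j).toLp, fun j φ hφ hc => ?_, fun j =>
    fieldSymm_of_ae_eq (hmem j).coeFn_toLp (fieldSymm_symmetrize _), fun j => ?_⟩
  · filter_upwards [ae_perm (hG j φ hφ hc), ae_ae_swap (fieldSymm_hil Ψ),
      ae_perm (ae_integrable_test_mul hφ.continuous hc (measurable_lp (G j))
        (lintegral_lp_lt_top _)), ae_ae_swap (hmem j).coeFn_toLp] with c h1 h2 h3 h4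
    have e1 : ∫ x, (φ x : ℂ) * (hmem j).toLp _ (x, c) =
        ∫ x, ((Fintype.card (Equiv.Perm (Fin c.1)) : ℝ)⁻¹ : ℝ) *
          ∑ σ : Equiv.Perm (Fin c.1), (φ x : ℂ) * G j (x, ⟨c.1, c.2 ∘ σ⟩) := by
      refine integral_congr_ae ?_
      filter_upwards [h4] with x hx
      rw [hx, symmetrize, ← Finset.mul_sum]
      ring
    rw [e1, integral_const_mul, integral_finsetSum _ fun σ _ => h3 σ]
    -- Since `Ψ` is symmetric, every relabelling of its gradient satisfies the same integration by
    -- parts, and so does the average.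
    have e2 : ∀ σ : Equiv.Perm (Fin c.1), ∫ x, (φ x : ℂ) * G j (x, ⟨c.1, c.2 ∘ σ⟩) =
        -∫ x, (fderiv ℝ φ x (EuclideanSpace.single j 1) : ℂ) * Ψ.1 (x, c) := by
      intro σ
      rw [← neg_eq_iff_eq_neg, ← h1 σ]
      refine integral_congr_ae ?_
      filter_upwards [h2] with x hx
      rw [hx σ]
    simp_rw [e2]
    rw [Finset.sum_const, Finset.card_univ, nsmul_eq_mul, ← mul_assoc]
    have h0 : (Fintype.card (Equiv.Perm (Fin c.1)) : ℂ) ≠ 0 := by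
      exact_mod_cast Fintype.card_ne_zero
    rw [Complex.ofReal_inv, Complex.ofReal_natCast, inv_mul_cancel₀ h0]
    ring
  · rw [enorm_toLp_sq, enorm_lp_sq]
    exact lintegral_symmetrize_le (measurable_lp _)

/-- Fubini: for almost every `c` the split function is square integrable in `(x, c')`, and so is `φ
⊗ w̄`. The remaining integral over `x` is the one in the definition of a weak derivative. -/
theorem integral_mul_contract {d : ℕ} (q : Cutoff d) (w : Lp ℂ 2 (volume : Measure (Conf d)))
    {F : Space d × Conf d → ℂ} (hF : Measurable F) (hs : FieldSymm F)
    (hfin : ∫⁻ z, ‖F z‖ₑ ^ 2 < ⊤) {φ : Space d → ℝ} (hφ : Continuous φ)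
    (hc : HasCompactSupport φ) :
    ∀ᵐ c : Conf d, ∫ x, (φ x : ℂ) * contract q w F (x, c) =
      ∫ c', starRingEnd ℂ (w c') * splitWeight q c c' * ∫ x, (φ x : ℂ) * F (x, c.cat c') := by
  have hm := measurable_fockSplit q hF
  have hm2 := (hm.enorm.pow_const 2).lintegral_prod_right' (ν := (volume : Measure (Conf d)))
  rw [← lintegral_lintegral_fockSplit q hF hs] at hfin
  filter_upwards [ae_lintegral_lt_top hm2 hfin] with c hcfin
  have hmc : Measurable fun p : Space d × Conf d => fockSplit q (fun e => F (p.1, e)) c p.2 := by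
    refine (Complex.measurable_ofReal.comp ((measurable_splitWeight q).comp
      (measurable_const.prodMk measurable_snd))).mul (hF.comp ?_)
    exact measurable_fst.prodMk ((measurable_cat d).comp (measurable_const.prodMk measurable_snd))
  have h1 : MemLp (fun p : Space d × Conf d => fockSplit q (fun e => F (p.1, e)) c p.2) 2
      volume := by
    refine memLp_two_of_lintegral_lt_top hmc ?_
    rwa [lintegral_volume_prod (hmc.enorm.pow_const 2)]
  have hmt : Measurable fun p : Space d × Conf d => (φ p.1 : ℂ) * starRingEnd ℂ (w p.2) :=
    (Complex.measurable_ofReal.comp (hφ.measurable.comp measurable_fst)).mul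
      (RCLike.continuous_conj.measurable.comp ((measurable_lp w).comp measurable_snd))
  have h2 : MemLp (fun p : Space d × Conf d => (φ p.1 : ℂ) * starRingEnd ℂ (w p.2)) 2
      volume := by
    refine memLp_two_of_lintegral_lt_top hmt ?_
    have hw := lintegral_lp_lt_top w
    have hφ2 := lintegral_lp_lt_top (memLp_test hφ hc).toLp
    rw [← enorm_lp_sq, enorm_toLp_sq] at hφ2
    simp_rw [enorm_mul, mul_pow, RCLike.enorm_conj]
    rw [Measure.volume_eq_prod, lintegral_prod_mul (f := fun x => ‖(φ x : ℂ)‖ₑ ^ 2)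
      ((Complex.measurable_ofReal.comp hφ.measurable).enorm.pow_const 2).aemeasurable
      ((measurable_lp w).enorm.pow_const 2).aemeasurable]
    exact ENNReal.mul_lt_top hφ2 hw
  have h3 : Integrable (Function.uncurry fun (x : Space d) (c' : Conf d) =>
      (φ x : ℂ) * starRingEnd ℂ (w c') * fockSplit q (fun e => F (x, e)) c c')
      ((volume : Measure (Space d)).prod (volume : Measure (Conf d))) :=
    h2.integrable_mul h1
  calc ∫ x, (φ x : ℂ) * contract q w F (x, c)
      = ∫ x, ∫ c', (φ x : ℂ) * starRingEnd ℂ (w c') * fockSplit q (fun e => F (x, e)) c c' := by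
        simp only [contract, ← integral_const_mul, mul_assoc]
    _ = ∫ c', ∫ x, (φ x : ℂ) * starRingEnd ℂ (w c') * fockSplit q (fun e => F (x, e)) c c' :=
        integral_integral_swap h3
    _ = _ := by
        refine integral_congr_ae (Eventually.of_forall fun c' => ?_)
        simp only
        rw [← integral_const_mul]
        refine integral_congr_ae (Eventually.of_forall fun x => ?_)
        simp only [fockSplit]
        ring

/-- The `j`-th component of the gradient of `q Ψ`, if `G` is the gradient of `Ψ`. -/
def cutoffGradient {d : ℕ} (q : Cutoff d) (Ψ : Space d × Conf d → ℂ)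
    (G : Fin d → Space d × Conf d → ℂ) (j : Fin d) (z : Space d × Conf d) : ℂ :=
  (q.toFun z.1 : ℂ) * G j z + (fderiv ℝ q.toFun z.1 (EuclideanSpace.single j 1) : ℂ) * Ψ z

theorem measurable_cutoffGradient {d : ℕ} (q : Cutoff d) {Ψ : Space d × Conf d → ℂ}
    (hΨ : Measurable Ψ) {G : Fin d → Space d × Conf d → ℂ} (hG : ∀ j, Measurable (G j))
    (j : Fin d) : Measurable (cutoffGradient q Ψ G j) := by
  have h : Measurable fun x => fderiv ℝ q.toFun x (EuclideanSpace.single j 1) :=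
    measurable_fderiv_apply_const ℝ _ _
  exact ((Complex.measurable_ofReal.comp (q.measurable.comp measurable_fst)).mul (hG j)).add
    ((Complex.measurable_ofReal.comp (h.comp measurable_fst)).mul hΨ)

theorem fieldSymm_cutoffGradient {d : ℕ} (q : Cutoff d) {Ψ : Space d × Conf d → ℂ}
    (hΨ : FieldSymm Ψ) {G : Fin d → Space d × Conf d → ℂ} (hG : ∀ j, FieldSymm (G j))
    (j : Fin d) : FieldSymm (cutoffGradient q Ψ G j) := by
  filter_upwards [hΨ, hG j] with z h1 h2 σ
  rw [cutoffGradient, cutoffGradient, h1, h2]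

theorem norm_single_one {d : ℕ} (j : Fin d) : ‖(EuclideanSpace.single j 1 : Space d)‖ = 1 := by
  simp

theorem memLp_cutoffGradient {d : ℕ} (q : Cutoff d) {B : ℝ}
    (hB : ∀ x, ‖fderiv ℝ q.toFun x‖ ≤ B) (Ψ : Lp ℂ 2 (volume : Measure (Space d × Conf d)))
    (G : Fin d → Lp ℂ 2 (volume : Measure (Space d × Conf d))) (j : Fin d) :
    MemLp (cutoffGradient q Ψ (fun j => G j) j) 2 volume := by
  have h : Measurable fun x => fderiv ℝ q.toFun x (EuclideanSpace.single j 1) :=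
    measurable_fderiv_apply_const ℝ _ _
  refine MemLp.add ?_ ?_
  · refine MemLp.of_le (Lp.memLp (G j)) ?_ (Eventually.of_forall fun z => ?_)
    · exact ((Complex.measurable_ofReal.comp (q.measurable.comp measurable_fst)).mul
        (measurable_lp (G j))).aestronglyMeasurable
    · rw [norm_mul, Complex.norm_real, Real.norm_of_nonneg (q.nonneg _)]
      exact mul_le_of_le_one_left (norm_nonneg _) (q.le_one _)
  · refine MemLp.of_le_mul (c := B) (Lp.memLp Ψ) ?_ (Eventually.of_forall fun z => ?_)
    · exact ((Complex.measurable_ofReal.comp (h.comp measurable_fst)).mul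
        (measurable_lp Ψ)).aestronglyMeasurable
    · rw [norm_mul, Complex.norm_real]
      gcongr
      refine (ContinuousLinearMap.le_opNorm _ _).trans ?_
      rw [norm_single_one, mul_one]
      exact hB _

/-- Product rule in weak form: the cutoff is moved onto the test function, and `φ q` is again smooth
with compact support. -/
theorem integral_fderiv_mul_cutoff {d : ℕ} (q : Cutoff d) (hq : ContDiff ℝ ∞ q.toFun)
    (Ψ : Lp ℂ 2 (volume : Measure (Space d × Conf d)))
    {G : Fin d → Lp ℂ 2 (volume : Measure (Space d × Conf d))} (hG : IsWeakGradient Ψ G)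
    (j : Fin d) {φ : Space d → ℝ} (hφ : ContDiff ℝ ∞ φ) (hc : HasCompactSupport φ) :
    ∀ᵐ c : Conf d, ∫ x, (fderiv ℝ φ x (EuclideanSpace.single j 1) : ℂ) * cutoffMul q Ψ (x, c) =
      -∫ x, (φ x : ℂ) * cutoffGradient q Ψ (fun j => G j) j (x, c) := by
  set e : Space d := EuclideanSpace.single j 1
  have hφq : ContDiff ℝ ∞ fun x => φ x * q.toFun x := hφ.mul hq
  have hcq : HasCompactSupport fun x => φ x * q.toFun x := hc.mul_right
  have hcd : HasCompactSupport fun x => φ x * fderiv ℝ q.toFun x e := hc.mul_right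
  have hdc : ∀ {f : Space d → ℝ}, ContDiff ℝ ∞ f → Continuous fun x => fderiv ℝ f x e :=
    fun h => (h.continuous_fderiv (by simp)).clm_apply continuous_const
  have hΨ := measurable_lp Ψ
  have hΨ2 := lintegral_lp_lt_top Ψ
  have hcd2 : HasCompactSupport fun x => fderiv ℝ (fun x => φ x * q.toFun x) x e :=
    hcq.fderiv_apply ℝ e
  filter_upwards [hG j _ hφq hcq,
    ae_integrable_test_mul (hdc hφq) hcd2 hΨ hΨ2,
    ae_integrable_test_mul (φ := fun x => φ x * fderiv ℝ q.toFun x e)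
      (hφ.continuous.mul (hdc hq)) hcd hΨ hΨ2,
    ae_integrable_test_mul hφq.continuous hcq (measurable_lp (G j)) (lintegral_lp_lt_top (G j))]
    with c h1 h2 h3 h4
  have e1 : ∀ x, fderiv ℝ (fun x => φ x * q.toFun x) x e =
      φ x * fderiv ℝ q.toFun x e + fderiv ℝ φ x e * q.toFun x := by
    intro x
    rw [fderiv_fun_mul (hφ.differentiable (by simp) x) (hq.differentiable (by simp) x)]
    simp [mul_comm]
  have e2 : ∫ x, (fderiv ℝ φ x e : ℂ) * cutoffMul q Ψ (x, c) =
      (∫ x, (fderiv ℝ (fun x => φ x * q.toFun x) x e : ℂ) * Ψ (x, c)) -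
      ∫ x, ((φ x * fderiv ℝ q.toFun x e : ℝ) : ℂ) * Ψ (x, c) := by
    rw [← integral_sub h2 h3]
    refine integral_congr_ae (Eventually.of_forall fun x => ?_)
    simp only [cutoffMul, e1]
    push_cast
    ring
  have e3 : ∫ x, (φ x : ℂ) * cutoffGradient q Ψ (fun j => G j) j (x, c) =
      (∫ x, ((φ x * q.toFun x : ℝ) : ℂ) * G j (x, c)) +
      ∫ x, ((φ x * fderiv ℝ q.toFun x e : ℝ) : ℂ) * Ψ (x, c) := by
    rw [← integral_add h4 h3]
    refine integral_congr_ae (Eventually.of_forall fun x => ?_)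
    simp only [cutoffGradient]
    push_cast
    ring
  rw [e2, e3, h1]
  ring

/-- The contraction acts on the configuration only and therefore commutes with differentiation in
`x`. The identity for `q Ψ` is used at `c.cat c'`, where it holds almost everywhere because
concatenation pulls null sets back to null sets. -/
theorem isWeakGradient_kraus {d : ℕ} (q : Cutoff d) (hq : ContDiff ℝ ∞ q.toFun) {B : ℝ}
    (hB : ∀ x, ‖fderiv ℝ q.toFun x‖ ≤ B) (w : Fock d) (Ψ : Hil d)
    {G : Fin d → Lp ℂ 2 (volume : Measure (Space d × Conf d))} (hG : IsWeakGradient Ψ.1 G)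
    (hGs : ∀ j, FieldSymm (G j : Space d × Conf d → ℂ))
    {K : Fin d → Lp ℂ 2 (volume : Measure (Space d × Conf d))}
    (hK : ∀ j, K j =ᵐ[volume] contract q w.1 (cutoffGradient q Ψ.1 (fun j => G j) j)) :
    IsWeakGradient (kraus q w Ψ).1 K := by
  intro j φ hφ hc
  have hdc : Continuous fun x => fderiv ℝ φ x (EuclideanSpace.single j 1) :=
    (hφ.continuous_fderiv (by simp)).clm_apply continuous_const
  have hfin : ∀ {F : Space d × Conf d → ℂ}, MemLp F 2 volume → ∫⁻ z, ‖F z‖ₑ ^ 2 < ⊤ := by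
    intro F h
    rw [← enorm_toLp_sq h]
    exact ENNReal.pow_lt_top enorm_lt_top
  have hcat := Measure.ae_ae_of_ae_prod ((quasiMeasurePreserving_cat d).ae
    (integral_fderiv_mul_cutoff q hq Ψ.1 hG j hφ hc))
  filter_upwards [hcat, ae_ae_swap (hK j), ae_ae_swap (kraus_ae_eq q w Ψ),
    integral_mul_contract q w.1 (measurable_cutoffMul q (measurable_lp Ψ.1))
      (fieldSymm_cutoffMul q (fieldSymm_hil Ψ))
      ((lintegral_cutoffMul_le q _).trans_lt (lintegral_lp_lt_top _)) hdc
      (hc.fderiv_apply ℝ _),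
    integral_mul_contract q w.1 (measurable_cutoffGradient q (measurable_lp Ψ.1)
      (fun j => measurable_lp (G j)) j) (fieldSymm_cutoffGradient q (fieldSymm_hil Ψ) hGs j)
      (hfin (memLp_cutoffGradient q hB Ψ.1 G j)) hφ.continuous hc] with c h1 h2 h3 h4 h5
  have e1 : ∫ x, (fderiv ℝ φ x (EuclideanSpace.single j 1) : ℂ) * (kraus q w Ψ).1 (x, c) =
      ∫ x, (fderiv ℝ φ x (EuclideanSpace.single j 1) : ℂ) *
        contract q w.1 (cutoffMul q Ψ.1) (x, c) := by
    refine integral_congr_ae ?_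
    filter_upwards [h3] with x hx
    rw [hx]
  have e2 : ∫ x, (φ x : ℂ) * K j (x, c) =
      ∫ x, (φ x : ℂ) * contract q w.1 (cutoffGradient q Ψ.1 (fun j => G j) j) (x, c) := by
    refine integral_congr_ae ?_
    filter_upwards [h2] with x hx
    rw [hx]
  rw [e1, e2, h4, h5, ← integral_neg]
  refine integral_congr_ae ?_
  filter_upwards [h1] with c' hc'
  rw [hc']
  ring

/-- `kinetic` is an infimum, so exhibiting one gradient of each Kraus vector bounds it from above;
only upper bounds are needed. -/
theorem tsum_kinetic_kraus_le {d : ℕ} (q : Cutoff d) (hq : ContDiff ℝ ∞ q.toFun) {B : ℝ}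
    (hB : ∀ x, ‖fderiv ℝ q.toFun x‖ ≤ B) {ι : Type*} [Countable ι] {w : ι → Fock d}
    (hw : ∀ g, ∑' i, ‖inner ℂ (w i) g‖ₑ ^ 2 ≤ ‖g‖ₑ ^ 2) (Ψ : Hil d)
    {G : Fin d → Lp ℂ 2 (volume : Measure (Space d × Conf d))} (hG : IsWeakGradient Ψ.1 G)
    (hGs : ∀ j, FieldSymm (G j : Space d × Conf d → ℂ)) :
    ∑' i, kinetic (kraus q (w i) Ψ) ≤
      ∑ j, ∫⁻ z, ‖cutoffGradient q Ψ.1 (fun j => G j) j z‖ₑ ^ 2 := by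
  have hm := fun j => measurable_cutoffGradient q (measurable_lp Ψ.1)
    (fun j => measurable_lp (G j)) j
  have hs := fun j => fieldSymm_cutoffGradient q (fieldSymm_hil Ψ) hGs j
  have hL := fun j => memLp_cutoffGradient q hB Ψ.1 G j
  have hfin : ∀ j, ∫⁻ z, ‖cutoffGradient q Ψ.1 (fun j => G j) j z‖ₑ ^ 2 < ⊤ := fun j => by
    rw [← enorm_toLp_sq (hL j)]
    exact ENNReal.pow_lt_top enorm_lt_top
  have hC := fun i j => memLp_contract q (w i).1 (hm j) (hs j) (hfin j)
  calc ∑' i, kinetic (kraus q (w i) Ψ)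
      ≤ ∑' i, ∑ j, ∫⁻ z, ‖contract q (w i).1 (cutoffGradient q Ψ.1 (fun j => G j) j) z‖ₑ ^ 2 := by
        refine ENNReal.tsum_le_tsum fun i => ?_
        refine (iInf₂_le (fun j => (hC i j).toLp) (isWeakGradient_kraus q hq hB (w i) Ψ hG hGs
          fun j => (hC i j).coeFn_toLp)).trans (le_of_eq ?_)
        exact Finset.sum_congr rfl fun j _ => enorm_toLp_sq (hC i j)
    _ = ∑ j, ∑' i, ∫⁻ z, ‖contract q (w i).1 (cutoffGradient q Ψ.1 (fun j => G j) j) z‖ₑ ^ 2 :=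
        Summable.tsum_finsetSum fun _ _ => ENNReal.summable
    _ ≤ _ := Finset.sum_le_sum fun j _ => tsum_lintegral_contract_le q hw (hm j) (hs j)

/-! ### Annihilation operators and the localized field energy -/

theorem measurePreserving_finCons (d n : ℕ) :
    MeasurePreserving (fun p : Space d × (Fin n → Space d) =>
      (Fin.cons p.1 p.2 : Fin (n + 1) → Space d)) := by
  have h := (volume_preserving_piFinSuccAbove (fun _ : Fin (n + 1) => Space d) 0).symm
  refine measurePreserving_of_eq h (funext fun p => ?_)
  simp [MeasurableEquiv.piFinSuccAbove, Fin.insertNthEquiv]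

theorem measurable_cons (d : ℕ) : Measurable fun p : Space d × Conf d => Conf.cons p.1 p.2 :=
  measurable_of_sectors_prod fun n =>
    (measurable_mk d (n + 1)).comp (measurePreserving_finCons d n).measurable

theorem quasiMeasurePreserving_cons (d : ℕ) :
    Measure.QuasiMeasurePreserving (fun p : Space d × Conf d => Conf.cons p.1 p.2) := by
  refine ⟨measurable_cons d, Measure.AbsolutelyContinuous.mk fun s hs h0 => ?_⟩
  have h0' : ∀ᵐ c : Conf d, c ∉ s := measure_eq_zero_iff_ae_notMem.1 h0
  have hI : Measurable (s.indicator (1 : Conf d → ℝ≥0∞)) := measurable_one.indicator hs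
  have hm := measurable_cons d hs
  rw [Measure.map_apply (measurable_cons d) hs, ← lintegral_indicator_one hm,
    lintegral_volume_prod (measurable_one.indicator hm)]
  have h1 : ∀ x : Space d, ∫⁻ c, ((fun p : Space d × Conf d => Conf.cons p.1 p.2) ⁻¹' s).indicator
      (1 : Space d × Conf d → ℝ≥0∞) (x, c) =
      ∑' n, ∫⁻ y : Fin n → Space d, s.indicator 1 (⟨n + 1, Fin.cons x y⟩ : Conf d) := fun x =>
    lintegral_conf (f := fun c => s.indicator 1 (Conf.cons x c))
      (hI.comp ((measurable_cons d).comp measurable_prodMk_left))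
  simp_rw [h1]
  have h2 : ∀ n, Measurable fun p : Space d × (Fin n → Space d) =>
      s.indicator (1 : Conf d → ℝ≥0∞) (⟨n + 1, Fin.cons p.1 p.2⟩ : Conf d) := fun n =>
    hI.comp ((measurable_mk d (n + 1)).comp (measurePreserving_finCons d n).measurable)
  rw [lintegral_tsum fun n => (h2 n).lintegral_prod_right'.aemeasurable, ENNReal.tsum_eq_zero]
  intro n
  rw [← lintegral_volume_prod (h2 n)]
  refine ((measurePreserving_finCons d n).lintegral_comp
    (f := fun y => s.indicator 1 (⟨n + 1, y⟩ : Conf d)) (hI.comp (measurable_mk d _))).trans ?_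
  refine (lintegral_eq_zero_iff (hI.comp (measurable_mk d _))).2 ?_
  filter_upwards [ae_conf h0' (n + 1)] with w hw
  simp [hw]

/-- Moving the point `y` into the configuration. -/
def absorb {d : ℕ} (r : Space d × (Space d × Conf d)) : Space d × Conf d :=
  (r.2.1, r.2.2.cons r.1)

theorem quasiMeasurePreserving_absorb (d : ℕ) :
    Measure.QuasiMeasurePreserving (absorb (d := d)) := by
  have h1 := (volume_preserving_prodAssoc (α₁ := Space d) (β₁ := Space d)
    (γ₁ := Conf d)).symm
  have h2 : MeasurePreserving (Prod.map Prod.swap id :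
      (Space d × Space d) × Conf d → (Space d × Space d) × Conf d) :=
    (Measure.measurePreserving_swap (μ := (volume : Measure (Space d)))
      (ν := (volume : Measure (Space d)))).prod (MeasurePreserving.id volume)
  have h3 := volume_preserving_prodAssoc (α₁ := Space d) (β₁ := Space d) (γ₁ := Conf d)
  exact (QuasiMeasurePreserving.prodMap (Measure.QuasiMeasurePreserving.id volume)
    (quasiMeasurePreserving_cons d)).comp (h3.comp (h2.comp h1)).quasiMeasurePreserving

theorem annih_eq {d : ℕ} (α : ℝ) (F : Space d × Conf d → ℂ) (r : Space d × (Space d × Conf d)) :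
    annih α F r.1 r.2 = ((α⁻¹ * √(r.2.2.1 + 1) : ℝ) : ℂ) * F (absorb r) := rfl

theorem measurable_annih {d : ℕ} (α : ℝ) {F : Space d × Conf d → ℂ} (hF : Measurable F) :
    Measurable fun r : Space d × (Space d × Conf d) => annih α F r.1 r.2 := by
  have h : Measurable fun n : ℕ => α⁻¹ * √((n : ℝ) + 1) := measurable_of_countable _
  exact (Complex.measurable_ofReal.comp (h.comp (measurable_conf_fst.comp
    (measurable_snd.comp measurable_snd)))).mul
    (hF.comp (quasiMeasurePreserving_absorb d).measurable)

theorem Conf.cons_perm {d : ℕ} (y : Space d) (c : Conf d) (σ : Equiv.Perm (Fin c.1)) :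
    ∃ τ : Equiv.Perm (Fin (c.cons y).1),
      Conf.cons y ⟨c.1, c.2 ∘ σ⟩ = ⟨(c.cons y).1, (c.cons y).2 ∘ τ⟩ := by
  refine ⟨Equiv.Perm.decomposeFin.symm (0, σ), ?_⟩
  simp only [Conf.cons]
  congr 1
  funext i
  refine Fin.cases ?_ (fun j => ?_) i
  · rw [Function.comp_apply]
    exact (congrArg (Fin.cons (α := fun _ => Space d) y c.2)
      (Equiv.Perm.decomposeFin_symm_apply_zero 0 σ)).symm
  · refine Eq.trans ?_ (congrArg (Fin.cons (α := fun _ => Space d) y c.2)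
      (Equiv.Perm.decomposeFin_symm_apply_succ σ 0 j)).symm
    simp

theorem fieldSymm_annih {d : ℕ} (α : ℝ) {F : Space d × Conf d → ℂ} (hs : FieldSymm F) :
    ∀ᵐ y : Space d, FieldSymm (annih α F y) := by
  have h := Measure.ae_ae_of_ae_prod ((quasiMeasurePreserving_absorb d).ae hs)
  filter_upwards [h] with y hy
  filter_upwards [hy] with z hz σ
  obtain ⟨τ, hτ⟩ := Conf.cons_perm y z.2 σ
  have h2 := hz τ
  simp only [annih, hτ]
  rw [show F (z.1, ⟨(z.2.cons y).1, (z.2.cons y).2 ∘ τ⟩) = F (z.1, z.2.cons y) from h2]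

theorem Conf.cat_cons {d : ℕ} (y : Space d) (c c' : Conf d) :
    (c.cons y).cat c' = (c.cat c').cons y := by
  simp only [Conf.cat, Conf.cons]
  refine Sigma.ext (by simp only; omega) ?_
  simp only
  rw [Fin.append_cons]
  -- The two index types `Fin (n + 1 + m)` and `Fin (n + m + 1)` are only propositionally equal;
  -- indices with the same value correspond.
  refine Function.hfunext (by congr 1; omega) fun a b hab => ?_
  refine heq_of_eq ?_
  rw [Function.comp_apply]
  congr 1
  refine Fin.ext ?_
  rw [Fin.val_cast]
  exact (Fin.heq_ext_iff (by omega)).1 hab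

/-- The binomial identity `(n+1) C(n+m+1, n+1) = (n+m+1) C(n+m, n)` under the square root, with the
factor `q(y)` of the added point split off. -/
theorem splitWeight_cons {d : ℕ} (q : Cutoff d) (y : Space d) (c c' : Conf d) :
    √((c.1 : ℝ) + 1) * splitWeight q (c.cons y) c' =
      q.toFun y * (√(((c.cat c').1 : ℝ) + 1) * splitWeight q c c') := by
  have h1 : √((c.1 : ℝ) + 1) * √(((c.1 + 1 + c'.1).choose (c.1 + 1) : ℕ) : ℝ) =
      √(((c.1 + c'.1 : ℕ) : ℝ) + 1) * √(((c.1 + c'.1).choose c.1 : ℕ) : ℝ) := by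
    rw [← Real.sqrt_mul (by positivity), ← Real.sqrt_mul (by positivity)]
    congr 1
    have := Nat.add_one_mul_choose_eq (c.1 + c'.1) c.1
    have e : c.1 + 1 + c'.1 = (c.1 + c'.1).succ := by omega
    rw [e, mul_comm]
    exact_mod_cast this.symm
  have h2 : ∏ i, q.toFun ((c.cons y).2 i) = q.toFun y * ∏ i, q.toFun (c.2 i) :=
    Fin.prod_univ_succ _
  simp only [splitWeight]
  rw [h2]
  calc _ = (√((c.1 : ℝ) + 1) * √(((c.1 + 1 + c'.1).choose (c.1 + 1) : ℕ) : ℝ)) *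
        (q.toFun y * ∏ i, q.toFun (c.2 i)) * ∏ j, √(1 - q.toFun (c'.2 j) ^ 2) := by
        simp only [Conf.cons]; ring
    _ = _ := by rw [h1]; simp only [Conf.cat]; ring

/-- The intertwining relation `(a_y ⊗ 1) U G(Q) = U G(Q) q(y) a_y`. -/
theorem fockSplit_annih {d : ℕ} (q : Cutoff d) (α : ℝ) (F : Space d × Conf d → ℂ)
    (y : Space d) (z : Space d × Conf d) (c' : Conf d) :
    ((α⁻¹ * √(z.2.1 + 1) : ℝ) : ℂ) * fockSplit q (fun c => F (z.1, c)) (z.2.cons y) c' =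
      fockSplit q (fun c => (q.toFun y : ℂ) * annih α F y (z.1, c)) z.2 c' := by
  have h := congrArg (fun t : ℝ => (t : ℂ)) (splitWeight_cons q y z.2 c')
  simp only [fockSplit, annih, Conf.cat_cons]
  push_cast at h ⊢
  linear_combination (α : ℂ)⁻¹ * F (z.1, (z.2.cat c').cons y) * h

/-- The function `(y, z) ↦ (q(y) a_y Ψ + v(x - y) Ψ)(z)`, with `z = (x, c)`. -/
def fieldFun {d : ℕ} (α : ℝ) (q v : Space d → ℝ) (F : Space d × Conf d → ℂ)
    (r : Space d × (Space d × Conf d)) : ℂ :=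
  (q r.1 : ℂ) * annih α F r.1 r.2 + (v (r.2.1 - r.1) : ℂ) * F r.2

theorem measurable_fieldFun {d : ℕ} (α : ℝ) {q v : Space d → ℝ} (hq : Measurable q)
    (hv : Measurable v) {F : Space d × Conf d → ℂ} (hF : Measurable F) :
    Measurable (fieldFun α q v F) :=
  ((Complex.measurable_ofReal.comp (hq.comp measurable_fst)).mul (measurable_annih α hF)).add
    ((Complex.measurable_ofReal.comp (hv.comp ((measurable_fst.comp measurable_snd).sub
      measurable_fst))).mul (hF.comp measurable_snd))

/-- `∫ ‖(a_y + v(x - y)) Ψ‖² dy`. -/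
def fieldEnergy {d : ℕ} (α : ℝ) (v : Space d → ℝ) (Ψ : Hil d) : ℝ≥0∞ :=
  ∫⁻ r, ‖fieldFun α 1 v Ψ.1 r‖ₑ ^ 2

theorem fieldFun_ae_congr {d : ℕ} (α : ℝ) (q v : Space d → ℝ) {F G : Space d × Conf d → ℂ}
    (h : F =ᵐ[volume] G) : fieldFun α q v F =ᵐ[volume] fieldFun α q v G := by
  filter_upwards [(quasiMeasurePreserving_absorb d).ae h,
    (Measure.quasiMeasurePreserving_snd (μ := (volume : Measure (Space d)))
      (ν := (volume : Measure (Space d × Conf d)))).ae h] with r h1 h2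
  rw [fieldFun, fieldFun, annih_eq, annih_eq, h1, h2]

/-- The exceptional null set does not depend on `w`, so Bessel's inequality can be applied to a
whole family at a fixed `r`. It suffices that the split function is square integrable at `r.2` and
at `absorb r`. -/
theorem fieldFun_contract {d : ℕ} (α : ℝ) (q : Cutoff d) (v : Space d → ℝ)
    {F : Space d × Conf d → ℂ} (hF : Measurable F) (hs : FieldSymm F)
    (hfin : ∫⁻ z, ‖F z‖ₑ ^ 2 < ⊤) :
    ∀ᵐ r : Space d × (Space d × Conf d), ∀ w : Lp ℂ 2 (volume : Measure (Conf d)),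
      fieldFun α 1 v (contract q w F) r = ∫ c', starRingEnd ℂ (w c') *
        fockSplit q (fun c => fieldFun α q.toFun v F (r.1, (r.2.1, c))) r.2.2 c' := by
  have hm := ((measurable_fockSplit q hF).enorm.pow_const 2).lintegral_prod_right'
    (ν := (volume : Measure (Conf d)))
  rw [← lintegral_lintegral_fockSplit q hF hs] at hfin
  have hgood := ae_lt_top hm hfin.ne
  filter_upwards [(quasiMeasurePreserving_absorb d).ae hgood,
    (Measure.quasiMeasurePreserving_snd (μ := (volume : Measure (Space d)))
      (ν := (volume : Measure (Space d × Conf d)))).ae hgood] with r h1 h2 w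
  have hi : ∀ z : Space d × Conf d,
      ∫⁻ c', ‖fockSplit q (fun c => F (z.1, c)) z.2 c'‖ₑ ^ 2 < ⊤ →
      Integrable fun c' => starRingEnd ℂ (w c') * fockSplit q (fun c => F (z.1, c)) z.2 c' := by
    intro z hz
    exact (Lp.memLp w).star.integrable_mul
      (memLp_two_of_lintegral_lt_top (measurable_fockSplit_right q hF z) hz)
  rw [fieldFun, annih_eq, Pi.one_apply, Complex.ofReal_one, one_mul, contract, contract,
    ← integral_const_mul, ← integral_const_mul,
    ← integral_add ((hi _ h1).const_mul _) ((hi _ h2).const_mul _)]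
  refine integral_congr_ae (Eventually.of_forall fun c' => ?_)
  have h3 := fockSplit_annih q α F r.1 r.2 c'
  simp only [fieldFun, absorb, fockSplit] at h3 ⊢
  linear_combination (starRingEnd ℂ (w c')) * h3

theorem lintegral_fockSplit_family {d : ℕ} (q : Cutoff d)
    {K : Space d × (Space d × Conf d) → ℂ} (hK : Measurable K)
    (hs : ∀ᵐ y, FieldSymm fun z => K (y, z)) :
    ∫⁻ r : Space d × (Space d × Conf d), ∫⁻ c',
      ‖fockSplit q (fun c => K (r.1, (r.2.1, c))) r.2.2 c'‖ₑ ^ 2 = ∫⁻ r, ‖K r‖ₑ ^ 2 := by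
  have hw : Measurable fun p : (Space d × (Space d × Conf d)) × Conf d =>
      fockSplit q (fun c => K (p.1.1, (p.1.2.1, c))) p.1.2.2 p.2 := by
    have h1 : Measurable fun p : (Space d × (Space d × Conf d)) × Conf d => (p.1.2.2, p.2) :=
      (measurable_snd.comp (measurable_snd.comp measurable_fst)).prodMk measurable_snd
    have h2 : Measurable fun p : (Space d × (Space d × Conf d)) × Conf d =>
        (p.1.1, (p.1.2.1, p.1.2.2.cat p.2)) :=
      (measurable_fst.comp measurable_fst).prodMk
        ((measurable_fst.comp (measurable_snd.comp measurable_fst)).prodMk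
          ((measurable_cat d).comp h1))
    exact (Complex.measurable_ofReal.comp ((measurable_splitWeight q).comp h1)).mul (hK.comp h2)
  rw [lintegral_volume_prod (hw.enorm.pow_const 2).lintegral_prod_right',
    lintegral_volume_prod (hK.enorm.pow_const 2)]
  refine lintegral_congr_ae ?_
  filter_upwards [hs] with y hy
  exact lintegral_lintegral_fockSplit q (F := fun z => K (y, z))
    (hK.comp measurable_prodMk_left) hy

/-- After the intertwining, `a_y + v(x-y)` on the localized state becomes `q(y) a_y + v(x-y)` on `q
Ψ`; the interaction itself does not involve the cutoff at `y`. -/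
theorem tsum_fieldEnergy_kraus_le {d : ℕ} (α : ℝ) (q : Cutoff d) {v : Space d → ℝ}
    (hv : Measurable v) {ι : Type*} [Countable ι] {w : ι → Fock d}
    (hw : ∀ g, ∑' i, ‖inner ℂ (w i) g‖ₑ ^ 2 ≤ ‖g‖ₑ ^ 2) (Ψ : Hil d) :
    ∑' i, fieldEnergy α v (kraus q (w i) Ψ) ≤
      ∫⁻ r, ‖fieldFun α q.toFun v (cutoffMul q Ψ.1) r‖ₑ ^ 2 := by
  have hF := measurable_cutoffMul q (measurable_lp Ψ.1)
  have hs := fieldSymm_cutoffMul q (fieldSymm_hil Ψ)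
  have hfin : ∫⁻ z, ‖cutoffMul q Ψ.1 z‖ₑ ^ 2 < ⊤ :=
    (lintegral_cutoffMul_le q _).trans_lt (lintegral_lp_lt_top _)
  set F := cutoffMul q Ψ.1
  have hfm := measurable_fieldFun α q.measurable hv hF
  have h1 : ∀ i, fieldEnergy α v (kraus q (w i) Ψ) =
      ∫⁻ r, ‖fieldFun α 1 v (contract q (w i).1 F) r‖ₑ ^ 2 := fun i =>
    lintegral_congr_ae ((fieldFun_ae_congr α 1 v (kraus_ae_eq q (w i) Ψ)).mono
      fun r hr => by simp only [hr]; rfl)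
  simp_rw [h1]
  rw [← lintegral_tsum fun i => ((measurable_fieldFun α measurable_one hv
    (measurable_contract q (measurable_lp _) hF)).enorm.pow_const 2).aemeasurable]
  have hfy : ∀ y, Measurable fun z => fieldFun α q.toFun v F (y, z) := fun y =>
    hfm.comp measurable_prodMk_left
  refine (lintegral_mono_ae ?_).trans (lintegral_fockSplit_family q hfm ?_).le
  · filter_upwards [fieldFun_contract α q v hF hs hfin] with r hr
    rw [tsum_congr fun i => by rw [hr]]
    exact tsum_enorm_integral_sq_le hw
      (measurable_fockSplit_right q (F := fun z => fieldFun α q.toFun v F (r.1, z)) (hfy r.1) r.2)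
  · filter_upwards [fieldSymm_annih α hs] with y hy
    filter_upwards [hy, hs] with z h2 h3 σ
    simp only [fieldFun, h2 σ, h3 σ]

/-! ### Completing the square in the energy -/

theorem lintegral_enorm_add_sq {α : Type*} [MeasurableSpace α] {μ : Measure α} {A B : α → ℂ}
    (hA : MemLp A 2 μ) (hB : MemLp B 2 μ) :
    ∫⁻ x, ‖A x + B x‖ₑ ^ 2 ∂μ = ENNReal.ofReal ((∫⁻ x, ‖A x‖ₑ ^ 2 ∂μ).toReal +
      2 * (∫ x, starRingEnd ℂ (B x) * A x ∂μ).re + (∫⁻ x, ‖B x‖ₑ ^ 2 ∂μ).toReal) := by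
  have h1 : (∫ x, starRingEnd ℂ (B x) * A x ∂μ) = inner ℂ hB.toLp hA.toLp := by
    rw [inner_toLp]
    refine integral_congr_ae ?_
    filter_upwards [hB.coeFn_toLp] with x hx
    rw [hx]
  have h2 : ∫⁻ x, ‖A x + B x‖ₑ ^ 2 ∂μ = ‖hA.toLp + hB.toLp‖ₑ ^ 2 := by
    rw [← MemLp.toLp_add, enorm_toLp_sq]
    rfl
  rw [h1, h2, enorm_sq_eq_ofReal, ← enorm_toLp_sq hA, ← enorm_toLp_sq hB, @norm_add_sq ℂ,
    ENNReal.toReal_pow, ENNReal.toReal_pow, toReal_enorm, toReal_enorm, inner_re_symm]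
  rfl

/-- For fixed `x` the integral over `y` of `g(x - y)` does not depend on `x`, by invariance under
translation and reflection. -/
theorem lintegral_translate_mul {d : ℕ} {g : Space d → ℝ≥0∞} (hg : Measurable g)
    {f : Space d × Conf d → ℝ≥0∞} (hf : Measurable f) :
    ∫⁻ r : Space d × (Space d × Conf d), g (r.2.1 - r.1) * f r.2 = (∫⁻ y, g y) * ∫⁻ z, f z := by
  have hm : Measurable fun r : Space d × (Space d × Conf d) => g (r.2.1 - r.1) * f r.2 :=
    (hg.comp ((measurable_fst.comp measurable_snd).sub measurable_fst)).mul
      (hf.comp measurable_snd)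
  rw [Measure.volume_eq_prod, lintegral_prod_symm _ hm.aemeasurable, ← lintegral_const_mul _ hf]
  refine lintegral_congr fun z => ?_
  have hgz : Measurable fun y => g (z.1 - y) := hg.comp (measurable_const.sub measurable_id)
  refine (lintegral_mul_const (f z) hgz).trans ?_
  congr 1
  exact lintegral_sub_left_eq_self (μ := (volume : Measure (Space d))) g z.1

theorem lintegral_translate_mul_sq {d : ℕ} {v : Space d → ℝ} (hv : Measurable v)
    {F : Space d × Conf d → ℂ} (hF : Measurable F) :
    ∫⁻ r : Space d × (Space d × Conf d), ‖(v (r.2.1 - r.1) : ℂ) * F r.2‖ₑ ^ 2 =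
      (∫⁻ y, ‖v y‖ₑ ^ 2) * ∫⁻ z, ‖F z‖ₑ ^ 2 := by
  rw [← lintegral_translate_mul (hv.enorm.pow_const 2) (hF.enorm.pow_const 2)]
  refine lintegral_congr fun r => ?_
  rw [enorm_mul, mul_pow]
  congr 2
  rw [← ofReal_norm, ← ofReal_norm, Complex.norm_real]

theorem number_eq {d : ℕ} (α : ℝ) (Φ : Hil d) :
    number α Φ = ∫⁻ r : Space d × (Space d × Conf d), ‖annih α Φ.1 r.1 r.2‖ₑ ^ 2 :=
  (lintegral_volume_prod ((measurable_annih α (measurable_lp Φ.1)).enorm.pow_const 2)).symm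

theorem lintegral_enorm_sq_lt_top {d : ℕ} {v : Space d → ℝ} (hv : MemLp v 2 volume) :
    ∫⁻ y, ‖v y‖ₑ ^ 2 < ⊤ := by
  rw [← eLpNorm_two_sq]
  exact ENNReal.pow_lt_top hv.2

theorem measurable_translate_mul {d : ℕ} {v : Space d → ℝ} (hv : Measurable v)
    {F : Space d × Conf d → ℂ} (hF : Measurable F) :
    Measurable fun r : Space d × (Space d × Conf d) => (v (r.2.1 - r.1) : ℂ) * F r.2 :=
  (Complex.measurable_ofReal.comp (hv.comp ((measurable_fst.comp measurable_snd).sub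
    measurable_fst))).mul (hF.comp measurable_snd)

theorem memLp_translate_mul {d : ℕ} {v : Space d → ℝ} (hv : Measurable v)
    (hv2 : MemLp v 2 volume) (Φ : Hil d) :
    MemLp (fun r : Space d × (Space d × Conf d) => (v (r.2.1 - r.1) : ℂ) * Φ.1 r.2) 2 volume := by
  refine memLp_two_of_lintegral_lt_top (measurable_translate_mul hv (measurable_lp _)) ?_
  rw [lintegral_translate_mul_sq hv (measurable_lp Φ.1)]
  exact ENNReal.mul_lt_top (lintegral_enorm_sq_lt_top hv2) (lintegral_lp_lt_top _)

theorem norm_hil_sq {d : ℕ} (Φ : Hil d) : (∫⁻ z, ‖Φ.1 z‖ₑ ^ 2).toReal = ‖Φ‖ ^ 2 := by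
  rw [← enorm_hil_sq, ENNReal.toReal_pow, toReal_enorm]

/-- Completing the square in the field energy. -/
theorem fieldEnergy_eq {d : ℕ} (α : ℝ) {v : Space d → ℝ} (hv : Measurable v)
    (hv2 : MemLp v 2 volume) (Φ : Hil d) (hN : number α Φ < ⊤) :
    fieldEnergy α v Φ = ENNReal.ofReal ((number α Φ).toReal + interaction α v Φ +
      (∫⁻ y, ‖v y‖ₑ ^ 2).toReal * ‖Φ‖ ^ 2) := by
  rw [number_eq] at hN
  have hA := memLp_two_of_lintegral_lt_top (measurable_annih α (measurable_lp Φ.1)) hN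
  have h := lintegral_enorm_add_sq hA (memLp_translate_mul hv hv2 Φ)
  rw [lintegral_translate_mul_sq hv (measurable_lp Φ.1), ENNReal.toReal_mul, norm_hil_sq,
    ← number_eq] at h
  have h1 : fieldEnergy α v Φ = ∫⁻ r : Space d × (Space d × Conf d),
      ‖annih α Φ.1 r.1 r.2 + (v (r.2.1 - r.1) : ℂ) * Φ.1 r.2‖ₑ ^ 2 := by
    simp [fieldEnergy, fieldFun]
  rw [h1, h, interaction]
  congr 6
  ext r
  rw [map_mul, Complex.conj_ofReal, mul_assoc]

/-- The annihilation term is the field term minus `v(x-y) Ψ`, and the latter is square integrable.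
Thus an infinite number forces an infinite field energy, whatever value `interaction` then takes. -/
theorem number_lt_top_of_fieldEnergy {d : ℕ} (α : ℝ) {v : Space d → ℝ} (hv : Measurable v)
    (hv2 : MemLp v 2 volume) (Φ : Hil d) (h : fieldEnergy α v Φ < ⊤) : number α Φ < ⊤ := by
  have h1 := memLp_two_of_lintegral_lt_top
    (measurable_fieldFun α measurable_one hv (measurable_lp Φ.1)) h
  have h2 := h1.sub (memLp_translate_mul hv hv2 Φ)
  rw [number_eq, ← eLpNorm_two_sq]
  refine ENNReal.pow_lt_top (lt_of_eq_of_lt ?_ h2.2)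
  congr 1
  ext r
  simp [fieldFun]

/-- `⟨Φ, (V + m) Φ⟩`. -/
def shiftedPotential {d : ℕ} (V : Space d → ℝ) (m : ℝ) (Φ : Hil d) : ℝ≥0∞ :=
  ∫⁻ z : Space d × Conf d, ENNReal.ofReal (V z.1 + m) * ‖Φ.1 z‖ₑ ^ 2

theorem integrable_norm_sq {d : ℕ} (Φ : Hil d) :
    Integrable fun z : Space d × Conf d => ‖Φ.1 z‖ ^ 2 :=
  (memLp_two_iff_integrable_sq_norm (Lp.memLp Φ.1).1).1 (Lp.memLp Φ.1)

theorem shiftedPotential_eq {d : ℕ} {V : Space d → ℝ} (hV : Measurable V) {m : ℝ}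
    (hm : ∀ x, |V x| ≤ m) (Φ : Hil d) :
    shiftedPotential V m Φ = ENNReal.ofReal (potential V Φ + m * ‖Φ‖ ^ 2) := by
  have h0 : ∀ x, 0 ≤ V x + m := fun x => by linarith [(abs_le.1 (hm x)).1]
  have hi := integrable_norm_sq Φ
  have hVi : Integrable fun z : Space d × Conf d => V z.1 * ‖Φ.1 z‖ ^ 2 :=
    hi.bdd_mul (hV.comp measurable_fst).aestronglyMeasurable
      (Eventually.of_forall fun z => hm z.1)
  have h1 : ‖Φ‖ ^ 2 = ∫ z, ‖Φ.1 z‖ ^ 2 := by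
    rw [← norm_hil_sq, integral_eq_lintegral_of_nonneg_ae
      (Eventually.of_forall fun z => by positivity) hi.1]
    simp_rw [enorm_sq_eq_ofReal]
  have h2 : potential V Φ + m * ‖Φ‖ ^ 2 =
      ∫ z : Space d × Conf d, (V z.1 + m) * ‖Φ.1 z‖ ^ 2 := by
    rw [h1, potential, ← integral_const_mul, ← integral_add hVi (hi.const_mul m)]
    simp only [add_mul]
  have h3 : Integrable fun z : Space d × Conf d => (V z.1 + m) * ‖Φ.1 z‖ ^ 2 := by
    simp only [add_mul]
    exact hVi.add (hi.const_mul m)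
  rw [h2, ofReal_integral_eq_lintegral_ofReal h3
    (Eventually.of_forall fun z => mul_nonneg (h0 _) (by positivity)), shiftedPotential]
  refine lintegral_congr fun z => ?_
  rw [ENNReal.ofReal_mul (h0 _), enorm_sq_eq_ofReal]

/-- The quadratic form of `H + ‖v‖² + m`, written as a sum of squares. -/
def totalEnergy {d : ℕ} (α : ℝ) (V v : Space d → ℝ) (m : ℝ) (Φ : Hil d) : ℝ≥0∞ :=
  kinetic Φ + fieldEnergy α v Φ + shiftedPotential V m Φ

/-- The constant `‖v‖² + m`. -/
def energyShift {d : ℕ} (v : Space d → ℝ) (m : ℝ) : ℝ := (∫⁻ y, ‖v y‖ₑ ^ 2).toReal + m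

/-- Each term of `totalEnergy` is a square, to which Bessel's inequality applies, and the rest is a
multiple of `‖Φ‖²`, whose sum over the Kraus vectors is known exactly. -/
theorem energy_eq {d : ℕ} (α : ℝ) {V v : Space d → ℝ} (hv : Measurable v)
    (hv2 : MemLp v 2 volume) (hV : Measurable V) {m : ℝ} (hm : ∀ x, |V x| ≤ m) (Φ : Hil d) :
    energy α V v Φ = (totalEnergy α V v m Φ : EReal) +
      ((-(energyShift v m * ‖Φ‖ ^ 2) : ℝ) : EReal) := by
  by_cases hN : number α Φ = ⊤
  · have hf : fieldEnergy α v Φ = ⊤ := by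
      by_contra h
      exact (number_lt_top_of_fieldEnergy α hv hv2 Φ (lt_top_iff_ne_top.2 h)).ne hN
    rw [energy, totalEnergy, hN, hf, EReal.coe_ennreal_top,
      EReal.add_top_of_ne_bot (EReal.coe_ennreal_ne_bot _), EReal.top_add_coe, add_top, top_add,
      EReal.coe_ennreal_top, EReal.top_add_coe]
  · have hf := fieldEnergy_eq α hv hv2 Φ (lt_top_iff_ne_top.2 hN)
    have hp := shiftedPotential_eq hV hm Φ
    have hf0 : fieldEnergy α v Φ ≠ ⊤ := by rw [hf]; exact ENNReal.ofReal_ne_top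
    have hp0 : shiftedPotential V m Φ ≠ ⊤ := by rw [hp]; exact ENNReal.ofReal_ne_top
    -- This bound and `hfr` ensure that the `ENNReal.ofReal` in the formulas for the two squares
    -- truncates nothing. The kinetic term may be infinite and is carried along unchanged.
    have h0 : 0 ≤ potential V Φ + m * ‖Φ‖ ^ 2 := by
      rw [potential]
      have hi := integrable_norm_sq Φ
      have h1 : ‖Φ‖ ^ 2 = ∫ z, ‖Φ.1 z‖ ^ 2 := by
        rw [← norm_hil_sq, integral_eq_lintegral_of_nonneg_ae
          (Eventually.of_forall fun z => by positivity) hi.1]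
        simp_rw [enorm_sq_eq_ofReal]
      have hVi : Integrable fun z : Space d × Conf d => V z.1 * ‖Φ.1 z‖ ^ 2 :=
        hi.bdd_mul (hV.comp measurable_fst).aestronglyMeasurable
          (Eventually.of_forall fun z => hm z.1)
      rw [h1, ← integral_const_mul, ← integral_add hVi (hi.const_mul m)]
      refine integral_nonneg fun z => ?_
      have := (abs_le.1 (hm z.1)).1
      simp only [Pi.zero_apply]
      nlinarith [sq_nonneg ‖Φ.1 z‖]
    have hfr : 0 ≤ (number α Φ).toReal + interaction α v Φ +
        (∫⁻ y, ‖v y‖ₑ ^ 2).toReal * ‖Φ‖ ^ 2 := by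
      rw [number_eq] at hN ⊢
      have hA := memLp_two_of_lintegral_lt_top (measurable_annih α (measurable_lp Φ.1))
        (lt_top_iff_ne_top.2 hN)
      have hB := memLp_translate_mul hv hv2 Φ
      have h1 := @norm_add_sq ℂ _ _ _ _ hA.toLp hB.toLp
      have h2 : interaction α v Φ = 2 * RCLike.re (inner ℂ hA.toLp hB.toLp) := by
        rw [← inner_conj_symm, inner_toLp, interaction]
        simp only [RCLike.re_eq_complex_re, Complex.conj_re]
        congr 2
        refine integral_congr_ae ?_
        filter_upwards [hB.coeFn_toLp] with r hr
        rw [hr, map_mul, Complex.conj_ofReal, mul_assoc]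
      have h3 : (∫⁻ y, ‖v y‖ₑ ^ 2).toReal * ‖Φ‖ ^ 2 = ‖hB.toLp‖ ^ 2 := by
        rw [← norm_hil_sq, ← ENNReal.toReal_mul, ← lintegral_translate_mul_sq hv (measurable_lp _),
          ← enorm_toLp_sq hB, ENNReal.toReal_pow, toReal_enorm]
      rw [h2, h3, ← enorm_toLp_sq hA, ENNReal.toReal_pow, toReal_enorm, ← h1]
      positivity
    rw [energy, totalEnergy, EReal.coe_ennreal_add, EReal.coe_ennreal_add, add_assoc, add_assoc,
      add_assoc]
    congr 1
    rw [← EReal.coe_toReal (EReal.coe_ennreal_eq_top_iff.not.2 hN) (EReal.coe_ennreal_ne_bot _),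
      hf, hp, EReal.coe_ennreal_ofReal, EReal.coe_ennreal_ofReal, max_eq_left hfr, max_eq_left h0,
      EReal.toReal_coe_ennreal, ← EReal.coe_add, ← EReal.coe_add, ← EReal.coe_add, energyShift]
    congr 1
    ring

/-! ### Homogeneity and traces of pure and localized states -/

theorem isWeakGradient_zero {d : ℕ} {F : Space d × Conf d → ℂ} (h : F =ᵐ[volume] 0) :
    IsWeakGradient F 0 := by
  intro j φ _ _
  have h0 : ((0 : Fin d → Lp ℂ 2 (volume : Measure (Space d × Conf d))) j :
      Space d × Conf d → ℂ) =ᵐ[volume] 0 := Lp.coeFn_zero _ _ _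
  filter_upwards [ae_ae_swap h, ae_ae_swap h0] with c h1 h2
  rw [integral_eq_zero_of_ae, integral_eq_zero_of_ae, neg_zero]
  · filter_upwards [h2] with x hx
    rw [hx]; simp
  · filter_upwards [h1] with x hx
    rw [hx]; simp

theorem isWeakGradient_smul {d : ℕ} (a : ℂ) {F K : Space d × Conf d → ℂ}
    (hK : K =ᵐ[volume] a • F) {G : Fin d → Lp ℂ 2 (volume : Measure (Space d × Conf d))}
    (h : IsWeakGradient F G) : IsWeakGradient K fun j => a • G j := by
  intro j φ hφ hc
  filter_upwards [ae_ae_swap hK, ae_ae_swap (Lp.coeFn_smul a (G j)), h j φ hφ hc] with c h1 h2 h3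
  have e1 : ∫ x, (fderiv ℝ φ x (EuclideanSpace.single j 1) : ℂ) * K (x, c) =
      ∫ x, a * ((fderiv ℝ φ x (EuclideanSpace.single j 1) : ℂ) * F (x, c)) := by
    refine integral_congr_ae ?_
    filter_upwards [h1] with x hx
    rw [hx, Pi.smul_apply, smul_eq_mul]
    ring
  have e2 : ∫ x, (φ x : ℂ) * (a • G j : Lp ℂ 2 _) (x, c) =
      ∫ x, a * ((φ x : ℂ) * G j (x, c)) := by
    refine integral_congr_ae ?_
    filter_upwards [h2] with x hx
    rw [hx, Pi.smul_apply, smul_eq_mul]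
    ring
  rw [e1, e2, integral_const_mul, integral_const_mul, h3]
  ring

theorem coe_smul_ae {d : ℕ} (a : ℂ) (Φ : Hil d) : (a • Φ).1 =ᵐ[volume] a • (Φ.1 : _ → ℂ) :=
  Lp.coeFn_smul a Φ.1

/-- Scaling a gradient of `Φ` gives a gradient of `a • Φ`; equality follows by applying the bound to
`a⁻¹` as well. -/
theorem kinetic_smul_le {d : ℕ} {a : ℂ} (ha : a ≠ 0) (Φ : Hil d) :
    kinetic (a • Φ) ≤ ‖a‖ₑ ^ 2 * kinetic Φ := by
  rw [kinetic, kinetic, ENNReal.mul_iInf_of_ne (pow_ne_zero 2 (enorm_ne_zero.2 ha))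
    (ENNReal.pow_ne_top enorm_ne_top)]
  refine le_iInf fun G => ?_
  rw [ENNReal.mul_iInf_of_ne (pow_ne_zero 2 (enorm_ne_zero.2 ha))
    (ENNReal.pow_ne_top enorm_ne_top)]
  refine le_iInf fun hG => ?_
  refine (iInf₂_le (fun j => a • G j) (isWeakGradient_smul a (coe_smul_ae a Φ) hG)).trans ?_
  simp_rw [enorm_smul, mul_pow, Finset.mul_sum]
  exact le_rfl

theorem kinetic_smul {d : ℕ} (a : ℂ) (Φ : Hil d) :
    kinetic (a • Φ) = ‖a‖ₑ ^ 2 * kinetic Φ := by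
  -- For `a = 0` the right side is `0` even if `kinetic Φ = ⊤`, and the zero function has gradient
  -- zero.
  by_cases ha : a = 0
  · subst ha
    have h : ((0 : ℂ) • Φ).1 =ᵐ[volume] (0 : Space d × Conf d → ℂ) := by
      filter_upwards [coe_smul_ae 0 Φ] with z hz
      rw [hz]; simp
    have h1 : kinetic ((0 : ℂ) • Φ) ≤ 0 := by
      refine (iInf₂_le 0 (isWeakGradient_zero h)).trans ?_
      simp
    rw [nonpos_iff_eq_zero.1 h1]
    simp
  · refine le_antisymm (kinetic_smul_le ha Φ) ?_
    have h := kinetic_smul_le (inv_ne_zero ha) (a • Φ)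
    rw [smul_smul, inv_mul_cancel₀ ha, one_smul] at h
    calc ‖a‖ₑ ^ 2 * kinetic Φ ≤ ‖a‖ₑ ^ 2 * (‖a⁻¹‖ₑ ^ 2 * kinetic (a • Φ)) := by gcongr
      _ = kinetic (a • Φ) := by
        rw [← mul_assoc, ← mul_pow, ← enorm_mul, mul_inv_cancel₀ ha]
        simp

theorem fieldEnergy_smul {d : ℕ} (α : ℝ) (v : Space d → ℝ) (a : ℂ) (Φ : Hil d) :
    fieldEnergy α v (a • Φ) = ‖a‖ₑ ^ 2 * fieldEnergy α v Φ := by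
  rw [fieldEnergy, fieldEnergy, ← lintegral_const_mul' _ _ (ENNReal.pow_ne_top enorm_ne_top)]
  refine lintegral_congr_ae ?_
  filter_upwards [fieldFun_ae_congr α 1 v (coe_smul_ae a Φ)] with r hr
  rw [hr, ← mul_pow, ← enorm_mul]
  congr 2
  simp only [fieldFun, annih, Pi.smul_apply, smul_eq_mul]
  ring

theorem shiftedPotential_smul {d : ℕ} (V : Space d → ℝ) (m : ℝ) (a : ℂ) (Φ : Hil d) :
    shiftedPotential V m (a • Φ) = ‖a‖ₑ ^ 2 * shiftedPotential V m Φ := by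
  rw [shiftedPotential, shiftedPotential,
    ← lintegral_const_mul' _ _ (ENNReal.pow_ne_top enorm_ne_top)]
  refine lintegral_congr_ae ?_
  filter_upwards [coe_smul_ae a Φ] with z hz
  rw [hz, Pi.smul_apply, smul_eq_mul, enorm_mul]
  ring

theorem totalEnergy_smul {d : ℕ} (α : ℝ) (V v : Space d → ℝ) (m : ℝ) (a : ℂ) (Φ : Hil d) :
    totalEnergy α V v m (a • Φ) = ‖a‖ₑ ^ 2 * totalEnergy α V v m Φ := by
  rw [totalEnergy, totalEnergy, kinetic_smul, fieldEnergy_smul, shiftedPotential_smul]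
  ring

theorem tsum_eq_of_eq_sub {ι H : Type*} [NormedAddCommGroup H] {h : H → EReal} {N : H → ℝ≥0∞}
    {s : ℝ} (hh : ∀ Φ, h Φ = (N Φ : EReal) + ((-(s * ‖Φ‖ ^ 2) : ℝ) : EReal))
    (φ : ι → H) {t : ℝ≥0∞} (ht : ∑' i, ‖φ i‖ₑ ^ 2 = t) (hfin : t ≠ ⊤) :
    ∑' i, h (φ i) = ((∑' i, N (φ i) : ℝ≥0∞) : EReal) + ((-(s * t.toReal) : ℝ) : EReal) := by
  have h1 : ∀ i, (‖φ i‖ₑ ^ 2).toReal = ‖φ i‖ ^ 2 := fun i => by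
    rw [ENNReal.toReal_pow, toReal_enorm]
  have h2 : Summable fun i => ‖φ i‖ ^ 2 := by
    rw [← ht] at hfin
    exact (ENNReal.summable_toReal hfin).congr h1
  have h3 : ∑' i, ‖φ i‖ ^ 2 = t.toReal := by
    rw [← ht, ENNReal.tsum_toReal_eq fun i => ENNReal.pow_ne_top enorm_ne_top]
    exact tsum_congr fun i => (h1 i).symm
  rw [tsum_congr fun i => hh (φ i), ereal_tsum_sub _ (h2.mul_left s), tsum_mul_left, h3]

theorem tsum_enorm_inner_basis_sq {ι H : Type*} [NormedAddCommGroup H] [InnerProductSpace ℂ H]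
    (b : HilbertBasis ι ℂ H) {Ψ : H} (hΨ : ‖Ψ‖ = 1) : ∑' i, ‖inner ℂ Ψ (b i)‖ₑ ^ 2 = 1 := by
  have h := tsum_enorm_inner_sq b Ψ
  rw [show ‖Ψ‖ₑ = 1 by rw [← ofReal_norm, hΨ]; simp, one_pow] at h
  rw [← h]
  refine tsum_congr fun i => ?_
  rw [← inner_conj_symm, RCLike.enorm_conj]

theorem tsum_enorm_inner_smul_sq {ι H : Type*} [NormedAddCommGroup H] [InnerProductSpace ℂ H]
    (b : HilbertBasis ι ℂ H) {Ψ : H} (hΨ : ‖Ψ‖ = 1) : ∑' i, ‖inner ℂ Ψ (b i) • Ψ‖ₑ ^ 2 = 1 := by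
  rw [← tsum_enorm_inner_basis_sq b hΨ]
  refine tsum_congr fun i => ?_
  rw [enorm_smul, show ‖Ψ‖ₑ = 1 by rw [← ofReal_norm, hΨ]; simp, mul_one]

theorem traceForm_rankOne_eq_of_eq_sub {H : Type} [NormedAddCommGroup H] [InnerProductSpace ℂ H]
    [CompleteSpace H] {h : H → EReal} {N : H → ℝ≥0∞} {s : ℝ}
    (hh : ∀ Φ, h Φ = (N Φ : EReal) + ((-(s * ‖Φ‖ ^ 2) : ℝ) : EReal))
    (hN : ∀ (a : ℂ) Φ, N (a • Φ) = ‖a‖ₑ ^ 2 * N Φ) {Ψ : H} (hΨ : ‖Ψ‖ = 1) :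
    traceForm h (InnerProductSpace.rankOne ℂ Ψ Ψ) = (N Ψ : EReal) + ((-s : ℝ) : EReal) := by
  rw [traceForm_rankOne h hΨ, tsum_eq_of_eq_sub hh _
    (tsum_enorm_inner_smul_sq (stdBasis H) hΨ) ENNReal.one_ne_top,
    tsum_congr fun i => hN (inner ℂ Ψ (stdBasis H i)) Ψ, ENNReal.tsum_mul_right,
    tsum_enorm_inner_basis_sq _ hΨ, one_mul, ENNReal.toReal_one, mul_one]

theorem traceForm_energy_pureState {d : ℕ} (α : ℝ) {V v : Space d → ℝ} (hv : Measurable v)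
    (hv2 : MemLp v 2 volume) (hV : Measurable V) {m : ℝ} (hm : ∀ x, |V x| ≤ m) {Ψ : Hil d}
    (hΨ : ‖Ψ‖ = 1) :
    traceForm (energy α V v) (pureState Ψ) =
      (totalEnergy α V v m Ψ : EReal) + ((-energyShift v m : ℝ) : EReal) :=
  traceForm_rankOne_eq_of_eq_sub (energy_eq α hv hv2 hV hm) (totalEnergy_smul α V v m) hΨ

/-- Multiplication by `√(V + m)` in the particle variable commutes with the contraction, so this
term is also the square of a contracted symmetric function. -/
theorem tsum_shiftedPotential_kraus_le {d : ℕ} {V : Space d → ℝ} (hV : Measurable V) {m : ℝ}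
    (hm : ∀ x, |V x| ≤ m) (q : Cutoff d) {ι : Type*} [Countable ι] {w : ι → Fock d}
    (hw : ∀ g, ∑' i, ‖inner ℂ (w i) g‖ₑ ^ 2 ≤ ‖g‖ₑ ^ 2) (Ψ : Hil d) :
    ∑' i, shiftedPotential V m (kraus q (w i) Ψ) ≤
      ∫⁻ z : Space d × Conf d, ENNReal.ofReal (V z.1 + m) * ‖cutoffMul q Ψ.1 z‖ₑ ^ 2 := by
  have hF := measurable_cutoffMul q (measurable_lp Ψ.1)
  have hs := fieldSymm_cutoffMul q (fieldSymm_hil Ψ)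
  have h0 : ∀ x, 0 ≤ V x + m := fun x => by linarith [(abs_le.1 (hm x)).1]
  have he : ∀ (x : Space d) (u : ℂ),
      ENNReal.ofReal (V x + m) * ‖u‖ₑ ^ 2 = ‖((√(V x + m) : ℝ) : ℂ) * u‖ₑ ^ 2 := by
    intro x u
    rw [enorm_mul, mul_pow, enorm_sq_eq_ofReal ((√(V x + m) : ℝ) : ℂ), Complex.norm_real,
      Real.norm_eq_abs, sq_abs, Real.sq_sqrt (h0 x)]
  have hVm : Measurable fun z : Space d × Conf d =>
      ((√(V z.1 + m) : ℝ) : ℂ) * cutoffMul q Ψ.1 z :=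
    (Complex.measurable_ofReal.comp ((hV.comp measurable_fst).add_const m).sqrt).mul hF
  have hVsy : FieldSymm fun z : Space d × Conf d =>
      ((√(V z.1 + m) : ℝ) : ℂ) * cutoffMul q Ψ.1 z := by
    filter_upwards [hs] with z hz σ
    simp only [hz σ]
  have h4 := tsum_lintegral_contract_le q hw hVm hVsy
  have h5 : ∀ i, shiftedPotential V m (kraus q (w i) Ψ) = ∫⁻ z, ‖contract q (w i).1
      (fun z : Space d × Conf d => ((√(V z.1 + m) : ℝ) : ℂ) * cutoffMul q Ψ.1 z) z‖ₑ ^ 2 := by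
    intro i
    refine lintegral_congr_ae ?_
    filter_upwards [kraus_ae_eq q (w i) Ψ] with z hz
    rw [hz, he, contract, contract, ← integral_const_mul]
    congr 3
    ext c'
    simp only [fockSplit]
    ring
  rw [tsum_congr h5]
  refine h4.trans (le_of_eq ?_)
  exact lintegral_congr fun z => (he _ _).symm

/-- `T` is fixed before the gradient `G`, so that the bounds for both cutoffs can be added for one
common `G` before taking the infimum over `G`. -/
theorem traceForm_energy_localize_le {d : ℕ} (α : ℝ) {V v : Space d → ℝ} (hv : Measurable v)
    (hv2 : MemLp v 2 volume) (hV : Measurable V) {m : ℝ} (hm : ∀ x, |V x| ≤ m) (q : Cutoff d)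
    (hq : ContDiff ℝ ∞ q.toFun) {B : ℝ} (hB : ∀ x, ‖fderiv ℝ q.toFun x‖ ≤ B) (Ψ : Hil d) :
    ∃ T : ℝ≥0∞, traceForm (energy α V v) (localize q (pureState Ψ)) = (T : EReal) +
        ((-(energyShift v m * (∫⁻ z, ‖cutoffMul q Ψ.1 z‖ₑ ^ 2).toReal) : ℝ) : EReal) ∧
      ∀ G : Fin d → Lp ℂ 2 (volume : Measure (Space d × Conf d)), IsWeakGradient Ψ.1 G →
        (∀ j, FieldSymm (G j : Space d × Conf d → ℂ)) →
        T ≤ (∑ j, ∫⁻ z, ‖cutoffGradient q Ψ.1 (fun j => G j) j z‖ₑ ^ 2) +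
          (∫⁻ r, ‖fieldFun α q.toFun v (cutoffMul q Ψ.1) r‖ₑ ^ 2) +
          ∫⁻ z : Space d × Conf d, ENNReal.ofReal (V z.1 + m) * ‖cutoffMul q Ψ.1 z‖ₑ ^ 2 := by
  obtain ⟨w, h1, h2, h3⟩ := exists_traceForm_localize_eq q Ψ
  refine ⟨∑' i, totalEnergy α V v m (kraus q (w i) Ψ), ?_, fun G hG hGs => ?_⟩
  · rw [h1]
    exact tsum_eq_of_eq_sub (energy_eq α hv hv2 hV hm) _ h3
      ((lintegral_cutoffMul_le q _).trans_lt (lintegral_lp_lt_top _)).ne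
  · simp only [totalEnergy]
    rw [ENNReal.tsum_add, ENNReal.tsum_add]
    exact add_le_add (add_le_add (tsum_kinetic_kraus_le q hq hB h2 Ψ hG hGs)
      (tsum_fieldEnergy_kraus_le α q hv h2 Ψ)) (tsum_shiftedPotential_kraus_le hV hm q h2 Ψ)

/-! ### Geometry of the cutoffs and of the interaction defect -/

namespace SmoothPartition

variable {d : ℕ} (P : SmoothPartition d)

theorem contDiff_inside (R : ℝ) : ContDiff ℝ ∞ (P.inside R).toFun :=
  P.χ_smooth.comp (contDiff_const_smul _)

theorem contDiff_outside (R : ℝ) : ContDiff ℝ ∞ (P.outside R).toFun :=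
  P.η_smooth.comp (contDiff_const_smul _)

/-- Both `χ` and `η - 1` are smooth and vanish outside the ball of radius `2`. -/
theorem exists_norm_fderiv_le : ∃ B : ℝ, 0 ≤ B ∧ (∀ x, ‖fderiv ℝ P.χ x‖ ≤ B) ∧
    ∀ x, ‖fderiv ℝ P.η x‖ ≤ B := by
  have hη : ∀ x, 2 ≤ ‖x‖ → P.η x = 1 := fun x hx => by
    have h := P.sq_add_sq x
    rw [P.χ_eq_zero x hx] at h
    nlinarith [P.η_nonneg x]
  have h1 : HasCompactSupport P.χ := HasCompactSupport.of_support_subset_isCompact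
    (isCompact_closedBall (0 : Space d) 2) fun x hx => by
      by_contra h
      rw [mem_closedBall_zero_iff, not_le] at h
      exact hx (P.χ_eq_zero x h.le)
  have h2 : HasCompactSupport fun x => P.η x - 1 := HasCompactSupport.of_support_subset_isCompact
    (isCompact_closedBall (0 : Space d) 2) fun x hx => by
      by_contra h
      rw [mem_closedBall_zero_iff, not_le] at h
      exact hx (by simp [hη x h.le])
  obtain ⟨B₁, hB₁⟩ := (h1.fderiv ℝ).exists_bound_of_continuous
    (P.χ_smooth.continuous_fderiv (by simp))
  obtain ⟨B₂, hB₂⟩ := (h2.fderiv ℝ).exists_bound_of_continuous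
    ((P.η_smooth.sub contDiff_const).continuous_fderiv (by simp))
  refine ⟨max B₁ B₂, ?_, fun x => (hB₁ x).trans (le_max_left _ _), fun x => ?_⟩
  · exact ((norm_nonneg _).trans (hB₁ 0)).trans (le_max_left _ _)
  · have h3 := hB₂ x
    rw [fderiv_sub_const] at h3
    exact h3.trans (le_max_right _ _)

theorem norm_fderiv_scale_le {f : Space d → ℝ} (hf : ContDiff ℝ ∞ f) {B : ℝ}
    (hB : ∀ x, ‖fderiv ℝ f x‖ ≤ B) {R : ℝ} (hR : 0 < R) (x : Space d) :
    ‖fderiv ℝ (fun x => f (R⁻¹ • x)) x‖ ≤ B / R := by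
  have h1 : HasFDerivAt (fun x : Space d => R⁻¹ • x) (R⁻¹ • ContinuousLinearMap.id ℝ (Space d)) x :=
    (hasFDerivAt_id x).const_smul R⁻¹
  have h2 := ((hf.differentiable (by simp) (R⁻¹ • x)).hasFDerivAt.comp x h1).fderiv
  have h3 : fderiv ℝ (fun x => f (R⁻¹ • x)) x = R⁻¹ • fderiv ℝ f (R⁻¹ • x) := by
    refine h2.trans ?_
    ext u
    simp
  rw [h3, norm_smul, norm_inv, Real.norm_of_nonneg hR.le, div_eq_inv_mul]
  exact mul_le_mul_of_nonneg_left (hB _) (inv_nonneg.2 hR.le)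

theorem sq_inside_add_sq_outside (R : ℝ) (x : Space d) :
    (P.inside R).toFun x ^ 2 + (P.outside R).toFun x ^ 2 = 1 :=
  P.sq_add_sq _

/-- The derivative of `χ² + η² = 1`; it cancels the cross terms in the kinetic energy. -/
theorem fderiv_inside_add_outside (R : ℝ) (x e : Space d) :
    (P.inside R).toFun x * fderiv ℝ (P.inside R).toFun x e +
      (P.outside R).toFun x * fderiv ℝ (P.outside R).toFun x e = 0 := by
  have h1 := ((P.contDiff_inside R).differentiable (by simp) x).hasFDerivAt
  have h2 := ((P.contDiff_outside R).differentiable (by simp) x).hasFDerivAt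
  have h3 := (h1.pow 2).add (h2.pow 2)
  have h4 : ((fun x => (P.inside R).toFun x ^ 2) + fun x => (P.outside R).toFun x ^ 2) =
      fun _ => (1 : ℝ) :=
    funext fun x => P.sq_inside_add_sq_outside R x
  rw [h4] at h3
  have h5 := congrArg (fun L => L e) (h3.unique (hasFDerivAt_const (1 : ℝ) x))
  simp at h5
  linarith

/-- The defect of the cutoffs in the interaction term. -/
def defect (R : ℝ) (x y : Space d) : ℝ :=
  1 - (P.inside R).toFun x ^ 2 * (P.inside R).toFun y -
    (P.outside R).toFun x ^ 2 * (P.outside R).toFun y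

theorem measurable_defect (R : ℝ) :
    Measurable fun r : Space d × Space d => P.defect R r.1 r.2 :=
  (measurable_const.sub ((((P.inside R).measurable.comp measurable_fst).pow_const 2).mul
    ((P.inside R).measurable.comp measurable_snd))).sub
    ((((P.outside R).measurable.comp measurable_fst).pow_const 2).mul
    ((P.outside R).measurable.comp measurable_snd))

theorem defect_nonneg (R : ℝ) (x y : Space d) : 0 ≤ P.defect R x y := by
  have h := P.sq_inside_add_sq_outside R x
  have h1 := (P.inside R).le_one y
  have h2 := (P.outside R).le_one y
  rw [defect]
  nlinarith [sq_nonneg ((P.inside R).toFun x), sq_nonneg ((P.outside R).toFun x)]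

theorem defect_le_one (R : ℝ) (x y : Space d) : P.defect R x y ≤ 1 := by
  have h1 := (P.inside R).nonneg y
  have h2 := (P.outside R).nonneg y
  rw [defect]
  nlinarith [mul_nonneg (sq_nonneg ((P.inside R).toFun x)) h1,
    mul_nonneg (sq_nonneg ((P.outside R).toFun x)) h2]

/-- The shell on which both cutoffs may be nonzero. -/
def shell (d : ℕ) (R : ℝ) : Set (Space d) := {x | R ≤ ‖x‖ ∧ ‖x‖ ≤ 2 * R}

theorem measurableSet_shell (d : ℕ) (R : ℝ) : MeasurableSet (shell d R) :=
  (measurableSet_le measurable_const measurable_norm).inter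
    (measurableSet_le measurable_norm measurable_const)

theorem outside_eq_zero {R : ℝ} (hR : 0 < R) {x : Space d} (hx : ‖x‖ ≤ R) :
    (P.outside R).toFun x = 0 := by
  have h := P.sq_inside_add_sq_outside R x
  have h1 : (P.inside R).toFun x = 1 := by
    refine P.χ_eq_one _ ?_
    rw [norm_smul, norm_inv, Real.norm_of_nonneg hR.le, inv_mul_le_iff₀ hR, mul_one]
    exact hx
  rw [h1] at h
  nlinarith

theorem inside_eq_zero {R : ℝ} (hR : 0 < R) {x : Space d} (hx : 2 * R ≤ ‖x‖) :
    (P.inside R).toFun x = 0 := by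
  refine P.χ_eq_zero _ ?_
  rw [norm_smul, norm_inv, Real.norm_of_nonneg hR.le, inv_mul_eq_div, le_div_iff₀ hR]
  exact hx

/-- Off the shell one cutoff is `1` and the other is `0`, so `1 - χ³ - η³ = 0`. -/
theorem defect_self_eq_zero {R : ℝ} (hR : 0 < R) {x : Space d} (hx : x ∉ shell d R) :
    P.defect R x x = 0 := by
  have h := P.sq_inside_add_sq_outside R x
  have h1 := (P.inside R).nonneg x
  have h2 := (P.outside R).nonneg x
  rw [defect]
  by_cases hx1 : ‖x‖ ≤ R
  · rw [P.outside_eq_zero hR hx1] at h ⊢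
    have h3 : (P.inside R).toFun x = 1 := by nlinarith
    rw [h3]; norm_num
  · have hx2 : 2 * R ≤ ‖x‖ := by
      by_contra h3
      exact hx ⟨(not_le.1 hx1).le, (not_le.1 h3).le⟩
    rw [P.inside_eq_zero hR hx2] at h ⊢
    have h3 : (P.outside R).toFun x = 1 := by nlinarith
    rw [h3]; norm_num

theorem abs_sub_le_of_fderiv {f : Space d → ℝ} (hf : ContDiff ℝ ∞ f) {B : ℝ}
    (hB : ∀ x, ‖fderiv ℝ f x‖ ≤ B) (x y : Space d) : f x - f y ≤ B * ‖x - y‖ := by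
  have h := Convex.norm_image_sub_le_of_norm_fderiv_le (𝕜 := ℝ) (s := Set.univ) (x := y) (y := x)
    (fun z _ => hf.differentiable (by simp) z) (fun z _ => hB z) convex_univ trivial trivial
  exact (le_abs_self _).trans h

/-- As a function of `y` the defect is an average of two `B`-Lipschitz functions with weights `χ(x)²
+ η(x)² = 1`, up to sign and a constant. -/
theorem defect_sub_self_le {B R : ℝ} (h1 : ∀ x, ‖fderiv ℝ (P.inside R).toFun x‖ ≤ B)
    (h2 : ∀ x, ‖fderiv ℝ (P.outside R).toFun x‖ ≤ B) (x y : Space d) :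
    P.defect R x y ≤ P.defect R x x + B * ‖x - y‖ := by
  have h3 := abs_sub_le_of_fderiv (P.contDiff_inside R) h1 x y
  have h4 := abs_sub_le_of_fderiv (P.contDiff_outside R) h2 x y
  have h := P.sq_inside_add_sq_outside R x
  simp only [defect]
  linear_combination mul_le_mul_of_nonneg_left h3 (sq_nonneg ((P.inside R).toFun x)) +
    mul_le_mul_of_nonneg_left h4 (sq_nonneg ((P.outside R).toFun x)) + (B * ‖x - y‖) * h

/-- If `|x - y| > r` the trivial bound `D ≤ 1` is used. Otherwise `D` is at most the shell indicator
at `x` plus `B r`, and `(s + t)² ≤ 2s² + 2t²`. -/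
theorem defect_sq_le {B R : ℝ} (r : ℝ) (hR : 0 < R)
    (h1 : ∀ x, ‖fderiv ℝ (P.inside R).toFun x‖ ≤ B)
    (h2 : ∀ x, ‖fderiv ℝ (P.outside R).toFun x‖ ≤ B) (x y : Space d) :
    P.defect R x y ^ 2 ≤ {z : Space d | r < ‖z‖}.indicator 1 (x - y) +
      (2 * (shell d R).indicator 1 x + 2 * (B * r) ^ 2) := by
  have hB : 0 ≤ B := (norm_nonneg _).trans (h1 0)
  have h3 := P.defect_nonneg R x y
  have h4 := P.defect_le_one R x y
  have h5 : (0 : ℝ) ≤ (shell d R).indicator 1 x := Set.indicator_nonneg (fun _ _ => zero_le_one) _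
  by_cases hxy : x - y ∈ {z : Space d | r < ‖z‖}
  · rw [Set.indicator_of_mem hxy, Pi.one_apply]
    nlinarith [sq_nonneg (B * r)]
  · rw [Set.indicator_of_notMem hxy, zero_add]
    have hxy' : ‖x - y‖ ≤ r := not_lt.1 hxy
    have h6 := P.defect_sub_self_le h1 h2 x y
    have h7 : P.defect R x x ≤ (shell d R).indicator 1 x := by
      by_cases hx : x ∈ shell d R
      · rw [Set.indicator_of_mem hx]
        exact P.defect_le_one R x x
      · rw [P.defect_self_eq_zero hR hx]
        exact h5
    have h8 : P.defect R x y ≤ (shell d R).indicator 1 x + B * r := by nlinarith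
    have h9 : (shell d R).indicator (1 : Space d → ℝ) x ^ 2 = (shell d R).indicator 1 x := by
      by_cases hx : x ∈ shell d R
      · simp [Set.indicator_of_mem hx]
      · simp [Set.indicator_of_notMem hx]
    nlinarith [sq_nonneg ((shell d R).indicator (1 : Space d → ℝ) x - B * r)]

end SmoothPartition

/-! ### Localization errors, pointwise and integrated -/

/-- The IMS identity: the cross terms carry the factor `χ a + η b`, which is zero. -/
theorem norm_sq_add_le_of_partition {χ η a b : ℝ} (h : χ ^ 2 + η ^ 2 = 1)
    (h0 : χ * a + η * b = 0) (g ψ : ℂ) :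
    ‖(χ : ℂ) * g + (a : ℂ) * ψ‖ ^ 2 + ‖(η : ℂ) * g + (b : ℂ) * ψ‖ ^ 2 =
      ‖g‖ ^ 2 + (a ^ 2 + b ^ 2) * ‖ψ‖ ^ 2 := by
  simp only [← Complex.normSq_eq_norm_sq, Complex.normSq_apply, Complex.add_re, Complex.add_im,
    Complex.re_ofReal_mul, Complex.im_ofReal_mul]
  linear_combination (g.re ^ 2 + g.im ^ 2) * h + 2 * (g.re * ψ.re + g.im * ψ.im) * h0

/-- The coefficient of `‖b‖²` is exactly `1`, that of `‖a‖²` is `χ²χ'² + η²η'² ≤ 1`, and the cross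
term changes by `-2 D Re(a b̄)`, to which Young's inequality with weight `ε` applies. -/
theorem norm_sq_field_le {χ η χ' η' : ℝ} (h : χ ^ 2 + η ^ 2 = 1) (h1 : 0 ≤ χ') (h2 : χ' ≤ 1)
    (h3 : 0 ≤ η') (h4 : η' ≤ 1) {ε : ℝ} (hε : 0 < ε) (a b : ℂ) :
    ‖(χ : ℂ) * ((χ' : ℂ) * a + b)‖ ^ 2 + ‖(η : ℂ) * ((η' : ℂ) * a + b)‖ ^ 2 ≤
      ‖a + b‖ ^ 2 + ε * ‖a‖ ^ 2 + ε⁻¹ * (‖b‖ ^ 2 * (1 - χ ^ 2 * χ' - η ^ 2 * η') ^ 2) := by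
  set D := 1 - χ ^ 2 * χ' - η ^ 2 * η' with hD
  set t := a.re * b.re + a.im * b.im with ht
  have e : ∀ s : ℝ, ‖(s : ℂ) * a + b‖ ^ 2 = s ^ 2 * ‖a‖ ^ 2 + 2 * s * t + ‖b‖ ^ 2 := by
    intro s
    simp only [← Complex.normSq_eq_norm_sq, Complex.normSq_apply, Complex.add_re, Complex.add_im,
      Complex.re_ofReal_mul, Complex.im_ofReal_mul, ht]
    ring
  have e1 := e 1
  rw [Complex.ofReal_one, one_mul] at e1
  have ht2 : t ^ 2 ≤ ‖a‖ ^ 2 * ‖b‖ ^ 2 := by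
    simp only [← Complex.normSq_eq_norm_sq, Complex.normSq_apply, ht]
    nlinarith [sq_nonneg (a.re * b.im - a.im * b.re)]
  have hy : -(2 * t * D) ≤ ε * ‖a‖ ^ 2 + ε⁻¹ * (‖b‖ ^ 2 * D ^ 2) := by
    have h5 : |t * D| ≤ ‖a‖ * (‖b‖ * |D|) := by
      rw [abs_mul, ← mul_assoc]
      refine mul_le_mul_of_nonneg_right ?_ (abs_nonneg _)
      refine abs_le_of_sq_le_sq ?_ (by positivity)
      rw [mul_pow]
      exact ht2
    have h6 := neg_abs_le (t * D)
    have h7 : ε * ‖a‖ ^ 2 + ε⁻¹ * (‖b‖ ^ 2 * D ^ 2) - 2 * (‖a‖ * (‖b‖ * |D|)) =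
        ε⁻¹ * (ε * ‖a‖ - ‖b‖ * |D|) ^ 2 := by
      have : |D| ^ 2 = D ^ 2 := sq_abs D
      field_simp
      linear_combination (-(‖b‖ ^ 2)) * this
    have h8 : 0 ≤ ε⁻¹ * (ε * ‖a‖ - ‖b‖ * |D|) ^ 2 := by positivity
    linarith
  rw [norm_mul, norm_mul, mul_pow, mul_pow, Complex.norm_real, Complex.norm_real,
    Real.norm_eq_abs, Real.norm_eq_abs, sq_abs, sq_abs, e, e, e1]
  have h9 : χ ^ 2 * χ' ^ 2 + η ^ 2 * η' ^ 2 ≤ 1 := by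
    have := mul_nonneg (sq_nonneg χ) (show (0 : ℝ) ≤ 1 - χ' ^ 2 by nlinarith)
    have := mul_nonneg (sq_nonneg η) (show (0 : ℝ) ≤ 1 - η' ^ 2 by nlinarith)
    nlinarith
  have h10 := mul_le_mul_of_nonneg_right h9 (sq_nonneg ‖a‖)
  have h11 : 2 * t * D = 2 * t - χ ^ 2 * (2 * χ' * t) - η ^ 2 * (2 * η' * t) := by
    rw [hD]; ring
  linear_combination h10 + hy + h11 + ‖b‖ ^ 2 * h

theorem enorm_ofReal_mul_sq (s : ℝ) (u : ℂ) :
    ‖(s : ℂ) * u‖ₑ ^ 2 = ENNReal.ofReal (s ^ 2) * ‖u‖ₑ ^ 2 := by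
  rw [enorm_mul, mul_pow, enorm_sq_eq_ofReal (s : ℂ), Complex.norm_real, Real.norm_eq_abs, sq_abs]

/-- The mass of `F` in the shell of radius `R`. -/
def shellMass {d : ℕ} (R : ℝ) (F : Space d × Conf d → ℂ) : ℝ≥0∞ :=
  ∫⁻ z, (SmoothPartition.shell d R).indicator 1 z.1 * ‖F z‖ₑ ^ 2

namespace SmoothPartition

variable {d : ℕ} (P : SmoothPartition d)

theorem lintegral_cutoffMul_add {R : ℝ} {F : Space d × Conf d → ℂ} (hF : Measurable F) :
    (∫⁻ z, ‖cutoffMul (P.inside R) F z‖ₑ ^ 2) + ∫⁻ z, ‖cutoffMul (P.outside R) F z‖ₑ ^ 2 =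
      ∫⁻ z, ‖F z‖ₑ ^ 2 := by
  rw [← lintegral_add_left ((measurable_cutoffMul _ hF).enorm.pow_const 2)]
  refine lintegral_congr fun z => ?_
  rw [cutoffMul, cutoffMul, enorm_ofReal_mul_sq, enorm_ofReal_mul_sq, ← add_mul,
    ← ENNReal.ofReal_add (sq_nonneg _) (sq_nonneg _), P.sq_inside_add_sq_outside,
    ENNReal.ofReal_one, one_mul]

/-- In each of the `d` directions each of the two cutoffs contributes at most `B²`. -/
theorem sum_lintegral_cutoffGradient_le {B R : ℝ}
    (h1 : ∀ x, ‖fderiv ℝ (P.inside R).toFun x‖ ≤ B)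
    (h2 : ∀ x, ‖fderiv ℝ (P.outside R).toFun x‖ ≤ B) {F : Space d × Conf d → ℂ}
    (hF : Measurable F) {G : Fin d → Space d × Conf d → ℂ} (hG : ∀ j, Measurable (G j)) :
    (∑ j, ∫⁻ z, ‖cutoffGradient (P.inside R) F G j z‖ₑ ^ 2) +
        ∑ j, ∫⁻ z, ‖cutoffGradient (P.outside R) F G j z‖ₑ ^ 2 ≤
      (∑ j, ∫⁻ z, ‖G j z‖ₑ ^ 2) + ENNReal.ofReal (d * (2 * B ^ 2)) * ∫⁻ z, ‖F z‖ₑ ^ 2 := by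
  have key : ∀ j, (∫⁻ z, ‖cutoffGradient (P.inside R) F G j z‖ₑ ^ 2) +
      ∫⁻ z, ‖cutoffGradient (P.outside R) F G j z‖ₑ ^ 2 ≤
      (∫⁻ z, ‖G j z‖ₑ ^ 2) + ENNReal.ofReal (2 * B ^ 2) * ∫⁻ z, ‖F z‖ₑ ^ 2 := by
    intro j
    rw [← lintegral_add_left ((measurable_cutoffGradient _ hF hG j).enorm.pow_const 2),
      ← lintegral_const_mul _ (hF.enorm.pow_const 2),
      ← lintegral_add_left ((hG j).enorm.pow_const 2)]
    refine lintegral_mono fun z => ?_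
    have hb : ∀ L : Space d →L[ℝ] ℝ, ‖L‖ ≤ B → L (EuclideanSpace.single j 1) ^ 2 ≤ B ^ 2 := by
      intro L hL
      have h := L.le_opNorm (EuclideanSpace.single j 1)
      rw [norm_single_one, mul_one] at h
      exact sq_le_sq' (by linarith [(abs_le.1 (h.trans hL)).1]) (abs_le.1 (h.trans hL)).2
    have h3 := norm_sq_add_le_of_partition (P.sq_inside_add_sq_outside R z.1)
      (P.fderiv_inside_add_outside R z.1 (EuclideanSpace.single j 1)) (G j z) (F z)
    simp only [enorm_sq_eq_ofReal]
    rw [← ENNReal.ofReal_add (sq_nonneg _) (sq_nonneg _),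
      ← ENNReal.ofReal_mul (by positivity), ← ENNReal.ofReal_add (sq_nonneg _) (by positivity)]
    refine ENNReal.ofReal_le_ofReal (h3.le.trans ?_)
    gcongr
    linarith [hb _ (h1 z.1), hb _ (h2 z.1)]
  rw [← Finset.sum_add_distrib]
  refine (Finset.sum_le_sum fun j _ => key j).trans (le_of_eq ?_)
  rw [Finset.sum_add_distrib, Finset.sum_const, Finset.card_univ, Fintype.card_fin, nsmul_eq_mul,
    ENNReal.ofReal_mul (p := (d : ℝ)) (by positivity), ENNReal.ofReal_natCast, mul_assoc]

theorem fieldFun_cutoffMul (α : ℝ) (q : Cutoff d) (v : Space d → ℝ)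
    (F : Space d × Conf d → ℂ) (r : Space d × (Space d × Conf d)) :
    fieldFun α q.toFun v (cutoffMul q F) r = (q.toFun r.2.1 : ℂ) *
      ((q.toFun r.1 : ℂ) * annih α F r.1 r.2 + (v (r.2.1 - r.1) : ℂ) * F r.2) := by
  simp only [fieldFun, annih, cutoffMul]
  ring

/-- `norm_sq_field_le` with `a = a_y Ψ` and `b = v(x-y) Ψ`: the cutoffs at the particle position `x`
form the partition, those at the field point `y` are only known to lie in `[0, 1]`. -/
theorem lintegral_fieldFun_le (α : ℝ) {v : Space d → ℝ} (hv : Measurable v) (R : ℝ) {ε : ℝ}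
    (hε : 0 < ε) {F : Space d × Conf d → ℂ} (hF : Measurable F) :
    (∫⁻ r, ‖fieldFun α (P.inside R).toFun v (cutoffMul (P.inside R) F) r‖ₑ ^ 2) +
        ∫⁻ r, ‖fieldFun α (P.outside R).toFun v (cutoffMul (P.outside R) F) r‖ₑ ^ 2 ≤
      (∫⁻ r, ‖fieldFun α 1 v F r‖ₑ ^ 2) +
        (ENNReal.ofReal ε * (∫⁻ r : Space d × (Space d × Conf d), ‖annih α F r.1 r.2‖ₑ ^ 2) +
        ENNReal.ofReal ε⁻¹ * ∫⁻ r : Space d × (Space d × Conf d),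
          ENNReal.ofReal (P.defect R r.2.1 r.1 ^ 2) * ‖(v (r.2.1 - r.1) : ℂ) * F r.2‖ₑ ^ 2) := by
  have hD : Measurable fun r : Space d × (Space d × Conf d) =>
      ENNReal.ofReal (P.defect R r.2.1 r.1 ^ 2) :=
    (((P.measurable_defect R).comp ((measurable_fst.comp measurable_snd).prodMk
      measurable_fst)).pow_const 2).ennreal_ofReal
  have hDv : Measurable fun r : Space d × (Space d × Conf d) =>
      ENNReal.ofReal (P.defect R r.2.1 r.1 ^ 2) * ‖(v (r.2.1 - r.1) : ℂ) * F r.2‖ₑ ^ 2 :=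
    hD.mul ((measurable_translate_mul hv hF).enorm.pow_const 2)
  have ha := (measurable_annih α hF).enorm.pow_const 2
  rw [← lintegral_add_left ((measurable_fieldFun α (P.inside R).measurable hv
      (measurable_cutoffMul _ hF)).enorm.pow_const 2),
    ← lintegral_const_mul _ ha, ← lintegral_const_mul _ hDv,
    ← lintegral_add_left (ha.const_mul _),
    ← lintegral_add_left ((measurable_fieldFun α measurable_one hv hF).enorm.pow_const 2)]
  refine lintegral_mono fun r => ?_
  have h := norm_sq_field_le (P.sq_inside_add_sq_outside R r.2.1) ((P.inside R).nonneg r.1)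
    ((P.inside R).le_one r.1) ((P.outside R).nonneg r.1) ((P.outside R).le_one r.1) hε
    (annih α F r.1 r.2) ((v (r.2.1 - r.1) : ℂ) * F r.2)
  rw [fieldFun_cutoffMul, fieldFun_cutoffMul, fieldFun, Pi.one_apply, Complex.ofReal_one, one_mul]
  simp only [enorm_sq_eq_ofReal]
  rw [← ENNReal.ofReal_add (sq_nonneg _) (sq_nonneg _), ← ENNReal.ofReal_mul (sq_nonneg _),
    ← ENNReal.ofReal_mul hε.le, ← ENNReal.ofReal_mul (inv_nonneg.2 hε.le),
    ← ENNReal.ofReal_add (by positivity) (by positivity),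
    ← ENNReal.ofReal_add (by positivity) (by positivity)]
  refine ENNReal.ofReal_le_ofReal (h.trans (le_of_eq ?_))
  rw [defect]
  ring

/-- The three terms of `defect_sq_le` yield the tail of `v` beyond `r`, the mass of `F` in the
shell, and the Lipschitz error of the cutoffs at distance `r`. -/
theorem lintegral_defect_le {B R : ℝ} (r : ℝ) (hR : 0 < R)
    (h1 : ∀ x, ‖fderiv ℝ (P.inside R).toFun x‖ ≤ B)
    (h2 : ∀ x, ‖fderiv ℝ (P.outside R).toFun x‖ ≤ B) {v : Space d → ℝ} (hv : Measurable v)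
    {F : Space d × Conf d → ℂ} (hF : Measurable F) :
    ∫⁻ p : Space d × (Space d × Conf d),
        ENNReal.ofReal (P.defect R p.2.1 p.1 ^ 2) * ‖(v (p.2.1 - p.1) : ℂ) * F p.2‖ₑ ^ 2 ≤
      (∫⁻ y in {z : Space d | r < ‖z‖}, ‖v y‖ₑ ^ 2) * (∫⁻ z, ‖F z‖ₑ ^ 2) +
        (∫⁻ y, ‖v y‖ₑ ^ 2) * (2 * shellMass R F +
          ENNReal.ofReal (2 * (B * r) ^ 2) * ∫⁻ z, ‖F z‖ₑ ^ 2) := by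
  have hS : MeasurableSet {z : Space d | r < ‖z‖} :=
    measurableSet_lt measurable_const measurable_norm
  have hv2 := hv.enorm.pow_const 2
  have hF2 := hF.enorm.pow_const 2
  have hsh : Measurable fun z : Space d × Conf d =>
      (shell d R).indicator (1 : Space d → ℝ≥0∞) z.1 * ‖F z‖ₑ ^ 2 :=
    ((measurable_one.indicator (measurableSet_shell d R)).comp measurable_fst).mul hF2
  have hsF : Measurable fun z : Space d × Conf d =>
      2 * ((shell d R).indicator (1 : Space d → ℝ≥0∞) z.1 * ‖F z‖ₑ ^ 2) +
        ENNReal.ofReal (2 * (B * r) ^ 2) * ‖F z‖ₑ ^ 2 :=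
    (hsh.const_mul _).add (hF2.const_mul _)
  have hvi : Measurable fun p : Space d × (Space d × Conf d) =>
      {z : Space d | r < ‖z‖}.indicator (fun y => ‖v y‖ₑ ^ 2) (p.2.1 - p.1) * ‖F p.2‖ₑ ^ 2 :=
    ((hv2.indicator hS).comp
      ((measurable_fst.comp measurable_snd).sub measurable_fst)).mul (hF2.comp measurable_snd)
  rw [shellMass, ← lintegral_const_mul _ hsh,
    ← lintegral_const_mul (ENNReal.ofReal (2 * (B * r) ^ 2)) hF2,
    ← lintegral_add_left (hsh.const_mul _), ← lintegral_indicator hS,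
    ← lintegral_translate_mul (hv2.indicator hS) hF2,
    ← lintegral_translate_mul hv2 hsF, ← lintegral_add_left hvi]
  refine lintegral_mono fun p => ?_
  have h3 : ENNReal.ofReal (P.defect R p.2.1 p.1 ^ 2) ≤
      {z : Space d | r < ‖z‖}.indicator 1 (p.2.1 - p.1) +
        (2 * (shell d R).indicator 1 p.2.1 + ENNReal.ofReal (2 * (B * r) ^ 2)) := by
    have hi : ∀ (s : Set (Space d)) x,
        s.indicator (1 : Space d → ℝ≥0∞) x = ENNReal.ofReal (s.indicator 1 x) := by
      intro s x
      by_cases hx : x ∈ s <;> simp [hx]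
    have hn : ∀ (s : Set (Space d)) x, (0 : ℝ) ≤ s.indicator 1 x := fun s x =>
      Set.indicator_nonneg (fun _ _ => zero_le_one) _
    have h0 := hn (shell d R) p.2.1
    have h0' := hn {z : Space d | r < ‖z‖} (p.2.1 - p.1)
    have h2' : 2 * ENNReal.ofReal ((shell d R).indicator 1 p.2.1) =
        ENNReal.ofReal (2 * (shell d R).indicator 1 p.2.1) := by
      rw [ENNReal.ofReal_mul zero_le_two, ENNReal.ofReal_ofNat]
    rw [hi, hi, h2', ← ENNReal.ofReal_add (by positivity) (by positivity),
      ← ENNReal.ofReal_add h0' (by positivity)]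
    exact ENNReal.ofReal_le_ofReal (P.defect_sq_le r hR h1 h2 p.2.1 p.1)
  refine (mul_le_mul_left h3 _).trans (le_of_eq ?_)
  have h4 : {z : Space d | r < ‖z‖}.indicator (fun y => ‖v y‖ₑ ^ 2) (p.2.1 - p.1) =
      {z : Space d | r < ‖z‖}.indicator 1 (p.2.1 - p.1) * ‖v (p.2.1 - p.1)‖ₑ ^ 2 := by
    by_cases hx : p.2.1 - p.1 ∈ {z : Space d | r < ‖z‖}
    · rw [Set.indicator_of_mem hx, Set.indicator_of_mem hx, Pi.one_apply, one_mul]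
    · rw [Set.indicator_of_notMem hx, Set.indicator_of_notMem hx, zero_mul]
  have h5 : ‖(v (p.2.1 - p.1) : ℂ)‖ₑ = ‖v (p.2.1 - p.1)‖ₑ := by
    rw [← ofReal_norm, ← ofReal_norm, Complex.norm_real]
  rw [h4, enorm_mul, h5]
  ring

/-- Only `-V η²` is lost in passing from `V` to `χ² V`, and `η` vanishes for `|x| ≤ R`. -/
theorem lintegral_potential_le {R : ℝ} (hR : 0 < R) {V : Space d → ℝ} (hV : Measurable V) {m : ℝ}
    (hm : ∀ x, |V x| ≤ m) {e : ℝ} (he : 0 ≤ e) (hVe : ∀ᵐ x, R ≤ ‖x‖ → -V x ≤ e)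
    {F : Space d × Conf d → ℂ} (hF : Measurable F) :
    (∫⁻ z, ENNReal.ofReal (V z.1 + m) * ‖cutoffMul (P.inside R) F z‖ₑ ^ 2) +
        ∫⁻ z, ENNReal.ofReal ((0 : Space d → ℝ) z.1 + m) * ‖cutoffMul (P.outside R) F z‖ₑ ^ 2 ≤
      (∫⁻ z, ENNReal.ofReal (V z.1 + m) * ‖F z‖ₑ ^ 2) +
        ENNReal.ofReal e * ∫⁻ z, ‖F z‖ₑ ^ 2 := by
  have hVm : Measurable fun z : Space d × Conf d => ENNReal.ofReal (V z.1 + m) :=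
    ((hV.comp measurable_fst).add_const m).ennreal_ofReal
  have hF2 := hF.enorm.pow_const 2
  have h1 : Measurable fun z : Space d × Conf d =>
      ENNReal.ofReal (V z.1 + m) * ‖cutoffMul (P.inside R) F z‖ₑ ^ 2 :=
    hVm.mul ((measurable_cutoffMul _ hF).enorm.pow_const 2)
  have h2 : Measurable fun z : Space d × Conf d => ENNReal.ofReal (V z.1 + m) * ‖F z‖ₑ ^ 2 :=
    hVm.mul hF2
  rw [← lintegral_add_left h1, ← lintegral_const_mul _ hF2, ← lintegral_add_left h2]
  refine lintegral_mono_ae ?_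
  filter_upwards [(Measure.quasiMeasurePreserving_fst (μ := (volume : Measure (Space d)))
      (ν := (volume : Measure (Conf d)))).ae hVe] with z hz
  have h := P.sq_inside_add_sq_outside R z.1
  have h0 : 0 ≤ V z.1 + m := by linarith [(abs_le.1 (hm z.1)).1]
  have hm0 : 0 ≤ m := (abs_nonneg _).trans (hm z.1)
  rw [cutoffMul, cutoffMul, enorm_ofReal_mul_sq, enorm_ofReal_mul_sq, ← mul_assoc, ← mul_assoc,
    ← add_mul, ← add_mul, Pi.zero_apply, zero_add]
  refine mul_le_mul_left ?_ _
  rw [← ENNReal.ofReal_mul h0, ← ENNReal.ofReal_mul hm0,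
    ← ENNReal.ofReal_add (by positivity) (by positivity), ← ENNReal.ofReal_add h0 he]
  refine ENNReal.ofReal_le_ofReal ?_
  have h2 : -V z.1 * (P.outside R).toFun z.1 ^ 2 ≤ e := by
    rcases le_total R ‖z.1‖ with hz1 | hz1
    · nlinarith [hz hz1, sq_nonneg ((P.inside R).toFun z.1), sq_nonneg ((P.outside R).toFun z.1)]
    · rw [P.outside_eq_zero hR hz1]
      simpa using he
  linear_combination h2 + (V z.1 + m) * h

end SmoothPartition

/-! ### The localization error for one radius and the mass in shells -/

theorem number_le {d : ℕ} (α : ℝ) {v : Space d → ℝ} (hv : Measurable v) (Ψ : Hil d) :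
    number α Ψ ≤ 2 * fieldEnergy α v Ψ + 2 * ((∫⁻ y, ‖v y‖ₑ ^ 2) * ∫⁻ z, ‖Ψ.1 z‖ₑ ^ 2) := by
  have h1 := (measurable_fieldFun α measurable_one hv (measurable_lp Ψ.1)).enorm.pow_const 2
  have h2 := (measurable_translate_mul hv (measurable_lp Ψ.1)).enorm.pow_const 2
  rw [number_eq, fieldEnergy, ← lintegral_translate_mul_sq hv (measurable_lp Ψ.1),
    ← lintegral_const_mul _ h1, ← lintegral_const_mul _ h2,
    ← lintegral_add_left (h1.const_mul _)]
  refine lintegral_mono fun r => ?_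
  have h3 : annih α Ψ.1 r.1 r.2 =
      fieldFun α 1 v Ψ.1 r - (v (r.2.1 - r.1) : ℂ) * Ψ.1 r.2 := by
    rw [fieldFun, Pi.one_apply, Complex.ofReal_one, one_mul, add_sub_cancel_right]
  rw [h3, ← mul_add]
  generalize fieldFun α 1 v Ψ.1 r = a
  generalize (v (r.2.1 - r.1) : ℂ) * Ψ.1 r.2 = b
  rw [enorm_sq_eq_ofReal, enorm_sq_eq_ofReal, enorm_sq_eq_ofReal,
    ← ENNReal.ofReal_add (sq_nonneg _) (sq_nonneg _), ← ENNReal.ofReal_ofNat,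
    ← ENNReal.ofReal_mul zero_le_two]
  refine ENNReal.ofReal_le_ofReal ?_
  have h4 := norm_sub_le a b
  nlinarith [sq_nonneg (‖a‖ - ‖b‖), norm_nonneg a, norm_nonneg b, norm_nonneg (a - b)]

namespace SmoothPartition

variable {d : ℕ} (P : SmoothPartition d)

/-- All errors but two are small for suitable parameters uniformly in `Ψ`: `number α Ψ` is
controlled by the energy, and `shellMass R Ψ` by the choice of `R`. -/
theorem traceForm_localize_add_le {B R : ℝ} (hR : 0 < R)
    (h1 : ∀ x, ‖fderiv ℝ (P.inside R).toFun x‖ ≤ B)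
    (h2 : ∀ x, ‖fderiv ℝ (P.outside R).toFun x‖ ≤ B) (α r : ℝ) {ε e : ℝ} (hε : 0 < ε)
    (he : 0 ≤ e) {V v : Space d → ℝ} (hv : Measurable v) (hv2 : MemLp v 2 volume)
    (hV : Measurable V) {m : ℝ} (hm : ∀ x, |V x| ≤ m) (hVe : ∀ᵐ x, R ≤ ‖x‖ → -V x ≤ e)
    {Ψ : Hil d} (hΨ : ‖Ψ‖ = 1) :
    traceForm (energy α V v) (localize (P.inside R) (pureState Ψ)) +
        traceForm (energy α 0 v) (localize (P.outside R) (pureState Ψ)) ≤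
      traceForm (energy α V v) (pureState Ψ) +
        ((ENNReal.ofReal (d * (2 * B ^ 2)) + (ENNReal.ofReal ε * number α Ψ +
          ENNReal.ofReal ε⁻¹ * ((∫⁻ y in {z : Space d | r < ‖z‖}, ‖v y‖ₑ ^ 2) +
            (∫⁻ y, ‖v y‖ₑ ^ 2) * (2 * shellMass R Ψ.1 + ENNReal.ofReal (2 * (B * r) ^ 2)))) +
          ENNReal.ofReal e : ℝ≥0∞) : EReal) := by
  have hmΨ := measurable_lp Ψ.1
  have hm0 : ∀ x : Space d, |(0 : Space d → ℝ) x| ≤ m := fun x => by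
    rw [Pi.zero_apply, abs_zero]
    exact (abs_nonneg _).trans (hm x)
  have hone : ∫⁻ z, ‖Ψ.1 z‖ₑ ^ 2 = 1 := by
    rw [← enorm_hil_sq, ← ofReal_norm, hΨ, ENNReal.ofReal_one, one_pow]
  obtain ⟨T, hT, hTle⟩ := traceForm_energy_localize_le α hv hv2 hV hm (P.inside R)
    (P.contDiff_inside R) h1 Ψ
  obtain ⟨S, hS, hSle⟩ := traceForm_energy_localize_le α hv hv2 measurable_zero hm0 (P.outside R)
    (P.contDiff_outside R) h2 Ψ
  set E := ENNReal.ofReal (d * (2 * B ^ 2)) + (ENNReal.ofReal ε * number α Ψ +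
          ENNReal.ofReal ε⁻¹ * ((∫⁻ y in {z : Space d | r < ‖z‖}, ‖v y‖ₑ ^ 2) +
            (∫⁻ y, ‖v y‖ₑ ^ 2) * (2 * shellMass R Ψ.1 + ENNReal.ofReal (2 * (B * r) ^ 2)))) +
          ENNReal.ofReal e with hE
  have hmass := P.lintegral_cutoffMul_add (R := R) hmΨ
  rw [hone] at hmass
  have hfield := (P.lintegral_fieldFun_le α hv R hε hmΨ).trans (add_le_add_right (add_le_add_right
    (mul_le_mul_right (P.lintegral_defect_le r hR h1 h2 hv hmΨ) _) _) _)
  have hpot := P.lintegral_potential_le hR hV hm he hVe hmΨ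
  rw [hone, mul_one, mul_one, ← number_eq] at hfield
  rw [hone, mul_one] at hpot
  have key : T + S ≤ totalEnergy α V v m Ψ + E := by
    have hX : T + S ≤ kinetic Ψ + (fieldEnergy α v Ψ + shiftedPotential V m Ψ + E) := by
      -- The inequality is moved to the form `… ≤ kinetic Ψ`, so that the infimum can be tested on
      -- each gradient; if there is none, `kinetic Ψ = ⊤`.
      rw [← tsub_le_iff_right]
      refine le_iInf₂ fun G hG => ?_
      rw [tsub_le_iff_right]
      obtain ⟨G', hG', hs, hle⟩ := exists_fieldSymm_isWeakGradient Ψ hG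
      have hkin := P.sum_lintegral_cutoffGradient_le h1 h2 hmΨ fun j => measurable_lp (G' j)
      rw [hone, mul_one] at hkin
      have hsum : ∑ j, ∫⁻ z, ‖G' j z‖ₑ ^ 2 ≤ ∑ j, ‖G j‖ₑ ^ 2 :=
        Finset.sum_le_sum fun j _ => (enorm_lp_sq (G' j)).symm.le.trans (hle j)
      have hkin' := hkin.trans (add_le_add_left hsum _)
      refine (add_le_add (hTle G' hG' hs) (hSle G' hG' hs)).trans ?_
      have h3 := add_le_add (add_le_add hkin' hfield) hpot
      refine (le_of_eq ?_).trans (h3.trans (le_of_eq ?_))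
      · ring
      · rw [hE, fieldEnergy, shiftedPotential]
        ring
    refine hX.trans (le_of_eq ?_)
    rw [totalEnergy]
    ring
  -- The masses of the two localized states add up to `1`, so their shifts add up to that of `Ψ` and
  -- cancel.
  have hreal : (∫⁻ z, ‖cutoffMul (P.inside R) Ψ.1 z‖ₑ ^ 2).toReal +
      (∫⁻ z, ‖cutoffMul (P.outside R) Ψ.1 z‖ₑ ^ 2).toReal = 1 := by
    rw [← ENNReal.toReal_add, hmass, ENNReal.toReal_one]
    · exact ((lintegral_cutoffMul_le _ _).trans_lt (lintegral_lp_lt_top _)).ne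
    · exact ((lintegral_cutoffMul_le _ _).trans_lt (lintegral_lp_lt_top _)).ne
  rw [hT, hS, traceForm_energy_pureState α hv hv2 hV hm hΨ, add_add_add_comm, ← EReal.coe_add,
    ← EReal.coe_ennreal_add, ← neg_add, ← mul_add, hreal, mul_one, add_right_comm,
    ← EReal.coe_ennreal_add]
  exact add_le_add_left (EReal.coe_ennreal_le_coe_ennreal_iff.2 key) _

/-- The outer radius `2 · 4^k R` of a shell is less than the inner radius `4^(k+1) R` of the next,
so the shells are disjoint. -/
theorem sum_shellMass_le {R : ℝ} (hR : 0 < R) (n : ℕ) {F : Space d × Conf d → ℂ}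
    (hF : Measurable F) :
    ∑ k ∈ Finset.range n, shellMass (4 ^ k * R) F ≤ ∫⁻ z, ‖F z‖ₑ ^ 2 := by
  have hdis : (↑(Finset.range n) : Set ℕ).PairwiseDisjoint fun k => shell d (4 ^ k * R) := by
    have h : ∀ i j : ℕ, i < j → Disjoint (shell d (4 ^ i * R)) (shell d (4 ^ j * R)) := by
      intro i j hij
      refine Set.disjoint_left.2 fun x hi hj => ?_
      have h1 : (4 : ℝ) ^ (i + 1) ≤ 4 ^ j := pow_le_pow_right₀ (by norm_num) hij
      have h2 := mul_le_mul_of_nonneg_right h1 hR.le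
      have h3 : 0 < (4 : ℝ) ^ i * R := by positivity
      rw [pow_succ] at h2
      linarith [hi.2, hj.1]
    intro i _ j _ hij
    rcases lt_or_gt_of_ne hij with h' | h'
    · exact h i j h'
    · exact (h j i h').symm
  have hm : ∀ k, Measurable fun z : Space d × Conf d =>
      (shell d (4 ^ k * R)).indicator (1 : Space d → ℝ≥0∞) z.1 * ‖F z‖ₑ ^ 2 := fun k =>
    ((measurable_one.indicator (measurableSet_shell d _)).comp measurable_fst).mul
      (hF.enorm.pow_const 2)
  simp only [shellMass]
  rw [← lintegral_finsetSum _ fun k _ => hm k]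
  refine lintegral_mono fun z => ?_
  rw [← Finset.sum_mul]
  have h := congrFun (Finset.indicator_biUnion (f := (1 : Space d → ℝ≥0∞)) (Finset.range n)
    (fun k => shell d (4 ^ k * R)) hdis) z.1
  rw [← h]
  exact mul_le_of_le_one_left' (Set.indicator_le_self' (fun _ _ => zero_le_one) _)

theorem exists_shellMass_le {R : ℝ} (hR : 0 < R) {n : ℕ} (hn : n ≠ 0) {Ψ : Hil d}
    (hΨ : ‖Ψ‖ = 1) : ∃ k ∈ Finset.range n, shellMass (4 ^ k * R) Ψ.1 ≤ (n : ℝ≥0∞)⁻¹ := by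
  refine ENNReal.exists_le_of_sum_le (Finset.nonempty_range_iff.2 hn) ?_
  refine (sum_shellMass_le hR n (measurable_lp Ψ.1)).trans ?_
  rw [Finset.sum_const, Finset.card_range, nsmul_eq_mul,
    ENNReal.mul_inv_cancel (Nat.cast_ne_zero.2 hn) (ENNReal.natCast_ne_top n), ← enorm_hil_sq,
    ← ofReal_norm, hΨ, ENNReal.ofReal_one, one_pow]

end SmoothPartition

/-! ### Choice of the constants -/

theorem exists_tail_le {d : ℕ} {v : Space d → ℝ} (hv : Measurable v) (hv2 : MemLp v 2 volume)
    {τ : ℝ} (hτ : 0 < τ) :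
    ∃ r : ℝ, ∫⁻ y in {z : Space d | r < ‖z‖}, ‖v y‖ₑ ^ 2 ≤ ENNReal.ofReal τ := by
  have hS : ∀ n : ℕ, MeasurableSet {z : Space d | (n : ℝ) < ‖z‖} := fun n =>
    measurableSet_lt measurable_const measurable_norm
  have h := tendsto_lintegral_of_dominated_convergence (μ := (volume : Measure (Space d)))
    (F := fun n : ℕ => {z : Space d | (n : ℝ) < ‖z‖}.indicator fun y => ‖v y‖ₑ ^ 2) (f := 0)
    (fun y => ‖v y‖ₑ ^ 2) (fun n => (hv.enorm.pow_const 2).indicator (hS n))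
    (fun n => Eventually.of_forall fun y => Set.indicator_le_self _ _ y)
    (lintegral_enorm_sq_lt_top hv2).ne (Eventually.of_forall fun y => by
      refine tendsto_const_nhds.congr' ?_
      obtain ⟨n, hn⟩ := exists_nat_ge ‖y‖
      filter_upwards [eventually_ge_atTop n] with k hk
      refine (Set.indicator_of_notMem ?_ _).symm
      exact not_lt.2 (hn.trans (Nat.cast_le.2 hk)))
  simp only [Pi.zero_apply, lintegral_zero] at h
  obtain ⟨n, hn⟩ := (h.eventually_lt_const (ENNReal.ofReal_pos.2 hτ)).exists
  exact ⟨n, by rw [← lintegral_indicator (hS n)]; exact hn.le⟩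

theorem exists_forall_neg_le {d : ℕ} {V : Space d → ℝ}
    (hV : Tendsto V (cocompact (Space d) ⊓ ae volume) (𝓝 0)) {e : ℝ} (he : 0 < e) :
    ∀ᶠ R in atTop, ∀ᵐ x, R ≤ ‖x‖ → -V x ≤ e := by
  have h := hV.eventually (lt_mem_nhds (neg_lt_zero.2 he))
  obtain ⟨s, hs, t, ht, hst⟩ := eventually_inf.1 h
  obtain ⟨K, hK, hKs⟩ := mem_cocompact.1 hs
  obtain ⟨r, hr⟩ := hK.isBounded.subset_closedBall 0
  filter_upwards [eventually_gt_atTop r] with R hR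
  filter_upwards [ht] with x hx hxR
  have h1 : x ∈ s := hKs fun hxK => by
    have := mem_closedBall_zero_iff.1 (hr hxK)
    linarith
  linarith [hst x ⟨h1, hx⟩]

/-- The threshold `κ` for the shell mass depends on neither `R`, `α` nor `Ψ`; this lets the number
of shells be fixed before the radius. -/
theorem SmoothPartition.exists_traceForm_localize_add_le {d : ℕ} (P : SmoothPartition d)
    {V v : Space d → ℝ} (hv : Measurable v) (hv2 : MemLp v 2 volume) (hV : Measurable V) {m : ℝ}
    (hm : ∀ x, |V x| ≤ m) (hVlim : Tendsto V (cocompact (Space d) ⊓ ae volume) (𝓝 0))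
    {δ M : ℝ} (hδ : 0 < δ) (hM : 0 ≤ M) :
    ∃ κ : ℝ, 0 < κ ∧ ∀ᶠ R in atTop, ∀ (α : ℝ) (Ψ : Hil d), ‖Ψ‖ = 1 →
      totalEnergy α V v m Ψ ≤ ENNReal.ofReal M → shellMass R Ψ.1 ≤ ENNReal.ofReal κ →
      traceForm (energy α V v) (localize (P.inside R) (pureState Ψ)) +
          traceForm (energy α 0 v) (localize (P.outside R) (pureState Ψ)) ≤
        traceForm (energy α V v) (pureState Ψ) + (δ : EReal) := by
  obtain ⟨B, hB0, hχ, hη⟩ := P.exists_norm_fderiv_le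
  set w := (∫⁻ y, ‖v y‖ₑ ^ 2).toReal with hw
  have hw0 : 0 ≤ w := ENNReal.toReal_nonneg
  have hwe : ∫⁻ y, ‖v y‖ₑ ^ 2 = ENNReal.ofReal w :=
    (ENNReal.ofReal_toReal (lintegral_enorm_sq_lt_top hv2).ne).symm
  -- The error budget is six parts `δ/6`: one each for the kinetic term, `ε` times the number, and
  -- `V`; three for the defect, namely tail, shell and Lipschitz error. The number is at most `2M +
  -- 2w`, and the `+ 1` keeps the denominator positive. The order of choice is `ε`, then `r` and
  -- `κ`, and `R` last.
  set ε := δ / (6 * (2 * M + 2 * w + 1)) with hε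
  have hε0 : 0 < ε := by positivity
  obtain ⟨r, hr⟩ := exists_tail_le hv hv2 (τ := ε * (δ / 6)) (by positivity)
  set κ := ε * (δ / 6) / (2 * w + 1) with hκ
  have hκ0 : 0 < κ := by positivity
  refine ⟨κ, hκ0, ?_⟩
  have hlim : ∀ c : ℝ, Tendsto (fun R : ℝ => c * (B / R) ^ 2) atTop (𝓝 0) := fun c => by
    have h := ((tendsto_const_nhds (x := B)).div_atTop tendsto_id).pow 2 |>.const_mul c
    simpa using h
  filter_upwards [eventually_gt_atTop 0, exists_forall_neg_le hVlim (e := δ / 6) (by positivity),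
    (hlim (2 * d)).eventually_le_const (show (0 : ℝ) < δ / 6 by positivity),
    (hlim (2 * w * r ^ 2)).eventually_le_const (show (0 : ℝ) < ε * (δ / 6) by positivity)]
    with R hR hVe hd hrR α Ψ hΨ hE hs
  refine (P.traceForm_localize_add_le hR (norm_fderiv_scale_le P.χ_smooth hχ hR)
    (norm_fderiv_scale_le P.η_smooth hη hR) α r hε0 (e := δ / 6) (by positivity) hv hv2 hV hm hVe
    hΨ).trans (add_le_add_right ?_ _)
  have hone : ∫⁻ z, ‖Ψ.1 z‖ₑ ^ 2 = 1 := by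
    rw [← enorm_hil_sq, ← ofReal_norm, hΨ, ENNReal.ofReal_one, one_pow]
  have hN : number α Ψ ≤ ENNReal.ofReal (2 * M + 2 * w) := by
    have h1 : fieldEnergy α v Ψ ≤ ENNReal.ofReal M :=
      (le_add_left le_rfl |>.trans le_self_add).trans hE
    refine (number_le α hv Ψ).trans ?_
    rw [hone, mul_one, hwe, ENNReal.ofReal_add (by positivity) (by positivity),
      ENNReal.ofReal_mul zero_le_two, ENNReal.ofReal_mul zero_le_two, ENNReal.ofReal_ofNat]
    gcongr
  have hfin : ENNReal.ofReal (d * (2 * (B / R) ^ 2)) + (ENNReal.ofReal ε * number α Ψ +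
      ENNReal.ofReal ε⁻¹ * ((∫⁻ y in {z : Space d | r < ‖z‖}, ‖v y‖ₑ ^ 2) +
        (∫⁻ y, ‖v y‖ₑ ^ 2) * (2 * shellMass R Ψ.1 + ENNReal.ofReal (2 * (B / R * r) ^ 2)))) +
      ENNReal.ofReal (δ / 6) ≤
      ENNReal.ofReal (d * (2 * (B / R) ^ 2) + (ε * (2 * M + 2 * w) +
        ε⁻¹ * (ε * (δ / 6) + w * (2 * κ + 2 * (B / R * r) ^ 2))) + δ / 6) := by
    rw [ENNReal.ofReal_add (by positivity) (by positivity),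
      ENNReal.ofReal_add (by positivity) (by positivity),
      ENNReal.ofReal_add (p := ε * (2 * M + 2 * w)) (by positivity) (by positivity),
      ENNReal.ofReal_mul hε0.le, ENNReal.ofReal_mul (p := ε⁻¹) (by positivity),
      ENNReal.ofReal_add (p := ε * (δ / 6)) (by positivity) (by positivity),
      ENNReal.ofReal_mul hw0, ENNReal.ofReal_add (p := 2 * κ) (by positivity) (by positivity),
      ENNReal.ofReal_mul (p := 2) (q := κ) zero_le_two, ENNReal.ofReal_ofNat, ← hwe]
    gcongr
  have hreal : d * (2 * (B / R) ^ 2) + (ε * (2 * M + 2 * w) +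
        ε⁻¹ * (ε * (δ / 6) + w * (2 * κ + 2 * (B / R * r) ^ 2))) + δ / 6 ≤ δ := by
    have h1 : ε * (2 * M + 2 * w) ≤ δ / 6 := by
      rw [hε, div_mul_eq_mul_div, div_le_div_iff₀ (by positivity) (by norm_num)]
      nlinarith
    have h2 : 2 * w * κ ≤ ε * (δ / 6) := by
      rw [hκ, mul_div_assoc', div_le_iff₀ (by positivity)]
      nlinarith [show 0 < ε * (δ / 6) by positivity]
    have h3 : ε⁻¹ * (ε * (δ / 6) + w * (2 * κ + 2 * (B / R * r) ^ 2)) ≤ 3 * (δ / 6) := by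
      rw [inv_mul_le_iff₀ hε0]
      linear_combination h2 + hrR
    linarith
  have h := EReal.coe_ennreal_le_coe_ennreal_iff.2
    (hfin.trans (ENNReal.ofReal_le_ofReal hreal))
  rwa [EReal.coe_ennreal_ofReal, max_eq_left hδ.le] at h

/-! ### Pigeonhole over the radii -/

theorem frequently_exists_mem_finset {ι β : Type*} {l : Filter β} (s : Finset ι)
    {p : β → ι → Prop} (h : ∃ᶠ a in l, ∃ i ∈ s, p a i) : ∃ i ∈ s, ∃ᶠ a in l, p a i := by
  by_contra hc
  push Not at hc
  refine h ?_
  filter_upwards [(eventually_all_finset s).2 fun i hi => hc i hi] with a ha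
  rintro ⟨i, hi, hp⟩
  exact ha i hi hp

theorem SmoothPartition.liminf_localize_le {d : ℕ} (P : SmoothPartition d)
    {V v : Space d → ℝ} (hv : Measurable v) (hv2 : MemLp v 2 volume) (hV : Measurable V) {m : ℝ}
    (hm : ∀ x, |V x| ≤ m) (hVlim : Tendsto V (cocompact (Space d) ⊓ ae volume) (𝓝 0))
    {Ψ : ℝ → Hil d} (hΨ : ∀ α, 0 < α → ‖Ψ α‖ = 1) :
    liminf (fun R : ℝ => liminf (fun α : ℝ =>
        traceForm (energy α V v) (localize (P.inside R) (pureState (Ψ α))) +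
          traceForm (energy α 0 v) (localize (P.outside R) (pureState (Ψ α)))) atTop) atTop ≤
      liminf (fun α : ℝ => traceForm (energy α V v) (pureState (Ψ α))) atTop := by
  refine EReal.le_of_forall_lt_iff_le.1 fun z hz => ?_
  -- For arbitrarily large `α` the energy is below `y`, which bounds `totalEnergy`; the gap `z - y`
  -- is the error allowed to the localization.
  obtain ⟨y, hy, hyz⟩ := EReal.lt_iff_exists_real_btwn.1 hz
  rw [EReal.coe_lt_coe_iff] at hyz
  obtain ⟨κ, hκ, hev⟩ := P.exists_traceForm_localize_add_le hv hv2 hV hm hVlim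
    (M := max (y + energyShift v m) 0) (sub_pos.2 hyz) (le_max_right _ _)
  obtain ⟨R₁, hR₁⟩ := eventually_atTop.1 hev
  obtain ⟨n, hn⟩ := ENNReal.exists_inv_nat_lt (ENNReal.ofReal_pos.2 hκ).ne'
  have hn0 : n ≠ 0 := by
    rintro rfl
    simp at hn
  have hfreq := (frequently_lt_of_liminf_lt (by isBoundedDefault) hy).and_eventually
    (eventually_gt_atTop 0)
  refine liminf_le_of_frequently_le' (frequently_atTop.2 fun a => ?_)
  -- All radii `4^k S` exceed the prescribed bound `a` and the threshold `R₁` of the error estimate.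
  set S := max (max a R₁) 1
  have hS : 0 < S := zero_lt_one.trans_le (le_max_right _ _)
  have h1 : ∃ᶠ α in atTop, ∃ k ∈ Finset.range n,
      traceForm (energy α V v) (localize (P.inside (4 ^ k * S)) (pureState (Ψ α))) +
        traceForm (energy α 0 v) (localize (P.outside (4 ^ k * S)) (pureState (Ψ α))) ≤ z := by
    refine hfreq.mono ?_
    rintro α ⟨hα, hα0⟩
    have hN := hΨ α hα0
    obtain ⟨k, hk, hks⟩ := exists_shellMass_le hS hn0 hN
    refine ⟨k, hk, (hR₁ _ ?_ α (Ψ α) hN ?_ (hks.trans hn.le)).trans ?_⟩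
    · exact ((le_max_right _ _).trans (le_max_left _ _)).trans
        (le_mul_of_one_le_left hS.le (one_le_pow₀ (by norm_num)))
    · rw [traceForm_energy_pureState α hv hv2 hV hm hN] at hα
      have h2 : (totalEnergy α V v m (Ψ α) : EReal) ≤ ((y + energyShift v m : ℝ) : EReal) := by
        have h3 := add_le_add_left hα.le ((energyShift v m : ℝ) : EReal)
        rwa [add_assoc, ← EReal.coe_add, neg_add_cancel, EReal.coe_zero, add_zero,
          ← EReal.coe_add] at h3
      rw [← EReal.coe_ennreal_le_coe_ennreal_iff, EReal.coe_ennreal_ofReal]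
      refine h2.trans (EReal.coe_le_coe_iff.2 ?_)
      exact (le_max_left _ _).trans (le_max_left _ _)
    · refine (add_le_add_left hα.le _).trans ?_
      rw [← EReal.coe_add, add_sub_cancel]
  -- The good shell depends on `α`, but one of the finitely many `k` is good for arbitrarily large
  -- `α`, and that suffices for the `liminf` in `α`.
  obtain ⟨k, -, hk⟩ := frequently_exists_mem_finset _ h1
  refine ⟨4 ^ k * S, ?_, liminf_le_of_frequently_le' hk⟩
  exact ((le_max_left _ _).trans (le_max_left _ _)).trans
    (le_mul_of_one_le_left hS.le (one_le_pow₀ (by norm_num)))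

/-! ### Passage to measurable representatives -/

theorem quasiMeasurePreserving_sub (d : ℕ) :
    Measure.QuasiMeasurePreserving fun r : Space d × (Space d × Conf d) => r.2.1 - r.1 := by
  have hm : Measurable fun r : Space d × (Space d × Conf d) => r.2.1 - r.1 :=
    (measurable_fst.comp measurable_snd).sub measurable_fst
  refine ⟨hm, Measure.AbsolutelyContinuous.mk fun s hs h0 => ?_⟩
  rw [Measure.map_apply hm hs, ← lintegral_indicator_one (hm hs)]
  have h := lintegral_translate_mul (measurable_one.indicator hs : Measurable
    (s.indicator (1 : Space d → ℝ≥0∞))) (measurable_one : Measurable (1 : Space d × Conf d → ℝ≥0∞))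
  rw [lintegral_indicator_one hs, h0, zero_mul] at h
  rw [← h]
  refine lintegral_congr fun r => ?_
  rw [Pi.one_apply, mul_one]
  rfl

theorem energy_congr_ae {d : ℕ} {V V' v v' : Space d → ℝ} (hV : V =ᵐ[volume] V')
    (hv : v =ᵐ[volume] v') (α : ℝ) : energy α V v = energy α V' v' := by
  funext Ψ
  have h1 : potential V Ψ = potential V' Ψ := by
    refine integral_congr_ae ?_
    filter_upwards [(Measure.quasiMeasurePreserving_fst (μ := (volume : Measure (Space d)))
      (ν := (volume : Measure (Conf d)))).ae hV] with z hz
    rw [hz]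
  have h2 : interaction α v Ψ = interaction α v' Ψ := by
    rw [interaction, interaction]
    congr 2
    refine integral_congr_ae ?_
    filter_upwards [(quasiMeasurePreserving_sub d).ae hv] with r hr
    rw [hr]
  rw [energy, energy, h1, h2]

/-- A measurable representative is truncated at the essential supremum, which changes it on a null
set only. -/
theorem exists_measurable_bounded_ae_eq {d : ℕ} {V : Space d → ℝ} (hV : MemLp V ⊤ volume) :
    ∃ V' : Space d → ℝ, Measurable V' ∧ (∃ m, ∀ x, |V' x| ≤ m) ∧ V =ᵐ[volume] V' := by
  set m := (eLpNorm V ⊤ volume).toReal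
  have hmk := hV.1.aemeasurable
  refine ⟨fun x => max (-m) (min m (hmk.mk V x)),
    measurable_const.max (measurable_const.min hmk.measurable_mk), ⟨m, fun x => ?_⟩, ?_⟩
  · have hm0 : 0 ≤ m := ENNReal.toReal_nonneg
    exact abs_le.2 ⟨le_max_left _ _, max_le (by linarith) (min_le_left _ _)⟩
  · filter_upwards [hmk.ae_eq_mk, ae_le_eLpNormEssSup (f := V) (μ := volume)] with x hx hb
    have h1 : |V x| ≤ m := by
      rw [← eLpNorm_exponent_top] at hb
      have h2 := ENNReal.toReal_mono hV.2.ne hb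
      rwa [toReal_enorm, Real.norm_eq_abs] at h2
    rw [← hx, min_eq_right (abs_le.1 h1).2, max_eq_right (abs_le.1 h1).1]

end
end Polaron

theorem proposition3p3 (d : ℕ)
    (V : Polaron.Space d → ℝ) (hV : MemLp V ∞ volume) (hVneg : ∀ᵐ x, V x < 0)
    (hVlim : Tendsto V (cocompact (Polaron.Space d) ⊓ ae volume) (𝓝 0))
    (v : Polaron.Space d → ℝ) (hv : MemLp v 2 volume)
    (P : Polaron.SmoothPartition d)
    (Ψ : ℝ → Polaron.Hil d) (hΨ : ∀ α, 0 < α → ‖Ψ α‖ = 1)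
    (C : ℝ)
    (hC : ∀ᶠ α in atTop,
      Polaron.traceForm (Polaron.energy α V v) (Polaron.pureState (Ψ α)) ≤ (C : EReal)) :
    liminf (fun R : ℝ => liminf (fun α : ℝ =>
        Polaron.traceForm (Polaron.energy α V v)
            (Polaron.localize (P.inside R) (Polaron.pureState (Ψ α))) +
          Polaron.traceForm (Polaron.energy α 0 v)
            (Polaron.localize (P.outside R) (Polaron.pureState (Ψ α)))) atTop) atTop ≤
      liminf (fun α : ℝ =>
        Polaron.traceForm (Polaron.energy α V v) (Polaron.pureState (Ψ α))) atTop := by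
  -- The energy form depends only on the classes of `V` and `v`, and the limit of `V` is taken
  -- modulo null sets, so both may be replaced by measurable representatives, that of `V` bounded
  -- everywhere.
  obtain ⟨V', hV', ⟨m, hm⟩, hVV'⟩ := Polaron.exists_measurable_bounded_ae_eq hV
  have hvmk := hv.1.aemeasurable
  simp only [Polaron.energy_congr_ae hVV' hvmk.ae_eq_mk,
    Polaron.energy_congr_ae (ae_eq_refl 0) hvmk.ae_eq_mk]
  exact P.liminf_localize_le hvmk.measurable_mk (hv.ae_eq hvmk.ae_eq_mk) hV' hm
    (hVlim.congr' (hVV'.filter_mono inf_le_right)) hΨ
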